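/- **Theorem ($L^1$ mass conservation of components in the supercritical range).** Let $n\ge 2$, $0<m<1$, let $\lambda_i>0$, $\beta_i\ge 0$ $(1\le i\le k)$, and put $m_i=\beta_i(m-1)+1$. Let $\mathbf u=(u^1,\dots,u^k)$ be a weak solution in $\mathbb R^n\times(0,\infty)$ of $$(u^i)_t=\nabla\cdot\big(mU^{m-1}\mathcal A(\nabla u^i,u^i,x,t)+\mathcal B(u^i,x,t)\big),\qquad 1\le i\le k,\qquad U=U(u^1,\dots,u^k),$$ with initial data $\mathbf u_0=(u_0^1,\dots,u_0^k)$, where every $u^i_0$ is nonnegative, integrable and compactly supported. *Weak solution* means: $u^i$ has a weak spatial gradient, both being locally integrable in $\mathbb R^n\times(0,\infty)$; $U^{m-1}|\mathcal A(\nabla u^i,u^i,x,t)|\in L^2(\mathbb R^n\times(0,T))$ for all $T>0$; $\mathcal B(u^i,x,t)$ is locally integrable; $$\int_0^\infty\!\!\int_{\mathbb R^n}\Big\{\big(mU^{m-1}\mathcal A(\nabla u^i,u^i,x,t)+\mathcal B(u^i,x,t)\big)\cdot\nabla\varphi-u^i\varphi_t\Big\}\,dx\,dt=0\qquad\forall\varphi\in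 C_c^\infty(\mathbb R^n\times(0,\infty));$$ and, for the chosen representative, $u^i(\cdot,t)\in L^1_{loc}(\mathbb R^n)$ for every $t>0$, the map $t\mapsto u^i(\cdot,t)$ is continuous on $(0,\infty)$ in the sense of distributions, and $u^i(\cdot,t)\to u^i_0$ in that sense as $t\to0^+$. (Where $U=0$, $U^{m-1}\mathcal A$ is read as $0$.) Assume that $\mathcal A(p,z,x,t)$, $\mathcal B(z,x,t)$ $(z\ge 0)$ are measurable in $(x,t)$ and, for a.e. $(x,t)$, continuous in $(p,z)$, resp. $z$; that $U$ is continuous on $[0,\infty)^k$ and its partial derivatives $U_{\xi^i}$ exist where $\xi^i>0$ (at $\xi^i=0$ derivatives are one-sided, read as $0$ if they do not exist); and that for constants $\mathbf c>0$, $\mathbf C_1,\dots,\mathbf C_5\ge0$, $q\in\mathbb R$: * $u^i\ge0$ and $\lambda_i(u^i)^{\beta_i}\le U$ a.e., for all $i$; * (A1) $U^mU_{u^i}\in L^2(a,b;H^1(\mathbb R^n))$ for all $0<a<b<\infty$ and all $i$; * (A2) $U(0)=0$, $\sum_i|U_{\xi^i}(\xi)\xi^i|\le\mathbf C_1U(\xi)$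 and $U_{\xi^i}(\xi)\ge0$ for all $\xi\in[0,\infty)^k$; * (A3) the functions $U_{u^i}$ have locally integrable weak spatial gradients and $\sum_i\big(mU^{m-1}\mathcal A(\nabla u^i,u^i,x,t)+\mathcal B(u^i,x,t)\big)\cdot\nabla U_{u^i}\ge0$ a.e.; * (A4) $U$ has a locally integrable weak spatial gradient and $\nabla U\cdot\sum_iU_{u^i}\mathcal A(\nabla u^i,u^i,x,t)\ge\mathbf c|\nabla U|^2-\mathbf C_2U^2$ a.e.; * (A5)–(A7) for a.e. $(x,t)$ and all $p\in\mathbb R^n$, $z\ge0$: $\mathcal A(p,z,x,t)\cdot p\ge\mathbf c|p|^2-\mathbf C_2z^2$, $|\mathcal A(p,z,x,t)|\le\mathbf C_3|p|+\mathbf C_4z$, $|\mathcal B(z,x,t)|\le\mathbf C_5z^q$. In (A1), (A3), (A4), $U$ and $U_{u^i}$ are regarded as functions of $(x,t)$ through $\mathbf u(x,t)$, and they (and $U^mU_{u^i}$) are locally integrable in $\mathbb R^n\times(0,\infty)$. Suppose that $\mathbf C_5=0$ and that there are constants $R^*,\Lambda$ with $U(x,t)\le\Lambda$ for a.e. $(x,t)$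 with $|x|\ge R^*$, $t>0$. Then, for each $i$ with $$\frac{n^2+n+4+\sqrt{2n(7n+11)}}{n^2+5n+8}<m_i<1,$$ for every $t>0$ the function $u^i(\cdot,t)$ is integrable and $$\int_{\mathbb R^n}u^i(x,t)\,dx=\int_{\mathbb R^n}u^i_0(x)\,dx .$$ Moreover, if $\mathbf C_2=\mathbf C_4=0$, the same conclusion holds for each $i$ with $$\frac{n^2-n+3+\sqrt{7n^2+2n-7}}{n^2+2n+4}<m_i<1.$$ -/

import Mathlib

open MeasureTheory Set Filter Topology
open scoped ContDiff

namespace ParabolicSystem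

/-- Euclidean space `ℝⁿ`. -/
abbrev Space (n : ℕ) : Type := EuclideanSpace ℝ (Fin n)

/-- The space-time domain `ℝⁿ × (0, ∞)`; a point is a pair `(x, t)`. -/
def domain (n : ℕ) : Set (Space n × ℝ) := univ ×ˢ Ioi 0

/-- The slab `ℝⁿ × (a, b)`. -/
def slab (n : ℕ) (a b : ℝ) : Set (Space n × ℝ) := univ ×ˢ Ioo a b

/-- The spatial gradient `∇φ(x, t)` of a smooth function. -/
noncomputable def gradX {n : ℕ} (φ : Space n × ℝ → ℝ) (z : Space n × ℝ) : Space n :=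
  gradient (fun x : Space n => φ (x, z.2)) z.1

/-- The time derivative `φ_t(x, t)` of a smooth function. -/
noncomputable def derivT {n : ℕ} (φ : Space n × ℝ → ℝ) (z : Space n × ℝ) : ℝ :=
  deriv (fun s : ℝ => φ (z.1, s)) z.2

/-- Test functions: `φ ∈ C_c^∞(ℝⁿ × (0, ∞))`. -/
structure IsTest {n : ℕ} (φ : Space n × ℝ → ℝ) : Prop where
  smooth : ContDiff ℝ ∞ φ
  compact : HasCompactSupport φ
  support : tsupport φ ⊆ domain n

/-- `g` is the weak spatial gradient of `f` in `ℝⁿ × (0, ∞)`; both are locally integrable there. -/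
structure HasWeakGrad {n : ℕ} (f : Space n × ℝ → ℝ) (g : Space n × ℝ → Space n) : Prop where
  locInt : LocallyIntegrableOn f (domain n)
  locInt_grad : LocallyIntegrableOn g (domain n)
  byParts : ∀ φ : Space n × ℝ → ℝ, IsTest φ →
    ∫ z in domain n, f z • gradX φ z = - ∫ z in domain n, φ z • g z

/-- The data of the system
`(uⁱ)_t = ∇ · (m U^{m-1} A(∇uⁱ, uⁱ, x, t) + B(uⁱ, x, t))`, `1 ≤ i ≤ k`, in `ℝⁿ × (0, ∞)`,
with `U = U(u¹, …, u^k)`, together with the numbers in the lower bounds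
`lam i * (uⁱ)^(beta i) ≤ U` and the constants of the structure conditions.
Only the values of `U` on `[0, ∞)^k` and those of `A(p, z, x, t)`, `B(z, x, t)` for `z ≥ 0`
matter. -/
structure Data (n k : ℕ) where
  m : ℝ
  U : (Fin k → ℝ) → ℝ
  A : Space n → ℝ → Space n → ℝ → Space n
  B : ℝ → Space n → ℝ → Space n
  lam : Fin k → ℝ
  beta : Fin k → ℝ
  c : ℝ
  C₁ : ℝ
  C₂ : ℝ
  C₃ : ℝ
  C₄ : ℝ
  C₅ : ℝ
  q : ℝ

namespace Data

variable {n k : ℕ}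

/-- The partial derivative `U_{ξ^i}(ξ)` of `U : [0, ∞)^k → ℝ` (one-sided where `ξ^i = 0`). -/
noncomputable def partialU (S : Data n k) (i : Fin k) (ξ : Fin k → ℝ) : ℝ :=
  derivWithin (fun s : ℝ => S.U (Function.update ξ i s)) (Ici 0) (ξ i)

/-- The function `U(x, t) = U(u¹(x, t), …, u^k(x, t))`. -/
def Uval (S : Data n k) (u : Fin k → Space n × ℝ → ℝ) (z : Space n × ℝ) : ℝ :=
  S.U (fun j => u j z)

/-- The function `U_{u^i}(u¹(x, t), …, u^k(x, t))`. -/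
noncomputable def partialUval (S : Data n k) (u : Fin k → Space n × ℝ → ℝ) (i : Fin k)
    (z : Space n × ℝ) : ℝ :=
  S.partialU i (fun j => u j z)

/-- The vector `A(∇uⁱ, uⁱ, x, t)`, where `Du i` is the weak gradient of `u i`. -/
def Aval (S : Data n k) (u : Fin k → Space n × ℝ → ℝ) (Du : Fin k → Space n × ℝ → Space n)
    (i : Fin k) (z : Space n × ℝ) : Space n :=
  S.A (Du i z) (u i z) z.1 z.2

/-- The flux `m U^{m-1} A(∇uⁱ, uⁱ, x, t) + B(uⁱ, x, t)`. For `m < 1` the real power gives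
`U^{m-1} = 0` where `U = 0`; this is the usual convention that the first summand vanishes there,
since `U = 0` forces `uⁱ = 0`, hence `∇uⁱ = 0` a.e. and `A = 0` by the growth condition. -/
noncomputable def flux (S : Data n k) (u : Fin k → Space n × ℝ → ℝ)
    (Du : Fin k → Space n × ℝ → Space n) (i : Fin k) (z : Space n × ℝ) : Space n :=
  (S.m * S.Uval u z ^ (S.m - 1)) • S.Aval u Du i z + S.B (u i z) z.1 z.2

/-- The conditions on the coefficient functions alone: the signs of the constants, the Carathéodory
property of `A` and `B`, the monotonicity and natural growth of `U`, and the coercivity and growth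
conditions on `A` and `B`. -/
structure Structural (S : Data n k) : Prop where
  lam_pos : ∀ i, 0 < S.lam i
  beta_nonneg : ∀ i, 0 ≤ S.beta i
  c_pos : 0 < S.c
  C₁_nonneg : 0 ≤ S.C₁
  C₂_nonneg : 0 ≤ S.C₂
  C₃_nonneg : 0 ≤ S.C₃
  C₄_nonneg : 0 ≤ S.C₄
  C₅_nonneg : 0 ≤ S.C₅
  A_meas : ∀ (p : Space n) (z : ℝ), 0 ≤ z →
    AEStronglyMeasurable (fun y : Space n × ℝ => S.A p z y.1 y.2) (volume.restrict (domain n))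
  A_cont : ∀ᵐ y ∂volume.restrict (domain n),
    ContinuousOn (fun w : Space n × ℝ => S.A w.1 w.2 y.1 y.2) (univ ×ˢ Ici 0)
  B_meas : ∀ z : ℝ, 0 ≤ z →
    AEStronglyMeasurable (fun y : Space n × ℝ => S.B z y.1 y.2) (volume.restrict (domain n))
  B_cont : ∀ᵐ y ∂volume.restrict (domain n),
    ContinuousOn (fun z : ℝ => S.B z y.1 y.2) (Ici 0)
  U_cont : ContinuousOn S.U {ξ | ∀ j, 0 ≤ ξ j}
  U_diff : ∀ (i : Fin k) (ξ : Fin k → ℝ), (∀ j, 0 ≤ ξ j) → 0 < ξ i →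
    DifferentiableAt ℝ (fun s : ℝ => S.U (Function.update ξ i s)) (ξ i)
  U_zero : S.U 0 = 0
  U_growth : ∀ ξ : Fin k → ℝ, (∀ j, 0 ≤ ξ j) →
    ∑ i, |S.partialU i ξ * ξ i| ≤ S.C₁ * S.U ξ
  U_mono : ∀ (i : Fin k) (ξ : Fin k → ℝ), (∀ j, 0 ≤ ξ j) → 0 ≤ S.partialU i ξ
  A_coercive : ∀ᵐ y ∂volume.restrict (domain n), ∀ (p : Space n) (z : ℝ), 0 ≤ z →
    S.c * ‖p‖ ^ 2 - S.C₂ * z ^ 2 ≤ inner ℝ (S.A p z y.1 y.2) p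
  A_growth : ∀ᵐ y ∂volume.restrict (domain n), ∀ (p : Space n) (z : ℝ), 0 ≤ z →
    ‖S.A p z y.1 y.2‖ ≤ S.C₃ * ‖p‖ + S.C₄ * z
  B_growth : ∀ᵐ y ∂volume.restrict (domain n), ∀ z : ℝ, 0 ≤ z →
    ‖S.B z y.1 y.2‖ ≤ S.C₅ * z ^ S.q

/-- The conditions that involve the solution: `uⁱ ≥ 0` and `lam i * (uⁱ)^(beta i) ≤ U`; the
regularity of `U^m U_{uⁱ}`; `∑ᵢ (m U^{m-1} A(∇uⁱ, uⁱ, x, t) + B(uⁱ, x, t)) · ∇U_{uⁱ} ≥ 0`;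
and `∇U · ∑ᵢ U_{uⁱ} A(∇uⁱ, uⁱ, x, t) ≥ c |∇U|² - C₂ U²`. -/
structure Compatible (S : Data n k) (u : Fin k → Space n × ℝ → ℝ)
    (Du : Fin k → Space n × ℝ → Space n) : Prop where
  nonneg : ∀ i, ∀ᵐ z ∂volume.restrict (domain n), 0 ≤ u i z
  lower : ∀ i, ∀ᵐ z ∂volume.restrict (domain n), S.lam i * u i z ^ S.beta i ≤ S.Uval u z
  regular : ∀ i, ∃ V : Space n × ℝ → Space n,
    HasWeakGrad (fun z => S.Uval u z ^ S.m * S.partialUval u i z) V ∧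
    ∀ a b : ℝ, 0 < a → a < b →
      MemLp (fun z => S.Uval u z ^ S.m * S.partialUval u i z) 2 (volume.restrict (slab n a b)) ∧
      MemLp V 2 (volume.restrict (slab n a b))
  monotone : ∃ W : Fin k → Space n × ℝ → Space n,
    (∀ i, HasWeakGrad (S.partialUval u i) (W i)) ∧
    ∀ᵐ z ∂volume.restrict (domain n), 0 ≤ ∑ i, inner ℝ (S.flux u Du i z) (W i z)
  coercive : ∃ G : Space n × ℝ → Space n, HasWeakGrad (S.Uval u) G ∧
    ∀ᵐ z ∂volume.restrict (domain n),
      S.c * ‖G z‖ ^ 2 - S.C₂ * S.Uval u z ^ 2 ≤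
        inner ℝ (G z) (∑ i, S.partialUval u i z • S.Aval u Du i z)

/-- `u = (u¹, …, u^k)`, with weak gradients `Du`, is a weak (energy) solution in `ℝⁿ × (0, ∞)`
with initial data `u₀`. So that `u i (·, t)` is meaningful for every `t > 0`, the representative
is the one for which `t ↦ u i (·, t)` is continuous in the sense of distributions; the initial data
are attained in the same sense. -/
structure IsWeakSolution (S : Data n k) (u : Fin k → Space n × ℝ → ℝ)
    (Du : Fin k → Space n × ℝ → Space n) (u₀ : Fin k → Space n → ℝ) : Prop where
  weakGrad : ∀ i, HasWeakGrad (u i) (Du i)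
  energy : ∀ (i : Fin k) (T : ℝ), 0 < T →
    MemLp (fun z => S.Uval u z ^ (S.m - 1) * ‖S.Aval u Du i z‖) 2 (volume.restrict (slab n 0 T))
  locInt_B : ∀ i, LocallyIntegrableOn (fun z => S.B (u i z) z.1 z.2) (domain n)
  equation : ∀ (i : Fin k) (φ : Space n × ℝ → ℝ), IsTest φ →
    ∫ z in domain n, (inner ℝ (S.flux u Du i z) (gradX φ z) - u i z * derivT φ z) = 0
  slice : ∀ (i : Fin k) (t : ℝ), 0 < t → LocallyIntegrable (fun x : Space n => u i (x, t))
  time_cont : ∀ (i : Fin k) (ζ : Space n → ℝ), ContDiff ℝ ∞ ζ → HasCompactSupport ζ →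
    ContinuousOn (fun t : ℝ => ∫ x, u i (x, t) * ζ x) (Ioi 0)
  initial : ∀ (i : Fin k) (ζ : Space n → ℝ), ContDiff ℝ ∞ ζ → HasCompactSupport ζ →
    Tendsto (fun t : ℝ => ∫ x, u i (x, t) * ζ x) (𝓝[>] 0) (𝓝 (∫ x, u₀ i x * ζ x))

/-- The exponent `m_i = β_i (m - 1) + 1`. -/
def mexp (S : Data n k) (i : Fin k) : ℝ := S.beta i * (S.m - 1) + 1

end Data

/-- `L¹` mass conservation: for every `t > 0` the function `v(·, t)` is integrable and its
integral is that of `v₀`. -/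
def MassConserved {n : ℕ} (v : Space n × ℝ → ℝ) (v₀ : Space n → ℝ) : Prop :=
  ∀ t : ℝ, 0 < t → Integrable (fun x : Space n => v (x, t)) ∧ ∫ x, v (x, t) = ∫ x, v₀ x

end ParabolicSystem

/-! Write `v` for one component, `F` for its flux and `μ` for `m_i`. Since `C₅ = 0`, the equation is
`v_t = ∇ · F` with `F` square integrable on every slab `ℝⁿ × (0, T)`. Testing with a cutoff of the
ball of radius `R` shows that the mass inside the ball differs from the initial mass by at most
`D/R` times the integral of `|F|` over the annulus `R ≤ |x| ≤ 2R` (`FluxSolution.mass_balance`,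
`FluxSolution.abs_flux_integral_le`). Conservation follows once this boundary term tends to zero.

The core is `ExteriorLaw.fluxBound`: the integral of `|F|` over the annulus and `(0, T)` is at most
`C R^(n(1-μ)) (M + 1)`, where `M` is the space-time mass in `B_{4R} × (0, T+1)`. After division by
`R` this gains `R^(-ϑ)` with `ϑ = 1 - n(1-μ)`, positive exactly when `μ > 1 - 1/n`. The square
integrability of `F` alone gives `M = O(R^n)`. Inserting a growth rate `R^a` of the mass into the
balance improves it to `R^max(a-ϑ, 0)`, so finitely many rounds reach bounded mass
(`FluxSolution.massGrowth_zero`), and then the boundary term is `O(R^(-ϑ))`.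

For the flux bound the equation is tested with `((v+δ)^(1-μ) - δ^(1-μ)) η² θ`, where `η` lives on an
annulus outside the support of the datum. There `F = w A`, and `λ v^β ≤ U` gives `w ≤ W v^(μ-1)`;
the power `1 - μ` is the one for which the error terms become linear in `v`, that is, mass. Young's
inequality then bounds `|F|` by the energy production plus `v + σ`, at the price `σ^(μ-1)`; the
choice `σ = R^(-n)` makes the contribution of `σ` bounded. The bound `U ≤ Λ` far out keeps `w` away
from zero, so that `∇v` is locally square integrable there and the energy identity, proved by
mollification, is legitimate. Both thresholds of the theorem are at least `1 - 1/n`, so a single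
argument serves both cases. -/

namespace ParabolicSystem

set_option linter.unusedSectionVars false

/-! ### Mollification and dominated convergence. -/

section Mollify

variable {E : Type*} [NormedAddCommGroup E] [NormedSpace ℝ E] [FiniteDimensional ℝ E]
  [MeasurableSpace E] [BorelSpace E]

/-- Dominated convergence with a convergent sequence of dominating functions. -/
theorem tendsto_integral_of_dominated_seq {α : Type*} [MeasurableSpace α] {μ : Measure α}
    {f : ℕ → α → ℝ} {g : α → ℝ} {H : ℕ → α → ℝ} {h : α → ℝ}
    (hf : ∀ k, AEStronglyMeasurable (f k) μ)
    (hH : ∀ k, Integrable (H k) μ) (hh : Integrable h μ)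
    (hfH : ∀ k, ∀ᵐ x ∂μ, |f k x| ≤ H k x)
    (hfg : ∀ᵐ x ∂μ, Tendsto (fun k => f k x) atTop (𝓝 (g x)))
    (hHh : ∀ᵐ x ∂μ, Tendsto (fun k => H k x) atTop (𝓝 (h x)))
    (hint : Tendsto (fun k => ∫ x, H k x ∂μ) atTop (𝓝 (∫ x, h x ∂μ))) :
    Tendsto (fun k => ∫ x, f k x ∂μ) atTop (𝓝 (∫ x, g x ∂μ)) := by
  have hall : ∀ᵐ x ∂μ, ∀ k, |f k x| ≤ H k x := ae_all_iff.2 hfH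
  have hgh : ∀ᵐ x ∂μ, |g x| ≤ h x := by
    filter_upwards [hall, hfg, hHh] with x h1 h2 h3
    exact le_of_tendsto_of_tendsto' h2.abs h3 h1
  have hh0 : ∀ᵐ x ∂μ, 0 ≤ h x := hgh.mono fun x hx => (abs_nonneg _).trans hx
  have hfi : ∀ k, Integrable (f k) μ := fun k => (hH k).mono' (hf k) (hfH k)
  -- clipped functions
  have h1 : Tendsto (fun k => ∫ x, max (-h x) (min (f k x) (h x)) ∂μ) atTop (𝓝 (∫ x, g x ∂μ)) := by
    refine tendsto_integral_of_dominated_convergence h ?_ hh ?_ ?_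
    · exact fun k => (hh.neg.aestronglyMeasurable.sup ((hf k).inf hh.aestronglyMeasurable))
    · intro k
      filter_upwards [hh0] with x hx
      rw [Real.norm_eq_abs, abs_le]
      exact ⟨le_max_left _ _, max_le (by linarith) (min_le_right _ _)⟩
    · filter_upwards [hgh, hfg] with x h1 h2
      have : max (-h x) (min (g x) (h x)) = g x := by
        rw [min_eq_left ((le_abs_self _).trans h1), max_eq_right (abs_le.1 h1).1]
      conv => rhs; rw [← this]
      exact tendsto_const_nhds.max (h2.min tendsto_const_nhds)
  have hmini : ∀ k, Integrable (fun x => min (H k x) (h x)) μ := fun k => (hH k).inf hh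
  have h2 : Tendsto (fun k => ∫ x, min (H k x) (h x) ∂μ) atTop (𝓝 (∫ x, h x ∂μ)) := by
    refine tendsto_integral_of_dominated_convergence h (fun k => (hmini k).aestronglyMeasurable)
      hh ?_ ?_
    · intro k
      filter_upwards [hh0, hfH k] with x hx hx2
      rw [Real.norm_eq_abs, abs_of_nonneg (le_min ((abs_nonneg _).trans hx2) hx)]
      exact min_le_right _ _
    · filter_upwards [hHh] with x hx
      simpa using hx.min (tendsto_const_nhds (x := h x))
  -- The excess of `f k` over its clip to `[-h, h]` is at most `H k - min (H k) h`. Its integral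
  -- vanishes in the limit because both integrals tend to that of `h`.
  have h3 : Tendsto (fun k => ∫ x, (H k x - min (H k x) (h x)) ∂μ) atTop (𝓝 0) := by
    have := hint.sub h2
    simp only [sub_self] at this
    refine this.congr fun k => ?_
    rw [integral_sub (hH k) (hmini k)]
  have hci : ∀ k, Integrable (fun x => max (-h x) (min (f k x) (h x))) μ :=
    fun k => hh.neg.sup ((hfi k).inf hh)
  have h4 : Tendsto (fun k => ∫ x, f k x ∂μ - ∫ x, max (-h x) (min (f k x) (h x)) ∂μ)
      atTop (𝓝 0) := by
    refine squeeze_zero_norm (fun k => ?_) h3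
    rw [← integral_sub (hfi k) (hci k)]
    refine norm_integral_le_of_norm_le ((hH k).sub (hmini k)) ?_
    filter_upwards [hh0, hfH k] with x hx hx2
    rw [Real.norm_eq_abs]
    rw [abs_le] at hx2
    rw [abs_le]
    constructor <;> rcases le_total (H k x) (h x) with h5 | h5 <;>
      rcases le_total (f k x) (h x) with h6 | h6 <;>
      rcases le_total (-h x) (f k x) with h7 | h7 <;>
      simp only [min_eq_left, min_eq_right, max_eq_left, max_eq_right, h5, h6, h7,
        neg_le_self hx] <;> linarith [hx2.1, hx2.2]
  simpa using h4.add h1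

/-- The sequence of smooth bump functions used for mollification. -/
noncomputable def bump (E : Type*) [NormedAddCommGroup E] (k : ℕ) : ContDiffBump (0 : E) where
  rIn := 1 / ((k : ℝ) + 1)
  rOut := 2 / ((k : ℝ) + 1)
  rIn_pos := by positivity
  rIn_lt_rOut := by gcongr; norm_num

theorem bump_rOut_tendsto : Tendsto (fun k => (bump E k).rOut) atTop (𝓝 0) := by
  have := (tendsto_one_div_add_atTop_nhds_zero_nat (𝕜 := ℝ)).const_mul 2
  simpa [bump, div_eq_mul_inv] using this

/-- Mollification of a function. -/
noncomputable def mollify (μ : Measure E) (k : ℕ) (f : E → ℝ) (x : E) : ℝ :=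
  ∫ w, (bump E k).normed μ (x - w) * f w ∂μ

variable {μ : Measure E} [μ.IsAddHaarMeasure]

theorem mollify_eq_convolution (k : ℕ) (f : E → ℝ) :
    mollify μ k f = MeasureTheory.convolution ((bump E k).normed μ) f
      (ContinuousLinearMap.lsmul ℝ ℝ) μ := by
  ext x
  rw [convolution_eq_swap]
  simp [mollify]

theorem kernel_mul_integrable (k : ℕ) {f : E → ℝ} (hf : LocallyIntegrable f μ) (x : E) :
    Integrable (fun w => (bump E k).normed μ (x - w) * f w) μ := by
  have hc : HasCompactSupport (fun w => (bump E k).normed μ (x - w)) :=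
    ((bump E k).hasCompactSupport_normed (μ := μ)).comp_homeomorph (Homeomorph.subLeft x)
  exact hf.integrable_smul_left_of_hasCompactSupport
    ((bump E k).continuous_normed.comp (continuous_const.sub continuous_id)) hc

theorem kernel_integral (k : ℕ) (x : E) : ∫ w, (bump E k).normed μ (x - w) ∂μ = 1 := by
  rw [integral_sub_left_eq_self (fun w => (bump E k).normed μ w) μ x]
  exact (bump E k).integral_normed

theorem kernel_integrable (k : ℕ) (x : E) :
    Integrable (fun w => (bump E k).normed μ (x - w)) μ := by
  simpa using kernel_mul_integrable k (locallyIntegrable_const (1 : ℝ)) x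

theorem mollify_contDiff (k : ℕ) {f : E → ℝ} (hf : LocallyIntegrable f μ) :
    ContDiff ℝ ∞ (mollify μ k f) := by
  rw [mollify_eq_convolution]
  exact (bump E k).hasCompactSupport_normed.contDiff_convolution_left _
    (bump E k).contDiff_normed hf

theorem mollify_ae_tendsto {f : E → ℝ} (hf : LocallyIntegrable f μ) :
    ∀ᵐ x ∂μ, Tendsto (fun k => mollify μ k f x) atTop (𝓝 (f x)) := by
  -- The value `K = 2` is the fixed ratio of outer to inner radius of `bump`; a bounded ratio is
  -- what Lebesgue differentiation requires of the kernels.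
  have := ContDiffBump.ae_convolution_tendsto_right_of_locallyIntegrable
    (φ := fun k => bump E k) (l := atTop) (K := 2) bump_rOut_tendsto
    (Eventually.of_forall fun k => by simp [bump]; field_simp; rfl) hf
  filter_upwards [this] with x hx
  simpa only [mollify_eq_convolution] using hx

theorem mollify_mono (k : ℕ) {f g : E → ℝ} (hf : LocallyIntegrable f μ)
    (hg : LocallyIntegrable g μ) (hfg : ∀ᵐ x ∂μ, f x ≤ g x) (x : E) :
    mollify μ k f x ≤ mollify μ k g x := by
  refine integral_mono_ae (kernel_mul_integrable k hf x) (kernel_mul_integrable k hg x) ?_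
  filter_upwards [hfg] with w hw
  exact mul_le_mul_of_nonneg_left hw ((bump E k).nonneg_normed _)

theorem mollify_const (k : ℕ) (c : ℝ) (x : E) : mollify μ k (fun _ => c) x = c := by
  rw [mollify, integral_mul_const, kernel_integral, one_mul]

theorem mollify_abs_le (k : ℕ) {f : E → ℝ} (x : E) :
    |mollify μ k f x| ≤ mollify μ k (fun y => |f y|) x := by
  refine (abs_integral_le_integral_abs).trans (le_of_eq ?_)
  refine integral_congr_ae (Eventually.of_forall fun w => ?_)
  simp only [abs_mul, abs_of_nonneg ((bump E k).nonneg_normed (μ := μ) _)]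

/-- Jensen's inequality for the square: the kernel is a probability density, and the variance of `f`
under it is nonnegative. -/
theorem mollify_sq_le (k : ℕ) {f : E → ℝ} (hf : LocallyIntegrable f μ)
    (hf2 : LocallyIntegrable (fun x => f x ^ 2) μ) (x : E) :
    mollify μ k f x ^ 2 ≤ mollify μ k (fun y => f y ^ 2) x := by
  set c := mollify μ k f x with hc
  have h0 : 0 ≤ ∫ w, (bump E k).normed μ (x - w) * (f w - c) ^ 2 ∂μ :=
    integral_nonneg fun w => mul_nonneg ((bump E k).nonneg_normed _) (sq_nonneg _)
  have h1 : ∫ w, (bump E k).normed μ (x - w) * (f w - c) ^ 2 ∂μ =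
      mollify μ k (fun y => f y ^ 2) x - 2 * c * mollify μ k f x + c ^ 2 := by
    have e : ∀ w, (bump E k).normed μ (x - w) * (f w - c) ^ 2 =
        (bump E k).normed μ (x - w) * f w ^ 2 - 2 * c * ((bump E k).normed μ (x - w) * f w) +
          (bump E k).normed μ (x - w) * c ^ 2 := fun w => by ring
    simp_rw [e]
    rw [integral_add, integral_sub, integral_mul_const, kernel_integral, integral_const_mul,
      one_mul]
    · rfl
    · exact kernel_mul_integrable k hf2 x
    · exact (kernel_mul_integrable k hf x).const_mul _
    · exact (kernel_mul_integrable k hf2 x).sub ((kernel_mul_integrable k hf x).const_mul _)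
    · exact (kernel_integrable k x).mul_const _
  rw [h1, ← hc] at h0
  nlinarith

theorem mollify_integrable (k : ℕ) {f : E → ℝ} (hf : Integrable f μ) :
    Integrable (mollify μ k f) μ := by
  rw [mollify_eq_convolution]
  exact ((bump E k).integrable_normed).integrable_convolution _ hf

theorem mollify_integral (k : ℕ) {f : E → ℝ} (hf : Integrable f μ) :
    ∫ x, mollify μ k f x ∂μ = ∫ x, f x ∂μ := by
  rw [mollify_eq_convolution, integral_convolution _ (bump E k).integrable_normed hf,
    (bump E k).integral_normed]
  simp

theorem mollify_fderiv (k : ℕ) {f : E → ℝ} (hf : LocallyIntegrable f μ) (x v : E) :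
    fderiv ℝ (mollify μ k f) x v = ∫ w, fderiv ℝ ((bump E k).normed μ) (x - w) v * f w ∂μ := by
  have hd := ((bump E k).hasCompactSupport_normed (μ := μ)).hasFDerivAt_convolution_left
    (ContinuousLinearMap.lsmul ℝ ℝ) ((bump E k).contDiff_normed (n := 1)) hf x
  rw [mollify_eq_convolution, hd.fderiv, convolution_eq_swap]
  rw [ContinuousLinearMap.integral_apply]
  · rfl
  · have hc : HasCompactSupport (fun w => fderiv ℝ ((bump E k).normed μ) (x - w)) :=
      (((bump E k).hasCompactSupport_normed (μ := μ)).fderiv ℝ).comp_homeomorph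
        (Homeomorph.subLeft x)
    have hcont : Continuous (fun w => fderiv ℝ ((bump E k).normed μ) (x - w)) :=
      (((bump E k).contDiff_normed (n := 1)).continuous_fderiv one_ne_zero).comp
        (continuous_const.sub continuous_id)
    have := hf.integrable_smul_right_of_hasCompactSupport hcont hc
    refine this.congr (Eventually.of_forall fun w => ?_)
    ext v
    simp [ContinuousLinearMap.precompL_apply, mul_comm]

end Mollify

end ParabolicSystem

namespace ParabolicSystem

set_option linter.unusedSectionVars false

/-! ### Weak derivatives, the chain rule and the energy identity. -/

section WeakDerivative

variable {E : Type*} [NormedAddCommGroup E] [NormedSpace ℝ E] [FiniteDimensional ℝ E]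
  [MeasurableSpace E] [BorelSpace E]

/-- Smooth functions with compact support in `O`. -/
structure TestOn (O : Set E) (φ : E → ℝ) : Prop where
  smooth : ContDiff ℝ ∞ φ
  compact : HasCompactSupport φ
  support : tsupport φ ⊆ O

/-- `g` is the weak derivative of `f` in the direction `v` on the set `O`. -/
def HasWeakDeriv (μ : Measure E) (O : Set E) (v : E) (f g : E → ℝ) : Prop :=
  ∀ φ : E → ℝ, TestOn O φ → ∫ z, f z * fderiv ℝ φ z v ∂μ = - ∫ z, φ z * g z ∂μ

variable {μ : Measure E} [μ.IsAddHaarMeasure] {O K : Set E}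

theorem TestOn.mono {O' : Set E} {φ : E → ℝ} (h : TestOn O φ) (hO : O ⊆ O') : TestOn O' φ :=
  ⟨h.smooth, h.compact, h.support.trans hO⟩

theorem TestOn.eq_zero {φ : E → ℝ} (h : TestOn O φ) {z : E} (hz : z ∉ O) : φ z = 0 :=
  image_eq_zero_of_notMem_tsupport fun hz' => hz (h.support hz')

theorem TestOn.continuous_fderiv {φ : E → ℝ} (h : TestOn O φ) (v : E) :
    Continuous fun z => fderiv ℝ φ z v :=
  (h.smooth.continuous_fderiv (by simp)).clm_apply continuous_const

theorem TestOn.hasCompactSupport_fderiv {φ : E → ℝ} (h : TestOn O φ) (v : E) :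
    HasCompactSupport fun z => fderiv ℝ φ z v := by
  refine (h.compact.fderiv ℝ).mono ?_
  intro z hz hz'
  apply hz
  simp [hz']

theorem fderiv_eq_zero_of_notMem_tsupport {φ : E → ℝ} (v : E) {z : E}
    (hz : z ∉ tsupport φ) : fderiv ℝ φ z v = 0 := by
  have : fderiv ℝ φ z = 0 := by
    by_contra hne
    exact hz (support_fderiv_subset ℝ hne)
  simp [this]

/-- Room for mollification: eventually every kernel centred in the support of `φ` lives in one
compact `K ⊆ O`. Functions that are only locally integrable on `O` may then be cut off to `K` and
mollified on the whole space. -/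
theorem TestOn.exists_compact {φ : E → ℝ} (h : TestOn O φ) (hO : IsOpen O) :
    ∃ K : Set E, IsCompact K ∧ K ⊆ O ∧ tsupport φ ⊆ K ∧
      ∀ᶠ k in atTop, ∀ z ∈ tsupport φ, Metric.closedBall z (bump E k).rOut ⊆ K := by
  obtain ⟨r, hr, hrO⟩ := h.compact.isCompact.exists_cthickening_subset_open hO h.support
  refine ⟨Metric.cthickening r (tsupport φ), h.compact.isCompact.cthickening, hrO,
    Metric.self_subset_cthickening _, ?_⟩
  filter_upwards [(bump_rOut_tendsto (E := E)).eventually (gt_mem_nhds hr)] with k hk z hz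
  exact (Metric.closedBall_subset_closedBall hk.le).trans
    (Metric.closedBall_subset_cthickening hz r)

theorem testOn_kernel (k : ℕ) {z : E} (hz : Metric.closedBall z (bump E k).rOut ⊆ O) :
    TestOn O (fun w => (bump E k).normed μ (z - w)) := by
  refine ⟨(bump E k).contDiff_normed.comp (contDiff_const.sub contDiff_id),
    ((bump E k).hasCompactSupport_normed (μ := μ)).comp_homeomorph (Homeomorph.subLeft z), ?_⟩
  refine subset_trans ?_ hz
  refine closure_minimal ?_ Metric.isClosed_closedBall
  intro w hw
  have : z - w ∈ Function.support ((bump E k).normed μ) := hw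
  rw [(bump E k).support_normed_eq] at this
  simp only [Metric.mem_ball, Metric.mem_closedBall, dist_eq_norm] at this ⊢
  rw [norm_sub_rev]
  simpa using this.le

theorem fderiv_kernel (k : ℕ) (z w v : E) :
    fderiv ℝ (fun w => (bump E k).normed μ (z - w)) w v =
      - fderiv ℝ ((bump E k).normed μ) (z - w) v := by
  have h1 : HasFDerivAt ((bump E k).normed μ) (fderiv ℝ ((bump E k).normed μ) (z - w)) (z - w) :=
    (((bump E k).contDiff_normed (n := 1)).differentiable one_ne_zero _).hasFDerivAt
  have h2 : HasFDerivAt (fun w : E => z - w) (-ContinuousLinearMap.id ℝ E) w :=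
    (hasFDerivAt_id w).const_sub z
  have h3 : HasFDerivAt (fun w => (bump E k).normed μ (z - w)) _ w := h1.comp w h2
  rw [h3.fderiv]
  simp

theorem integral_kernel_indicator (k : ℕ) {z : E}
    (hz : Metric.closedBall z (bump E k).rOut ⊆ K) (f : E → ℝ) :
    mollify μ k (K.indicator f) z = ∫ w, (bump E k).normed μ (z - w) * f w ∂μ := by
  refine integral_congr_ae (Eventually.of_forall fun w => ?_)
  by_cases hw : w ∈ K
  · simp [hw]
  · simp [hw, (testOn_kernel (μ := μ) k hz).eq_zero hw]

theorem integral_fderiv_kernel_indicator (k : ℕ) {z : E}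
    (hz : Metric.closedBall z (bump E k).rOut ⊆ K) {f : E → ℝ}
    (hf : LocallyIntegrable (K.indicator f) μ) (v : E) :
    fderiv ℝ (mollify μ k (K.indicator f)) z v =
      - ∫ w, f w * fderiv ℝ (fun w => (bump E k).normed μ (z - w)) w v ∂μ := by
  rw [mollify_fderiv k hf, ← integral_neg]
  refine integral_congr_ae (Eventually.of_forall fun w => ?_)
  simp only
  by_cases hw : w ∈ K
  · rw [fderiv_kernel]
    simp [hw, mul_comm]
  · have hw' : w ∉ tsupport (fun w => (bump E k).normed μ (z - w)) :=
      fun h => hw ((testOn_kernel (μ := μ) k hz).support h)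
    rw [fderiv_eq_zero_of_notMem_tsupport v hw']
    simp [hw]

/-- The kernel centred at `z` is itself an admissible test function. Differentiating it in `w`
instead of `z` costs one sign, and the weak derivative supplies the other. -/
theorem HasWeakDeriv.fderiv_mollify {v : E} {f g : E → ℝ} (h : HasWeakDeriv μ O v f g)
    (hKO : K ⊆ O) (hf : LocallyIntegrable (K.indicator f) μ) (k : ℕ) {z : E}
    (hz : Metric.closedBall z (bump E k).rOut ⊆ K) :
    fderiv ℝ (mollify μ k (K.indicator f)) z v = mollify μ k (K.indicator g) z := by
  rw [integral_fderiv_kernel_indicator k hz hf, h _ (testOn_kernel k (hz.trans hKO)),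
    integral_kernel_indicator k hz, neg_neg]

theorem mollify_mem_Icc {f : E → ℝ} {L : ℝ} (hf : LocallyIntegrable f μ)
    (h0 : ∀ᵐ z ∂μ, 0 ≤ f z ∧ f z ≤ L) (k : ℕ) (z : E) : mollify μ k f z ∈ Icc 0 L := by
  constructor
  · rw [← mollify_const (μ := μ) k 0 z]
    exact mollify_mono k (locallyIntegrable_const 0) hf (h0.mono fun z h => h.1) z
  · conv => rhs; rw [← mollify_const (μ := μ) k L z]
    exact mollify_mono k hf (locallyIntegrable_const L) (h0.mono fun z h => h.2) z

/-- The factors `p k` have no fixed integrable majorant, only the mollifications of `h`. These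
converge to `h` almost everywhere and have the same integral as `h`, so dominated convergence with
varying majorants applies. -/
theorem tendsto_integral_comp_mollify_mul {f : E → ℝ} {L : ℝ} {ψ : E → ℝ} {q : ℝ → ℝ}
    (hf : LocallyIntegrable f μ) (h0 : ∀ᵐ z ∂μ, 0 ≤ f z ∧ f z ≤ L)
    (hq : ContinuousOn q (Icc 0 L)) (hψ : Continuous ψ) (hψc : HasCompactSupport ψ)
    {p : ℕ → E → ℝ} {p₀ h : E → ℝ} (hp : ∀ k, Continuous (p k)) (hh : Integrable h μ)
    (hph : ∀ k z, |p k z| ≤ mollify μ k h z)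
    (hpp : ∀ᵐ z ∂μ, Tendsto (fun k => p k z) atTop (𝓝 (p₀ z))) :
    Tendsto (fun k => ∫ z, q (mollify μ k f z) * p k z * ψ z ∂μ) atTop
      (𝓝 (∫ z, q (f z) * p₀ z * ψ z ∂μ)) := by
  obtain ⟨C, hC⟩ := isCompact_Icc.exists_bound_of_continuousOn hq
  obtain ⟨D, hD⟩ := hψc.exists_bound_of_continuous hψ
  have hmem := mollify_mem_Icc hf h0
  have hcont : ∀ k, Continuous fun z => q (mollify μ k f z) := fun k =>
    hq.comp_continuous (mollify_contDiff k hf).continuous (hmem k)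
  refine tendsto_integral_of_dominated_seq (H := fun k z => C * mollify μ k h z * D)
    (h := fun z => C * h z * D) ?_ ?_ ?_ ?_ ?_ ?_ ?_
  · exact fun k => (((hcont k).mul (hp k)).mul hψ).aestronglyMeasurable
  · exact fun k => ((mollify_integrable k hh).const_mul _).mul_const _
  · exact (hh.const_mul _).mul_const _
  · intro k
    refine Eventually.of_forall fun z => ?_
    rw [abs_mul, abs_mul]
    have h1 : |q (mollify μ k f z)| ≤ C := hC _ (hmem k z)
    have h2 : |ψ z| ≤ D := hD z
    have h3 := hph k z
    have := abs_nonneg (p k z)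
    have := (abs_nonneg _).trans h1
    have := (abs_nonneg _).trans h2
    gcongr
    exact mul_nonneg ‹_› ((abs_nonneg _).trans h3)
  · filter_upwards [hpp, mollify_ae_tendsto hf, h0] with z h1 h2 h3
    refine (Tendsto.mul ?_ h1).mul tendsto_const_nhds
    exact (hq (f z) h3).tendsto.comp (tendsto_nhdsWithin_iff.2
      ⟨h2, Eventually.of_forall fun k => hmem k z⟩)
  · filter_upwards [mollify_ae_tendsto hh.locallyIntegrable] with z h1
    exact (h1.const_mul _).mul_const _
  · simp_rw [integral_mul_const, integral_const_mul, mollify_integral _ hh]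
    exact tendsto_const_nhds

theorem tendsto_integral_comp_mollify {f : E → ℝ} {L : ℝ} {ψ : E → ℝ} {q : ℝ → ℝ}
    (hf : LocallyIntegrable f μ) (h0 : ∀ᵐ z ∂μ, 0 ≤ f z ∧ f z ≤ L)
    (hq : ContinuousOn q (Icc 0 L)) (hψ : Continuous ψ) (hψc : HasCompactSupport ψ) :
    Tendsto (fun k => ∫ z, q (mollify μ k f z) * ψ z ∂μ) atTop
      (𝓝 (∫ z, q (f z) * ψ z ∂μ)) := by
  obtain ⟨C, hC⟩ := isCompact_Icc.exists_bound_of_continuousOn hq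
  have hmem := mollify_mem_Icc hf h0
  have hcont : ∀ k, Continuous fun z => q (mollify μ k f z) := fun k =>
    hq.comp_continuous (mollify_contDiff k hf).continuous (hmem k)
  refine tendsto_integral_of_dominated_convergence (fun z => C * |ψ z|)
    (fun k => ((hcont k).mul hψ).aestronglyMeasurable) ?_ ?_ ?_
  · exact ((hψ.integrable_of_hasCompactSupport hψc).abs).const_mul _
  · intro k
    refine Eventually.of_forall fun z => ?_
    rw [norm_mul, Real.norm_eq_abs (ψ z)]
    gcongr
    exact hC _ (hmem k z)
  · filter_upwards [mollify_ae_tendsto hf, h0] with z h2 h3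
    refine Tendsto.mul ?_ tendsto_const_nhds
    exact (hq (f z) h3).tendsto.comp (tendsto_nhdsWithin_iff.2
      ⟨h2, Eventually.of_forall fun k => hmem k z⟩)

theorem fderiv_comp_mollify {H : ℝ → ℝ} {H' : ℝ → ℝ} (hH : ∀ x, 0 ≤ x → HasDerivAt H (H' x) x)
    {f : E → ℝ} {L : ℝ} (hf : LocallyIntegrable f μ) (h0 : ∀ᵐ z ∂μ, 0 ≤ f z ∧ f z ≤ L)
    (k : ℕ) (z : E) :
    HasFDerivAt (fun z => H (mollify μ k f z))
      (H' (mollify μ k f z) • fderiv ℝ (mollify μ k f) z) z := by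
  have h1 : HasFDerivAt (mollify μ k f) (fderiv ℝ (mollify μ k f) z) z :=
    ((mollify_contDiff k hf).differentiable (by simp) z).hasFDerivAt
  exact (hH _ (mollify_mem_Icc hf h0 k z).1).comp_hasFDerivAt z h1

theorem indicator_bounds {f : E → ℝ} {L : ℝ} (hL : 0 ≤ L) (hKO : K ⊆ O)
    (h0 : ∀ᵐ z ∂μ, z ∈ O → 0 ≤ f z ∧ f z ≤ L) :
    ∀ᵐ z ∂μ, 0 ≤ K.indicator f z ∧ K.indicator f z ≤ L := by
  filter_upwards [h0] with z hz
  by_cases h : z ∈ K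
  · simpa [h] using hz (hKO h)
  · simp [h, hL]

theorem integral_comp_mollify_mul_fderiv {H H' : ℝ → ℝ}
    (hH : ∀ x, 0 ≤ x → HasDerivAt H (H' x) x) (hH' : ContinuousOn H' (Ici 0))
    {f : E → ℝ} {L : ℝ} (hf : LocallyIntegrable f μ) (h0 : ∀ᵐ z ∂μ, 0 ≤ f z ∧ f z ≤ L)
    (k : ℕ) {ψ : E → ℝ} (hψ : TestOn O ψ) (v : E) :
    ∫ z, H (mollify μ k f z) * fderiv ℝ ψ z v ∂μ =
      - ∫ z, H' (mollify μ k f z) * fderiv ℝ (mollify μ k f) z v * ψ z ∂μ := by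
  have hd := fderiv_comp_mollify hH hf h0 k
  have hmc := (mollify_contDiff k hf)
  have hc : Continuous fun z => H (mollify μ k f z) :=
    continuous_iff_continuousAt.2 fun z => (hd z).continuousAt
  have hc' : Continuous fun z => H' (mollify μ k f z) :=
    hH'.comp_continuous hmc.continuous fun z => (mollify_mem_Icc hf h0 k z).1
  have hcf : Continuous fun z => fderiv ℝ (mollify μ k f) z v :=
    (hmc.continuous_fderiv (by simp)).clm_apply continuous_const
  have e : ∀ z, H' (mollify μ k f z) * fderiv ℝ (mollify μ k f) z v =
      fderiv ℝ (fun z => H (mollify μ k f z)) z v := fun z => by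
    rw [(hd z).fderiv]; rfl
  have hc2 : Continuous fun z => fderiv ℝ (fun z => H (mollify μ k f z)) z v := by
    simp_rw [← e]
    exact hc'.mul hcf
  simp_rw [e]
  refine integral_mul_fderiv_eq_neg_fderiv_mul_of_integrable ?_ ?_ ?_ ?_ ?_
  · exact (hc2.mul hψ.smooth.continuous).integrable_of_hasCompactSupport hψ.compact.mul_left
  · exact (hc.mul (hψ.continuous_fderiv v)).integrable_of_hasCompactSupport
      (hψ.hasCompactSupport_fderiv v).mul_left
  · exact (hc.mul hψ.smooth.continuous).integrable_of_hasCompactSupport hψ.compact.mul_left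
  · exact fun z _ => (hd z).differentiableAt
  · exact fun z _ => hψ.smooth.differentiable (by simp) z

/-- The chain rule for weak derivatives of bounded nonnegative functions. -/
theorem HasWeakDeriv.comp {H H' : ℝ → ℝ} (hH : ∀ x, 0 ≤ x → HasDerivAt H (H' x) x)
    (hH' : ContinuousOn H' (Ici 0)) (hO : IsOpen O) {v : E} {f g : E → ℝ} {L : ℝ} (hL : 0 ≤ L)
    (hf : LocallyIntegrableOn f O μ) (hg : LocallyIntegrableOn g O μ)
    (h0 : ∀ᵐ z ∂μ, z ∈ O → 0 ≤ f z ∧ f z ≤ L) (h : HasWeakDeriv μ O v f g) :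
    HasWeakDeriv μ O v (fun z => H (f z)) (fun z => H' (f z) * g z) := by
  intro ψ hψ
  obtain ⟨K, hK, hKO, hψK, hev⟩ := hψ.exists_compact hO
  have hfi : Integrable (K.indicator f) μ :=
    (hf.integrableOn_compact_subset hKO hK).integrable_indicator hK.measurableSet
  have hgi : Integrable (K.indicator g) μ :=
    (hg.integrableOn_compact_subset hKO hK).integrable_indicator hK.measurableSet
  have hb := indicator_bounds hL hKO h0
  have hHc : ContinuousOn H (Icc 0 L) := fun x hx => (hH x hx.1).continuousAt.continuousWithinAt
  have lim1 := tendsto_integral_comp_mollify hfi.locallyIntegrable hb hHc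
    (hψ.continuous_fderiv v) (hψ.hasCompactSupport_fderiv v)
  have lim2 := tendsto_integral_comp_mollify_mul hfi.locallyIntegrable hb
    (hH'.mono Icc_subset_Ici_self) hψ.smooth.continuous hψ.compact
    (p := fun k => mollify μ k (K.indicator g))
    (fun k => (mollify_contDiff k hgi.locallyIntegrable).continuous) hgi.abs
    (fun k z => mollify_abs_le k z) (mollify_ae_tendsto hgi.locallyIntegrable)
  -- For mollified functions the chain rule is classical, and on the support of `ψ` the derivative
  -- of the mollification is eventually the mollification of `g`.
  have key := tendsto_nhds_unique_of_eventuallyEq lim1 lim2.neg (by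
    filter_upwards [hev] with k hk
    rw [integral_comp_mollify_mul_fderiv hH hH' hfi.locallyIntegrable hb k hψ v]
    congr 1
    refine integral_congr_ae (Eventually.of_forall fun z => ?_)
    simp only
    by_cases hz : z ∈ tsupport ψ
    · rw [h.fderiv_mollify hKO hfi.locallyIntegrable k (hk z hz)]
    · simp [image_eq_zero_of_notMem_tsupport hz])
  calc _ = ∫ z, H (K.indicator f z) * fderiv ℝ ψ z v ∂μ := by
        refine integral_congr_ae (Eventually.of_forall fun z => ?_)
        simp only
        by_cases hz : z ∈ tsupport ψ
        · rw [indicator_of_mem (hψK hz)]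
        · simp [fderiv_eq_zero_of_notMem_tsupport v hz]
    _ = _ := key
    _ = _ := by
        congr 1
        refine integral_congr_ae (Eventually.of_forall fun z => ?_)
        simp only
        by_cases hz : z ∈ tsupport ψ
        · rw [indicator_of_mem (hψK hz), indicator_of_mem (hψK hz)]; ring
        · simp [image_eq_zero_of_notMem_tsupport hz]

/-- The energy identity: if `∂_τ u = ∑ⱼ ∂_{vⱼ} Fⱼ` in the sense of distributions, then the equation
may be tested with `G(u) ψ`. -/
theorem energy_identity {ι : Type*} [Fintype ι] (hO : IsOpen O) {v : ι → E} {τ : E}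
    {u : E → ℝ} {F g : ι → E → ℝ} {L : ℝ} (hL : 0 ≤ L)
    {Φ G G' : ℝ → ℝ} (hΦ : ∀ x, 0 ≤ x → HasDerivAt Φ (G x) x)
    (hG : ∀ x, 0 ≤ x → HasDerivAt G (G' x) x) (hG' : ContinuousOn G' (Ici 0))
    (hu : LocallyIntegrableOn u O μ) (hF : ∀ j, LocallyIntegrableOn (F j) O μ)
    (hg : ∀ j, LocallyIntegrableOn (g j) O μ)
    (hF2 : ∀ j, LocallyIntegrableOn (fun z => F j z ^ 2) O μ)
    (hg2 : ∀ j, LocallyIntegrableOn (fun z => g j z ^ 2) O μ)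
    (h0 : ∀ᵐ z ∂μ, z ∈ O → 0 ≤ u z ∧ u z ≤ L)
    (hug : ∀ j, HasWeakDeriv μ O (v j) u (g j))
    (heq : ∀ φ : E → ℝ, TestOn O φ →
      ∑ j, ∫ z, F j z * fderiv ℝ φ z (v j) ∂μ = ∫ z, u z * fderiv ℝ φ z τ ∂μ)
    {ψ : E → ℝ} (hψ : TestOn O ψ) :
    ∑ j, (∫ z, G' (u z) * (F j z * g j z) * ψ z ∂μ +
      ∫ z, G (u z) * F j z * fderiv ℝ ψ z (v j) ∂μ) = ∫ z, Φ (u z) * fderiv ℝ ψ z τ ∂μ := by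
  obtain ⟨K, hK, hKO, hψK, hev⟩ := hψ.exists_compact hO
  have hind : ∀ {f : E → ℝ}, LocallyIntegrableOn f O μ → Integrable (K.indicator f) μ :=
    fun hf => (hf.integrableOn_compact_subset hKO hK).integrable_indicator hK.measurableSet
  have hindsq : ∀ {f : E → ℝ}, LocallyIntegrableOn (fun z => f z ^ 2) O μ →
      Integrable (fun z => K.indicator f z ^ 2) μ := fun {f} hf => by
    refine (hind hf).congr (Eventually.of_forall fun z => ?_)
    by_cases hz : z ∈ K <;> simp [hz]
  have hui := (hind hu).locallyIntegrable
  have hb := indicator_bounds hL hKO h0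
  set U := K.indicator u with hU
  have hGc' : ContinuousOn G (Ici 0) := fun x hx => (hG x hx).continuousAt.continuousWithinAt
  have hGc : ContinuousOn G (Icc 0 L) := hGc'.mono Icc_subset_Ici_self
  have hΦc : ContinuousOn Φ (Icc 0 L) :=
    fun x hx => (hΦ x hx.1).continuousAt.continuousWithinAt
  have lim0 := tendsto_integral_comp_mollify hui hb hΦc
    (hψ.continuous_fderiv τ) (hψ.hasCompactSupport_fderiv τ)
  have hcm : ∀ {f : E → ℝ}, LocallyIntegrableOn f O μ → ∀ k,
      Continuous (mollify μ k (K.indicator f)) :=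
    fun hf k => (mollify_contDiff k (hind hf).locallyIntegrable).continuous
  have lim1 : ∀ j, Tendsto (fun k => ∫ z, G' (mollify μ k U z) *
      (mollify μ k (K.indicator (F j)) z * mollify μ k (K.indicator (g j)) z) * ψ z ∂μ) atTop
      (𝓝 (∫ z, G' (U z) * (K.indicator (F j) z * K.indicator (g j) z) * ψ z ∂μ)) := by
    intro j
    -- A product of two mollifications is dominated through `|ab| ≤ a² + b²` and Jensen; this is
    -- where local square integrability of `F` and `g` enters.
    refine tendsto_integral_comp_mollify_mul hui hb (hG'.mono Icc_subset_Ici_self)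
      hψ.smooth.continuous hψ.compact
      (h := fun z => K.indicator (F j) z ^ 2 + K.indicator (g j) z ^ 2)
      (fun k => (hcm (hF j) k).mul (hcm (hg j) k)) ((hindsq (hF2 j)).add (hindsq (hg2 j))) ?_ ?_
    · intro k z
      have e : mollify μ k (fun z => K.indicator (F j) z ^ 2 + K.indicator (g j) z ^ 2) z =
          mollify μ k (fun z => K.indicator (F j) z ^ 2) z +
          mollify μ k (fun z => K.indicator (g j) z ^ 2) z := by
        simp only [mollify, mul_add]
        exact integral_add (kernel_mul_integrable k (hindsq (hF2 j)).locallyIntegrable z)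
          (kernel_mul_integrable k (hindsq (hg2 j)).locallyIntegrable z)
      rw [e]
      have h1 := mollify_sq_le k (hind (hF j)).locallyIntegrable
        (hindsq (hF2 j)).locallyIntegrable z
      have h2 := mollify_sq_le k (hind (hg j)).locallyIntegrable
        (hindsq (hg2 j)).locallyIntegrable z
      refine le_trans ?_ (add_le_add h1 h2)
      rw [abs_le]
      constructor <;> nlinarith [sq_nonneg (mollify μ k (K.indicator (F j)) z +
        mollify μ k (K.indicator (g j)) z), sq_nonneg (mollify μ k (K.indicator (F j)) z -
        mollify μ k (K.indicator (g j)) z), sq_nonneg (mollify μ k (K.indicator (F j)) z),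
        sq_nonneg (mollify μ k (K.indicator (g j)) z)]
    · filter_upwards [mollify_ae_tendsto (hind (hF j)).locallyIntegrable,
        mollify_ae_tendsto (hind (hg j)).locallyIntegrable] with z h1 h2 using h1.mul h2
  have lim2 : ∀ j, Tendsto (fun k => ∫ z, G (mollify μ k U z) *
      mollify μ k (K.indicator (F j)) z * fderiv ℝ ψ z (v j) ∂μ) atTop
      (𝓝 (∫ z, G (U z) * K.indicator (F j) z * fderiv ℝ ψ z (v j) ∂μ)) := fun j =>
    tendsto_integral_comp_mollify_mul hui hb hGc (hψ.continuous_fderiv _)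
      (hψ.hasCompactSupport_fderiv _) (fun k => hcm (hF j) k) (hind (hF j)).abs
      (fun k z => mollify_abs_le k z) (mollify_ae_tendsto (hind (hF j)).locallyIntegrable)
  have lim3 := tendsto_finsetSum Finset.univ fun j _ => (lim1 j).add (lim2 j)
  have key := tendsto_nhds_unique_of_eventuallyEq lim0 lim3 (by
    filter_upwards [hev] with k hk
    have hmU := mollify_contDiff k hui
    have hGd := fderiv_comp_mollify hG hui hb k
    have cG : Continuous fun z => G (mollify μ k U z) :=
      hGc.comp_continuous hmU.continuous (mollify_mem_Icc hui hb k)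
    have cG' : Continuous fun z => G' (mollify μ k U z) :=
      hG'.comp_continuous hmU.continuous fun z => (mollify_mem_Icc hui hb k z).1
    rw [integral_comp_mollify_mul_fderiv hΦ hGc' hui hb k hψ τ]
    have hFd : ∀ j z, HasFDerivAt (mollify μ k (K.indicator (F j)))
        (fderiv ℝ (mollify μ k (K.indicator (F j))) z) z := fun j z =>
      ((mollify_contDiff k (hind (hF j)).locallyIntegrable).differentiable (by simp)
        z).hasFDerivAt
    have cFd : ∀ j, Continuous fun z => fderiv ℝ (mollify μ k (K.indicator (F j))) z (v j) :=
      fun j => ((mollify_contDiff k (hind (hF j)).locallyIntegrable).continuous_fderiv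
        (by simp)).clm_apply continuous_const
    -- Testing the equation with the kernel centred at `z` makes the mollified equation hold
    -- pointwise on the support of `ψ`.
    have e1 : ∀ z ∈ tsupport ψ, fderiv ℝ (mollify μ k U) z τ =
        ∑ j, fderiv ℝ (mollify μ k (K.indicator (F j))) z (v j) := by
      intro z hz
      rw [integral_fderiv_kernel_indicator k (hk z hz) hui, ← heq _ (testOn_kernel k
        ((hk z hz).trans hKO)), ← Finset.sum_neg_distrib]
      exact Finset.sum_congr rfl fun j _ =>
        (integral_fderiv_kernel_indicator k (hk z hz) (hind (hF j)).locallyIntegrable _).symm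
    have e2 : ∫ z, G (mollify μ k U z) * fderiv ℝ (mollify μ k U) z τ * ψ z ∂μ =
        ∑ j, ∫ z, fderiv ℝ (mollify μ k (K.indicator (F j))) z (v j) *
          (G (mollify μ k U z) * ψ z) ∂μ := by
      rw [← integral_finsetSum]
      · refine integral_congr_ae (Eventually.of_forall fun z => ?_)
        simp only
        by_cases hz : z ∈ tsupport ψ
        · rw [e1 z hz, ← Finset.sum_mul]; ring
        · simp [image_eq_zero_of_notMem_tsupport hz]
      · intro j _
        exact ((cFd j).mul (cG.mul hψ.smooth.continuous)).integrable_of_hasCompactSupport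
          hψ.compact.mul_left.mul_left
    rw [e2, ← Finset.sum_neg_distrib]
    refine Finset.sum_congr rfl fun j _ => ?_
    have hprod : ∀ z, HasFDerivAt (fun z => G (mollify μ k U z) * ψ z)
        (G (mollify μ k U z) • fderiv ℝ ψ z +
          ψ z • (G' (mollify μ k U z) • fderiv ℝ (mollify μ k U) z)) z := fun z =>
      (hGd z).mul (hψ.smooth.differentiable (by simp) z).hasFDerivAt
    have cU : Continuous fun z => fderiv ℝ (mollify μ k U) z (v j) :=
      (hmU.continuous_fderiv (by simp)).clm_apply continuous_const
    have e3 : ∀ z, fderiv ℝ (fun z => G (mollify μ k U z) * ψ z) z (v j) =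
        G (mollify μ k U z) * fderiv ℝ ψ z (v j) +
          ψ z * (G' (mollify μ k U z) * fderiv ℝ (mollify μ k U) z (v j)) := fun z => by
      rw [(hprod z).fderiv]; rfl
    have i1 : Integrable (fun z => G' (mollify μ k U z) *
        (mollify μ k (K.indicator (F j)) z * mollify μ k (K.indicator (g j)) z) * ψ z) μ :=
      ((cG'.mul ((hcm (hF j) k).mul (hcm (hg j) k))).mul
        hψ.smooth.continuous).integrable_of_hasCompactSupport hψ.compact.mul_left
    have i2 : Integrable (fun z => G (mollify μ k U z) *
        mollify μ k (K.indicator (F j)) z * fderiv ℝ ψ z (v j)) μ :=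
      ((cG.mul (hcm (hF j) k)).mul
        (hψ.continuous_fderiv _)).integrable_of_hasCompactSupport
          (hψ.hasCompactSupport_fderiv _).mul_left
    have e4 : ∀ z, mollify μ k (K.indicator (F j)) z *
        fderiv ℝ (fun z => G (mollify μ k U z) * ψ z) z (v j) =
        G' (mollify μ k U z) *
        (mollify μ k (K.indicator (F j)) z * mollify μ k (K.indicator (g j)) z) * ψ z +
        G (mollify μ k U z) *
        mollify μ k (K.indicator (F j)) z * fderiv ℝ ψ z (v j) := by
      intro z
      rw [e3]
      by_cases hz : z ∈ tsupport ψ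
      · rw [(hug j).fderiv_mollify hKO hui k (hk z hz)]; ring
      · simp [image_eq_zero_of_notMem_tsupport hz, fderiv_eq_zero_of_notMem_tsupport _ hz]
    -- A second integration by parts moves `∂_{vⱼ}` from the mollified `F j` onto `G(u) ψ`; the
    -- product rule then yields the production term and the cutoff term.
    rw [← integral_add i1 i2, ← neg_eq_iff_eq_neg.2
      (integral_mul_fderiv_eq_neg_fderiv_mul_of_integrable (μ := μ) (v := v j)
        (f := mollify μ k (K.indicator (F j))) (g := fun z => G (mollify μ k U z) * ψ z)
        ?_ ?_ ?_ ?_ ?_), neg_neg]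
    · exact integral_congr_ae (Eventually.of_forall e4)
    · exact ((cFd j).mul (cG.mul hψ.smooth.continuous)).integrable_of_hasCompactSupport
        hψ.compact.mul_left.mul_left
    · exact (i1.add i2).congr (Eventually.of_forall fun z => (e4 z).symm)
    · exact ((hcm (hF j) k).mul (cG.mul hψ.smooth.continuous)).integrable_of_hasCompactSupport
        hψ.compact.mul_left.mul_left
    · exact fun z _ => (hFd j z).differentiableAt
    · exact fun z _ => (hprod z).differentiableAt)
  have e0 : ∫ z, Φ (u z) * fderiv ℝ ψ z τ ∂μ = ∫ z, Φ (U z) * fderiv ℝ ψ z τ ∂μ := by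
    refine integral_congr_ae (Eventually.of_forall fun z => ?_)
    simp only
    by_cases hz : z ∈ tsupport ψ
    · rw [hU, indicator_of_mem (hψK hz)]
    · simp [fderiv_eq_zero_of_notMem_tsupport τ hz]
  rw [e0, key]
  refine Finset.sum_congr rfl fun j _ => ?_
  congr 1
  · refine integral_congr_ae (Eventually.of_forall fun z => ?_)
    simp only [hU]
    by_cases hz : z ∈ tsupport ψ
    · simp only [indicator_of_mem (hψK hz)]
    · simp [image_eq_zero_of_notMem_tsupport hz]
  · refine integral_congr_ae (Eventually.of_forall fun z => ?_)
    simp only [hU]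
    by_cases hz : z ∈ tsupport ψ
    · simp only [indicator_of_mem (hψK hz)]
    · simp [fderiv_eq_zero_of_notMem_tsupport _ hz]

end WeakDerivative

end ParabolicSystem

namespace ParabolicSystem

set_option linter.unusedSectionVars false

/-! ### Vanishing of weak derivatives on zero sets. -/

section WeakDerivative

variable {E : Type*} [NormedAddCommGroup E] [NormedSpace ℝ E] [FiniteDimensional ℝ E]
  [MeasurableSpace E] [BorelSpace E] {μ : Measure E} [μ.IsAddHaarMeasure] {O : Set E}

theorem _root_.MeasureTheory.LocallyIntegrableOn.mono_of_isOpen (hO : IsOpen O) {F F' : Type*}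
    [NormedAddCommGroup F] [NormedAddCommGroup F'] {f : E → F} {g : E → F'}
    (hf : LocallyIntegrableOn f O μ) (hg : AEStronglyMeasurable g (μ.restrict O))
    (h : ∀ᵐ z ∂μ.restrict O, ‖g z‖ ≤ ‖f z‖) : LocallyIntegrableOn g O μ := by
  refine (locallyIntegrableOn_iff hO.isLocallyClosed).2 fun K hKO hK => ?_
  have hr : μ.restrict K ≤ μ.restrict O := Measure.restrict_mono hKO le_rfl
  exact Integrable.mono (hf.integrableOn_compact_subset hKO hK) (hg.mono_measure hr)
    (ae_mono hr h)

/-- The weak derivative of a bounded nonnegative function vanishes almost everywhere on its zero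
set. -/
theorem HasWeakDeriv.ae_eq_zero_of_eq_zero (hO : IsOpen O) {v : E} {f g : E → ℝ} {L : ℝ}
    (hL : 0 ≤ L) (hf : LocallyIntegrableOn f O μ) (hg : LocallyIntegrableOn g O μ)
    (h0 : ∀ᵐ z ∂μ, z ∈ O → 0 ≤ f z ∧ f z ≤ L) (h : HasWeakDeriv μ O v f g) :
    ∀ᵐ z ∂μ, z ∈ O → f z = 0 → g z = 0 := by
  set ε : ℕ → ℝ := fun k => 1 / ((k : ℝ) + 1) with hε
  have hεpos : ∀ k, 0 < ε k := fun k => by positivity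
  have hεlim : Tendsto ε atTop (𝓝 0) := tendsto_one_div_add_atTop_nhds_zero_nat
  -- Smooth approximations of the identity on `[0, ∞)` whose derivatives vanish at `0` and tend to
  -- `1` at every `x > 0`. In the limit the chain rule gives both `g` and `g` restricted to `{f >
  -- 0}` as weak derivative of `f`.
  set H : ℕ → ℝ → ℝ := fun k x => x ^ 2 / (x + ε k) with hH
  set H' : ℕ → ℝ → ℝ := fun k x => (x ^ 2 + 2 * ε k * x) / (x + ε k) ^ 2 with hH'
  have hder : ∀ k x, 0 ≤ x → HasDerivAt (H k) (H' k x) x := by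
    intro k x hx
    have hne : x + ε k ≠ 0 := (add_pos_of_nonneg_of_pos hx (hεpos k)).ne'
    have := ((hasDerivAt_id x).pow 2).div ((hasDerivAt_id x).add_const (ε k)) hne
    refine this.congr_deriv ?_
    simp only [hH', id, Pi.pow_apply]
    congr 1
    push_cast
    ring
  have hcont : ∀ k, ContinuousOn (H' k) (Ici 0) := by
    intro k
    refine ContinuousOn.div (by fun_prop) (by fun_prop) fun x hx => ?_
    exact pow_ne_zero _ (add_pos_of_nonneg_of_pos hx (hεpos k)).ne'
  have hHb : ∀ k x, 0 ≤ x → |H k x| ≤ |x| := by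
    intro k x hx
    have h1 := add_pos_of_nonneg_of_pos hx (hεpos k)
    rw [abs_of_nonneg (by positivity), abs_of_nonneg hx, div_le_iff₀ h1]
    nlinarith [hεpos k]
  have hHb' : ∀ k x, 0 ≤ x → |H' k x| ≤ 1 := by
    intro k x hx
    have h1 := add_pos_of_nonneg_of_pos hx (hεpos k)
    have h2 := hεpos k
    rw [abs_of_nonneg (by positivity), div_le_iff₀ (by positivity)]
    nlinarith [sq_nonneg (ε k)]
  have hHl : ∀ x, 0 ≤ x → Tendsto (fun k => H k x) atTop (𝓝 x) := by
    intro x hx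
    rcases hx.eq_or_lt with rfl | hx
    · simp [hH]
    · have : Tendsto (fun k => x ^ 2 / (x + ε k)) atTop (𝓝 (x ^ 2 / (x + 0))) :=
        tendsto_const_nhds.div (tendsto_const_nhds.add hεlim) (by simpa using hx.ne')
      convert this using 2
      field_simp
      ring
  have hHl' : ∀ x, 0 < x → Tendsto (fun k => H' k x) atTop (𝓝 1) := by
    intro x hx
    have : Tendsto (fun k => (x ^ 2 + 2 * ε k * x) / (x + ε k) ^ 2) atTop
        (𝓝 ((x ^ 2 + 2 * 0 * x) / (x + 0) ^ 2)) :=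
      (tendsto_const_nhds.add ((hεlim.const_mul 2).mul_const x)).div
        ((tendsto_const_nhds.add hεlim).pow 2) (by simpa using hx.ne')
    convert this using 2
    field_simp
    ring
  have h0O : ∀ᵐ z ∂μ.restrict O, 0 ≤ f z :=
    (ae_restrict_iff' hO.measurableSet).2 (h0.mono fun z hz hzO => (hz hzO).1)
  have hm : ∀ k, AEStronglyMeasurable (fun z => H' k (f z)) (μ.restrict O) := by
    intro k
    have : AEMeasurable (fun z => H' k (f z)) (μ.restrict O) := by
      have hfm := hf.aestronglyMeasurable.aemeasurable
      exact ((hfm.pow_const 2).add (hfm.const_mul _)).div ((hfm.add_const _).pow_const 2)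
    exact this.aestronglyMeasurable
  -- The difference of these two candidates; it remains to see that it annihilates all test
  -- functions.
  set d : E → ℝ := fun z => if f z = 0 then g z else 0 with hd
  have hlim : ∀ᵐ z ∂μ.restrict O, Tendsto (fun k => g z - H' k (f z) * g z) atTop (𝓝 (d z)) := by
    filter_upwards [h0O] with z hz
    rcases hz.eq_or_lt with hz | hz
    · simp [hd, ← hz, hH']
    · have : d z = g z - 1 * g z := by simp [hd, hz.ne']
      rw [this]
      exact tendsto_const_nhds.sub ((hHl' _ hz).mul_const _)
  have hdm : AEStronglyMeasurable d (μ.restrict O) :=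
    aestronglyMeasurable_of_tendsto_ae atTop
      (fun k => hg.aestronglyMeasurable.sub ((hm k).mul hg.aestronglyMeasurable)) hlim
  have hdg : ∀ z, ‖d z‖ ≤ ‖g z‖ := fun z => by
    by_cases hz : f z = 0 <;> simp [hd, hz]
  have hdi : LocallyIntegrableOn d O μ := hg.mono_of_isOpen hO hdm (Eventually.of_forall hdg)
  have hz := hO.ae_eq_zero_of_integral_contDiff_smul_eq_zero hdi (fun φ h1 h2 h3 => ?_)
  · filter_upwards [hz] with z hz hzO hfz
    simpa [hd, hfz] using hz hzO
  have hφ : TestOn O φ := ⟨h1, h2, h3⟩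
  have hK : IsCompact (tsupport φ) := h2.isCompact
  have hKO : ∀ {p : E → ℝ}, (∀ z ∉ tsupport φ, p z = 0) →
      ∫ z, p z ∂μ = ∫ z in tsupport φ, p z ∂μ := fun hp =>
    (setIntegral_eq_integral_of_forall_compl_eq_zero hp).symm
  have hrest : μ.restrict (tsupport φ) ≤ μ.restrict O := Measure.restrict_mono h3 le_rfl
  have hfi : IntegrableOn f (tsupport φ) μ := hf.integrableOn_compact_subset h3 hK
  have hgi : IntegrableOn g (tsupport φ) μ := hg.integrableOn_compact_subset h3 hK
  obtain ⟨D, hD⟩ := h2.exists_bound_of_continuous h1.continuous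
  obtain ⟨D', hD'⟩ := (hφ.hasCompactSupport_fderiv v).exists_bound_of_continuous
    (hφ.continuous_fderiv v)
  have l1 : Tendsto (fun k => ∫ z in tsupport φ, H k (f z) * fderiv ℝ φ z v ∂μ) atTop
      (𝓝 (∫ z in tsupport φ, f z * fderiv ℝ φ z v ∂μ)) := by
    refine tendsto_integral_of_dominated_convergence (fun z => |f z| * D') ?_
      (hfi.abs.mul_const _) ?_ ?_
    · intro k
      refine AEStronglyMeasurable.mul ?_ (hφ.continuous_fderiv v).aestronglyMeasurable
      have hfm := hfi.aestronglyMeasurable.aemeasurable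
      exact ((hfm.pow_const 2).div (hfm.add_const _)).aestronglyMeasurable
    · intro k
      filter_upwards [ae_mono hrest h0O] with z hz
      rw [norm_mul]
      exact mul_le_mul (hHb k _ hz) (hD' z) (norm_nonneg _) (abs_nonneg _)
    · filter_upwards [ae_mono hrest h0O] with z hz
      exact (hHl _ hz).mul_const _
  have l2 : Tendsto (fun k => ∫ z in tsupport φ, φ z * (H' k (f z) * g z) ∂μ) atTop
      (𝓝 (∫ z in tsupport φ, φ z * (g z - d z) ∂μ)) := by
    refine tendsto_integral_of_dominated_convergence (fun z => D * |g z|) ?_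
      (hgi.abs.const_mul _) ?_ ?_
    · exact fun k => h1.continuous.aestronglyMeasurable.mul
        (((hm k).mono_measure hrest).mul hgi.aestronglyMeasurable)
    · intro k
      filter_upwards [ae_mono hrest h0O] with z hz
      rw [norm_mul, norm_mul]
      have := hHb' k _ hz
      have h5 : ‖H' k (f z)‖ * ‖g z‖ ≤ |g z| :=
        mul_le_of_le_one_left (norm_nonneg _) this
      exact mul_le_mul (hD z) h5 (by positivity) ((norm_nonneg _).trans (hD z))
    · filter_upwards [ae_mono hrest hlim] with z hz
      have := (tendsto_const_nhds (x := g z)).sub hz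
      simp only [sub_sub_cancel] at this
      exact this.const_mul _
  have l3 := tendsto_nhds_unique_of_eventuallyEq l1 l2.neg (Eventually.of_forall fun k => by
    have := h.comp (hder k) (hcont k) hO hL hf hg h0 φ hφ
    rwa [hKO (fun z hz => by simp [fderiv_eq_zero_of_notMem_tsupport v hz]),
      hKO (fun z hz => by simp [image_eq_zero_of_notMem_tsupport hz])] at this)
  have l4 := h φ hφ
  rw [hKO (fun z hz => by simp [fderiv_eq_zero_of_notMem_tsupport v hz]),
      hKO (fun z hz => by simp [image_eq_zero_of_notMem_tsupport hz]), l3, neg_inj] at l4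
  have hdi' : IntegrableOn d (tsupport φ) μ := hdi.integrableOn_compact_subset h3 hK
  have hbm : ∀ {p : E → ℝ}, IntegrableOn p (tsupport φ) μ →
      Integrable (fun z => φ z * p z) (μ.restrict (tsupport φ)) := fun hp =>
    hp.bdd_mul h1.continuous.aestronglyMeasurable (Eventually.of_forall hD)
  simp_rw [smul_eq_mul]
  rw [hKO (fun z hz => by simp [image_eq_zero_of_notMem_tsupport hz])]
  simp_rw [mul_sub] at l4
  rw [integral_sub (hbm hgi) (hbm hdi')] at l4
  linarith

end WeakDerivative

end ParabolicSystem

namespace ParabolicSystem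

/-! ### Functions of time: primitives and continuity. -/

section OneDim

/-- Convergence at a prescribed point, not merely almost everywhere, so that the endpoints of a time
interval can be evaluated. -/
theorem mollify_tendsto_of_continuousAt {f : ℝ → ℝ} (hf : LocallyIntegrable f) {x : ℝ}
    (hx : ContinuousAt f x) :
    Tendsto (fun k => mollify volume k f x) atTop (𝓝 (f x)) := by
  simp_rw [mollify_eq_convolution]
  exact ContDiffBump.convolution_tendsto_right (g := fun _ => f) bump_rOut_tendsto
    (Eventually.of_forall fun _ => hf.aestronglyMeasurable) (hx.tendsto.comp tendsto_snd)
    tendsto_const_nhds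

/-- A continuous function with a locally integrable weak derivative is a primitive of it. -/
theorem HasWeakDeriv.sub_eq_integral {f g : ℝ → ℝ} {O : Set ℝ}
    (hf : ContinuousOn f O) (hg : LocallyIntegrableOn g O)
    (h : HasWeakDeriv volume O 1 f g) {a b : ℝ} (hO : IsOpen O) (hab : a ≤ b)
    (habO : Icc a b ⊆ O) : f b - f a = ∫ s in a..b, g s := by
  obtain ⟨r, hr, hrO⟩ := isCompact_Icc.exists_cthickening_subset_open hO habO
  set K := Metric.cthickening r (Icc a b) with hKdef
  have hK : IsCompact K := isCompact_Icc.cthickening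
  have hint : ∀ {p : ℝ → ℝ}, LocallyIntegrableOn p O volume → Integrable (K.indicator p) :=
    fun hp => (hp.integrableOn_compact_subset hrO hK).integrable_indicator hK.measurableSet
  have hfi := (hint (hf.locallyIntegrableOn hO.measurableSet)).locallyIntegrable
  have hgi := hint hg
  have hev : ∀ᶠ k in atTop, ∀ z ∈ Icc a b, Metric.closedBall z (bump ℝ k).rOut ⊆ K := by
    filter_upwards [(bump_rOut_tendsto (E := ℝ)).eventually (gt_mem_nhds hr)] with k hk z hz
    exact (Metric.closedBall_subset_closedBall hk.le).trans
      (Metric.closedBall_subset_cthickening hz r)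
  have hnhds : ∀ z ∈ Icc a b, K ∈ 𝓝 z := fun z hz =>
    mem_of_superset (Metric.closedBall_mem_nhds z hr) (Metric.closedBall_subset_cthickening hz r)
  have hca : ∀ z ∈ Icc a b, ContinuousAt (K.indicator f) z := fun z hz => by
    refine (hf.continuousAt (hO.mem_nhds (habO hz))).congr ?_
    filter_upwards [hnhds z hz] with y hy using (indicator_of_mem hy f).symm
  have hKm : ∀ z ∈ Icc a b, z ∈ K := fun z hz => mem_of_mem_nhds (hnhds z hz)
  have la := mollify_tendsto_of_continuousAt hfi (hca a (left_mem_Icc.2 hab))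
  have lb := mollify_tendsto_of_continuousAt hfi (hca b (right_mem_Icc.2 hab))
  rw [indicator_of_mem (hKm a (left_mem_Icc.2 hab))] at la
  rw [indicator_of_mem (hKm b (right_mem_Icc.2 hab))] at lb
  have hin : Tendsto (fun k => ∫ s in a..b, mollify volume k (K.indicator g) s) atTop
      (𝓝 (∫ s in a..b, K.indicator g s)) := by
    simp_rw [intervalIntegral.integral_of_le hab, ← integral_indicator measurableSet_Ioc]
    refine tendsto_integral_of_dominated_seq
      (H := fun k => mollify volume k (fun y => |K.indicator g y|))
      (h := fun y => |K.indicator g y|) ?_ ?_ hgi.abs ?_ ?_ ?_ ?_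
    · exact fun k => (mollify_contDiff k hgi.locallyIntegrable).continuous.aestronglyMeasurable.indicator
        measurableSet_Ioc
    · exact fun k => mollify_integrable k hgi.abs
    · refine fun k => Eventually.of_forall fun z => le_trans ?_ (mollify_abs_le k z)
      by_cases hz : z ∈ Ioc a b <;> simp [hz]
    · filter_upwards [mollify_ae_tendsto hgi.locallyIntegrable] with z hz
      by_cases hz' : z ∈ Ioc a b
      · simpa [hz'] using hz
      · simp [hz']
    · exact mollify_ae_tendsto hgi.abs.locallyIntegrable
    · simp_rw [mollify_integral _ hgi.abs]
      exact tendsto_const_nhds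
  have key := tendsto_nhds_unique_of_eventuallyEq (lb.sub la) hin (by
    filter_upwards [hev] with k hk
    have hd : ∀ z, HasDerivAt (mollify volume k (K.indicator f))
        (deriv (mollify volume k (K.indicator f)) z) z := fun z =>
      ((mollify_contDiff k hfi).differentiable (by simp) z).hasDerivAt
    rw [← intervalIntegral.integral_eq_sub_of_hasDerivAt (fun z _ => hd z)
      (((mollify_contDiff k hfi).continuous_deriv (by simp)).intervalIntegrable _ _)]
    refine intervalIntegral.integral_congr fun z hz => ?_
    rw [uIcc_of_le hab] at hz
    rw [← h.fderiv_mollify hrO hfi k (hk z hz), fderiv_apply_one_eq_deriv])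
  rw [key]
  refine intervalIntegral.integral_congr fun z hz => ?_
  rw [uIcc_of_le hab] at hz
  exact indicator_of_mem (hKm z hz) g

/-- A negative value would persist on a nonempty open set, which has positive measure. -/
theorem nonneg_of_ae_nonneg_of_continuousOn {f : ℝ → ℝ} {O : Set ℝ} (hO : IsOpen O)
    (hf : ContinuousOn f O) (h : ∀ᵐ t, t ∈ O → 0 ≤ f t) {t : ℝ} (ht : t ∈ O) : 0 ≤ f t := by
  by_contra! hneg
  have h1 : ∀ᶠ s in 𝓝 t, f s < 0 ∧ s ∈ O :=
    ((hf.continuousAt (hO.mem_nhds ht)).eventually (gt_mem_nhds hneg)).and (hO.mem_nhds ht)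
  obtain ⟨V, hV, hVo, htV⟩ := eventually_nhds_iff.1 h1
  have h2 : volume V = 0 := by
    refine measure_mono_null (fun s hs => ?_) h
    intro hs'
    exact absurd (hs' (hV s hs).2) (not_le.2 (hV s hs).1)
  exact (hVo.measure_pos volume ⟨t, htV⟩).ne' h2

end OneDim

/-! ### Space-time derivatives and product test functions. -/

section Slices

variable {n : ℕ}

theorem isOpen_domain : IsOpen (domain n) := isOpen_univ.prod isOpen_Ioi

theorem measurableSet_slab {a b : ℝ} : MeasurableSet (slab n a b) :=
  MeasurableSet.univ.prod measurableSet_Ioo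

theorem IsTest.testOn {φ : Space n × ℝ → ℝ} (h : IsTest φ) : TestOn (domain n) φ :=
  ⟨h.smooth, h.compact, h.support⟩

theorem TestOn.isTest {φ : Space n × ℝ → ℝ} {O : Set (Space n × ℝ)} (h : TestOn O φ)
    (hO : O ⊆ domain n) : IsTest φ :=
  ⟨h.smooth, h.compact, h.support.trans hO⟩

theorem inner_gradX {φ : Space n × ℝ → ℝ} {z : Space n × ℝ} (h : DifferentiableAt ℝ φ z)
    (p : Space n) : inner ℝ p (gradX φ z) = fderiv ℝ φ z (p, 0) := by
  have h1 : HasFDerivAt (fun x : Space n => φ (x, z.2))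
      ((fderiv ℝ φ z).comp (ContinuousLinearMap.inl ℝ (Space n) ℝ)) z.1 := by
    have h2 : HasFDerivAt (fun x : Space n => (x, z.2))
      (ContinuousLinearMap.inl ℝ (Space n) ℝ) z.1 := hasFDerivAt_prodMk_left z.1 z.2
    exact HasFDerivAt.comp (g := φ) z.1 h.hasFDerivAt h2
  rw [gradX, gradient, h1.fderiv, real_inner_comm, InnerProductSpace.toDual_symm_apply]
  rfl

theorem derivT_eq {φ : Space n × ℝ → ℝ} {z : Space n × ℝ} (h : DifferentiableAt ℝ φ z) :
    derivT φ z = fderiv ℝ φ z (0, 1) := by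
  have h2 : HasFDerivAt (fun s : ℝ => (z.1, s))
      (ContinuousLinearMap.inr ℝ (Space n) ℝ) z.2 := hasFDerivAt_prodMk_right z.1 z.2
  have h1 := (HasFDerivAt.comp (g := φ) z.2 h.hasFDerivAt h2).hasDerivAt
  rw [derivT]
  refine h1.deriv.trans ?_
  simp

variable {ζ : Space n → ℝ} {θ : ℝ → ℝ}

theorem hasFDerivAt_prod_mul (hζ : ContDiff ℝ ∞ ζ) (hθ : ContDiff ℝ ∞ θ) (z : Space n × ℝ)
    (p : Space n) (s : ℝ) :
    fderiv ℝ (fun z : Space n × ℝ => ζ z.1 * θ z.2) z (p, s) =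
      fderiv ℝ ζ z.1 p * θ z.2 + ζ z.1 * (deriv θ z.2 * s) := by
  have h1 : HasFDerivAt (fun z : Space n × ℝ => ζ z.1)
      ((fderiv ℝ ζ z.1).comp (ContinuousLinearMap.fst ℝ _ _)) z :=
    HasFDerivAt.comp (g := ζ) z (hζ.differentiable (by simp) z.1).hasFDerivAt hasFDerivAt_fst
  have h2 : HasFDerivAt (fun z : Space n × ℝ => θ z.2)
      ((fderiv ℝ θ z.2).comp (ContinuousLinearMap.snd ℝ _ _)) z :=
    HasFDerivAt.comp (g := θ) z (hθ.differentiable (by simp) z.2).hasFDerivAt hasFDerivAt_snd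
  have h3 : HasFDerivAt (fun z : Space n × ℝ => ζ z.1 * θ z.2) _ z := h1.mul h2
  rw [h3.fderiv]
  have h4 : fderiv ℝ θ z.2 s = deriv θ z.2 * s := by
    rw [← fderiv_apply_one_eq_deriv, mul_comm, ← smul_eq_mul, ← map_smul]; simp
  simp [h4]
  ring

theorem testOn_prod_mul {V : Set (Space n)} {I : Set ℝ} (hζ : TestOn V ζ) (hθ : TestOn I θ) :
    TestOn (V ×ˢ I) (fun z : Space n × ℝ => ζ z.1 * θ z.2) := by
  have hsub : tsupport (fun z : Space n × ℝ => ζ z.1 * θ z.2) ⊆ tsupport ζ ×ˢ tsupport θ := by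
    refine closure_minimal ?_ ((isClosed_tsupport _).prod (isClosed_tsupport _))
    intro z hz
    exact ⟨subset_tsupport _ (left_ne_zero_of_mul hz), subset_tsupport _ (right_ne_zero_of_mul hz)⟩
  refine ⟨(hζ.smooth.comp contDiff_fst).mul (hθ.smooth.comp contDiff_snd), ?_,
    hsub.trans (prod_mono hζ.support hθ.support)⟩
  exact (hζ.compact.isCompact.prod hθ.compact.isCompact).of_isClosed_subset
    (isClosed_tsupport _) hsub

end Slices

end ParabolicSystem

/-! ### The continuity equation with square integrable flux, and its mass balance. -/

namespace ParabolicSystem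

theorem _root_.MeasureTheory.LocallyIntegrableOn.integrable_mul_of_tsupport_subset {X : Type*}
    [TopologicalSpace X] [TopologicalSpace.PseudoMetrizableSpace X] [MeasurableSpace X]
    [BorelSpace X] {μ : Measure X} {O : Set X}
    {f q : X → ℝ} (hf : LocallyIntegrableOn f O μ) (hq : Continuous q)
    (hqc : HasCompactSupport q) (hqO : tsupport q ⊆ O) : Integrable (fun z => f z * q z) μ := by
  obtain ⟨D, hD⟩ := hqc.exists_bound_of_continuous hq
  have h1 : IntegrableOn f (tsupport q) μ := hf.integrableOn_compact_subset hqO hqc.isCompact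
  have h2 : IntegrableOn (fun z => f z * q z) (tsupport q) μ :=
    Integrable.mul_bdd h1 hq.aestronglyMeasurable (Eventually.of_forall hD)
  rw [← integrableOn_univ]
  exact h2.of_forall_sdiff_eq_zero MeasurableSet.univ fun z hz => by
    simp [image_eq_zero_of_notMem_tsupport hz.2]

variable {n : ℕ}

/-- A nonnegative function `v` with initial values `v₀` that satisfies the continuity equation
`v_t = ∇ · F` in `ℝⁿ × (0, ∞)` with a square integrable flux `F`. -/
structure FluxSolution (v : Space n × ℝ → ℝ) (F : Space n × ℝ → Space n) (v₀ : Space n → ℝ) :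
    Prop where
  nonneg : ∀ᵐ z ∂volume.restrict (domain n), 0 ≤ v z
  locInt : LocallyIntegrableOn v (domain n)
  flux_memLp : ∀ T : ℝ, 0 < T → MemLp F 2 (volume.restrict (slab n 0 T))
  equation : ∀ φ : Space n × ℝ → ℝ, IsTest φ →
    ∫ z in domain n, inner ℝ (F z) (gradX φ z) = ∫ z in domain n, v z * derivT φ z
  slice : ∀ t : ℝ, 0 < t → LocallyIntegrable (fun x : Space n => v (x, t))
  time_cont : ∀ ζ : Space n → ℝ, ContDiff ℝ ∞ ζ → HasCompactSupport ζ →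
    ContinuousOn (fun t : ℝ => ∫ x, v (x, t) * ζ x) (Ioi 0)
  initial : ∀ ζ : Space n → ℝ, ContDiff ℝ ∞ ζ → HasCompactSupport ζ →
    Tendsto (fun t : ℝ => ∫ x, v (x, t) * ζ x) (𝓝[>] 0) (𝓝 (∫ x, v₀ x * ζ x))
  init_nonneg : ∀ᵐ x, 0 ≤ v₀ x
  init_int : Integrable v₀
  init_supp : HasCompactSupport v₀

theorem restrict_slab (a b : ℝ) : (volume : Measure (Space n × ℝ)).restrict (slab n a b) =
    (volume : Measure (Space n)).prod (volume.restrict (Ioo a b)) := by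
  rw [slab, Measure.volume_eq_prod, ← Measure.prod_restrict, Measure.restrict_univ]

theorem restrict_domain : (volume : Measure (Space n × ℝ)).restrict (domain n) =
    (volume : Measure (Space n)).prod (volume.restrict (Ioi 0)) := by
  rw [domain, Measure.volume_eq_prod, ← Measure.prod_restrict, Measure.restrict_univ]

theorem slab_subset_domain {a b : ℝ} (ha : 0 ≤ a) : slab n a b ⊆ domain n :=
  prod_mono le_rfl fun _ hs => ha.trans_lt hs.1

theorem ae_slice {p : Space n × ℝ → Prop} (h : ∀ᵐ z ∂volume.restrict (domain n), p z) :
    ∀ᵐ t ∂volume.restrict (Ioi (0 : ℝ)), ∀ᵐ x, p (x, t) := by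
  rw [restrict_domain] at h
  exact Measure.ae_ae_of_ae_prod
    (Measure.measurePreserving_swap.quasiMeasurePreserving.ae h)

theorem integrableOn_of_memLp_slab {F : Space n × ℝ → Space n}
    (hF : ∀ T : ℝ, 0 < T → MemLp F 2 (volume.restrict (slab n 0 T))) {K : Set (Space n)}
    (hKf : volume K ≠ ⊤) {T : ℝ} (hT : 0 < T) : IntegrableOn F (K ×ˢ Ioo 0 T) := by
  have h1 : MemLp F 2 (volume.restrict (K ×ˢ Ioo 0 T)) :=
    (hF T hT).mono_measure (Measure.restrict_mono (prod_mono (subset_univ _) le_rfl) le_rfl)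
  have : IsFiniteMeasure ((volume : Measure (Space n × ℝ)).restrict (K ×ˢ Ioo 0 T)) := by
    constructor
    rw [Measure.restrict_apply_univ, Measure.volume_eq_prod, Measure.prod_prod]
    exact ENNReal.mul_lt_top hKf.lt_top (by simp)
  exact memLp_one_iff_integrable.1 (h1.mono_exponent (by norm_num))

theorem locallyIntegrableOn_of_memLp_slab {F : Space n × ℝ → Space n}
    (hF : ∀ T : ℝ, 0 < T → MemLp F 2 (volume.restrict (slab n 0 T))) :
    LocallyIntegrableOn F (domain n) ∧ LocallyIntegrableOn (fun z => ‖F z‖ ^ 2) (domain n) := by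
  have hT : ∀ K ⊆ domain n, IsCompact K → ∃ T, 0 < T ∧ K ⊆ (Prod.fst '' K) ×ˢ Ioo 0 T := by
    intro K hK hKc
    obtain ⟨b, hb⟩ := (hKc.image continuous_snd).bddAbove
    refine ⟨max 0 b + 1, by positivity, fun z hz => ⟨mem_image_of_mem _ hz, (hK hz).2, ?_⟩⟩
    exact ((hb (mem_image_of_mem _ hz)).trans (le_max_right 0 b)).trans_lt (lt_add_one _)
  constructor
  · refine (locallyIntegrableOn_iff isOpen_domain.isLocallyClosed).2 fun K hK hKc => ?_
    obtain ⟨T, hT0, hKT⟩ := hT K hK hKc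
    exact (integrableOn_of_memLp_slab hF
      (hKc.image continuous_fst).measure_ne_top hT0).mono_set hKT
  · refine (locallyIntegrableOn_iff isOpen_domain.isLocallyClosed).2 fun K hK hKc => ?_
    obtain ⟨T, hT0, hKT⟩ := hT K hK hKc
    have h2 : IntegrableOn (fun z => ‖F z‖ ^ 2) (slab n 0 T) :=
      (hF T hT0).integrable_norm_pow (by norm_num)
    exact h2.mono_set (hKT.trans (prod_mono (subset_univ _) le_rfl))

namespace FluxSolution

variable {v : Space n × ℝ → ℝ} {F : Space n × ℝ → Space n} {v₀ : Space n → ℝ}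

theorem flux_integrableOn (h : FluxSolution v F v₀) {K : Set (Space n)}
    (hKf : volume K ≠ ⊤) {T : ℝ} (hT : 0 < T) : IntegrableOn F (K ×ˢ Ioo 0 T) :=
  integrableOn_of_memLp_slab h.flux_memLp hKf hT

theorem integrableOn_fderiv_flux (h : FluxSolution v F v₀) {ζ : Space n → ℝ}
    (hζ : ContDiff ℝ ∞ ζ) (hζc : HasCompactSupport ζ) {T : ℝ} (hT : 0 < T) :
    IntegrableOn (fun z => fderiv ℝ ζ z.1 (F z)) (slab n 0 T) := by
  have hc : Continuous (fderiv ℝ ζ) := hζ.continuous_fderiv (by simp)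
  obtain ⟨D, hD⟩ := (hζc.fderiv ℝ).exists_bound_of_continuous hc
  have hF := h.flux_integrableOn hζc.isCompact.measure_ne_top hT
  have h2 : IntegrableOn (fun z => fderiv ℝ ζ z.1 (F z)) (tsupport ζ ×ˢ Ioo 0 T) := by
    refine Integrable.mono' (hF.norm.const_mul D) ?_ (Eventually.of_forall fun z => ?_)
    · have h3 : AEStronglyMeasurable (fun z : Space n × ℝ => fderiv ℝ ζ z.1)
          (volume.restrict (tsupport ζ ×ˢ Ioo 0 T)) :=
        (hc.comp continuous_fst).aestronglyMeasurable
      exact ContinuousLinearMap.aestronglyMeasurable_comp₂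
        (ContinuousLinearMap.id ℝ (Space n →L[ℝ] ℝ)) h3 hF.aestronglyMeasurable
    · exact ((fderiv ℝ ζ z.1).le_opNorm _).trans
        (mul_le_mul_of_nonneg_right (hD _) (norm_nonneg _))
  refine h2.of_forall_sdiff_eq_zero measurableSet_slab fun z hz => ?_
  have hz' : z.1 ∉ tsupport ζ := fun h' => hz.2 ⟨h', hz.1.2⟩
  exact fderiv_eq_zero_of_notMem_tsupport _ hz'

/-- Test the equation with the product of `ζ` and a function `θ` of time, and apply Fubini. -/
theorem hasWeakDeriv_mass (h : FluxSolution v F v₀) {ζ : Space n → ℝ}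
    (hζ : ContDiff ℝ ∞ ζ) (hζc : HasCompactSupport ζ) :
    HasWeakDeriv volume (Ioi 0) 1 (fun t => ∫ x, v (x, t) * ζ x)
      (fun t => - ∫ x, fderiv ℝ ζ x (F (x, t))) := by
  intro θ hθ
  have hψ := testOn_prod_mul (V := univ) (I := Ioi 0) ⟨hζ, hζc, subset_univ _⟩ hθ
  have hdψ := hψ.smooth.differentiable (by simp)
  have heq := h.equation _ (hψ.isTest le_rfl)
  obtain ⟨T, hT0, hT⟩ : ∃ T : ℝ, 0 < T ∧ tsupport θ ⊆ Iio T := by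
    obtain ⟨b, hb⟩ := hθ.compact.isCompact.bddAbove
    exact ⟨max 0 b + 1, by positivity, fun s hs =>
      (((hb hs).trans (le_max_right 0 b)).trans_lt (lt_add_one _))⟩
  obtain ⟨D, hD⟩ := hθ.compact.exists_bound_of_continuous hθ.smooth.continuous
  have hp := h.integrableOn_fderiv_flux hζ hζc hT0
  have i1 : IntegrableOn (fun z : Space n × ℝ => fderiv ℝ ζ z.1 (F z) * θ z.2) (domain n) := by
    have : IntegrableOn (fun z : Space n × ℝ => fderiv ℝ ζ z.1 (F z) * θ z.2) (slab n 0 T) :=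
      Integrable.mul_bdd hp (hθ.smooth.continuous.comp continuous_snd).aestronglyMeasurable
        (Eventually.of_forall fun z => hD z.2)
    refine this.of_forall_sdiff_eq_zero isOpen_domain.measurableSet fun z hz => ?_
    have : z.2 ∉ tsupport θ := fun h' => hz.2 ⟨mem_univ _, hz.1.2, hT h'⟩
    simp [image_eq_zero_of_notMem_tsupport this]
  have i2 : IntegrableOn (fun z : Space n × ℝ => v z * (ζ z.1 * deriv θ z.2)) (domain n) := by
    have hd : Continuous (deriv θ) := hθ.smooth.continuous_deriv (by simp)
    have hsub : tsupport (fun z : Space n × ℝ => ζ z.1 * deriv θ z.2) ⊆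
        tsupport ζ ×ˢ tsupport θ := by
      refine closure_minimal ?_ ((isClosed_tsupport _).prod (isClosed_tsupport _))
      intro z hz
      exact ⟨subset_tsupport _ (left_ne_zero_of_mul hz),
        support_deriv_subset (right_ne_zero_of_mul hz)⟩
    refine (h.locInt.integrable_mul_of_tsupport_subset
      ((hζ.continuous.comp continuous_fst).mul (hd.comp continuous_snd)) ?_ ?_).integrableOn
    · exact (hζc.isCompact.prod hθ.compact.isCompact).of_isClosed_subset
        (isClosed_tsupport _) hsub
    · exact hsub.trans (prod_mono (subset_univ _) hθ.support)
  have e1 : ∀ z, inner ℝ (F z) (gradX (fun z : Space n × ℝ => ζ z.1 * θ z.2) z) =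
      fderiv ℝ ζ z.1 (F z) * θ z.2 := fun z => by
    rw [inner_gradX (hdψ z), hasFDerivAt_prod_mul hζ hθ.smooth]; simp
  have e2 : ∀ z, derivT (fun z : Space n × ℝ => ζ z.1 * θ z.2) z = ζ z.1 * deriv θ z.2 :=
    fun z => by
    rw [derivT_eq (hdψ z), hasFDerivAt_prod_mul hζ hθ.smooth]; simp
  simp_rw [e1, e2] at heq
  rw [IntegrableOn, restrict_domain] at i1 i2
  rw [restrict_domain, integral_prod_symm _ i1, integral_prod_symm _ i2] at heq
  have hz : ∀ {p : ℝ → ℝ}, (∀ s ∉ tsupport θ, p s = 0) → ∫ s, p s = ∫ s in Ioi 0, p s :=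
    fun hp => (setIntegral_eq_integral_of_forall_compl_eq_zero
      fun s hs => hp s fun h' => hs (hθ.support h')).symm
  rw [hz fun s hs => by simp [fderiv_eq_zero_of_notMem_tsupport _ hs],
    hz fun s hs => by simp [image_eq_zero_of_notMem_tsupport hs]]
  simp_rw [mul_neg, integral_neg, neg_neg, fderiv_apply_one_eq_deriv, ← integral_const_mul,
    ← integral_mul_const, mul_comm (θ _), mul_assoc]
  exact heq.symm

/-- The balance of mass. -/
theorem mass_balance (h : FluxSolution v F v₀) {ζ : Space n → ℝ}
    (hζ : ContDiff ℝ ∞ ζ) (hζc : HasCompactSupport ζ) {t : ℝ} (ht : 0 < t) :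
    ∫ x, v (x, t) * ζ x = (∫ x, v₀ x * ζ x) - ∫ z in slab n 0 t, fderiv ℝ ζ z.1 (F z) := by
  have hi : ∀ T, 0 < T → IntegrableOn (fun t => ∫ x, fderiv ℝ ζ x (F (x, t))) (Ioo 0 T) := by
    intro T hT
    have := h.integrableOn_fderiv_flux hζ hζc hT
    rw [IntegrableOn, restrict_slab] at this
    exact this.integral_prod_right
  have hloc : LocallyIntegrableOn (fun t => - ∫ x, fderiv ℝ ζ x (F (x, t))) (Ioi 0) := by
    refine (locallyIntegrableOn_iff isOpen_Ioi.isLocallyClosed).2 fun K hK hKc => ?_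
    obtain ⟨b, hb⟩ := hKc.bddAbove
    exact ((hi (max 0 b + 1) (by positivity)).mono_set fun s hs => ⟨hK hs,
      (((hb hs).trans (le_max_right 0 b)).trans_lt (lt_add_one _))⟩).neg
  have key : ∀ a, 0 < a → a ≤ t → (∫ x, v (x, t) * ζ x) - ∫ x, v (x, a) * ζ x =
      ∫ s in a..t, - ∫ x, fderiv ℝ ζ x (F (x, s)) := fun a ha hat =>
    (h.hasWeakDeriv_mass hζ hζc).sub_eq_integral (h.time_cont ζ hζ hζc) hloc isOpen_Ioi hat
      fun s hs => ha.trans_le hs.1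
  have hii : IntervalIntegrable (fun t => ∫ x, fderiv ℝ ζ x (F (x, t))) volume 0 t := by
    rw [intervalIntegrable_iff_integrableOn_Ioo_of_le ht.le]
    exact hi t ht
  -- The lower endpoint may go to `0` since the flux is integrable up to the initial time: its
  -- square is integrable on the whole slab `(0, t)`, not just away from `0`.
  have l1 : Tendsto (fun a => ∫ s in a..t, - ∫ x, fderiv ℝ ζ x (F (x, s))) (𝓝[>] 0)
      (𝓝 (∫ s in (0:ℝ)..t, - ∫ x, fderiv ℝ ζ x (F (x, s)))) := by
    have hc := (intervalIntegral.continuousOn_primitive_interval_left (a := 0) (b := t)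
      (f := fun s => - ∫ x, fderiv ℝ ζ x (F (x, s))) (μ := volume) (by
        rw [uIcc_of_le ht.le, integrableOn_Icc_iff_integrableOn_Ioo]
        exact (hi t ht).neg)) 0 left_mem_uIcc
    rw [uIcc_of_le ht.le] at hc
    exact hc.tendsto.mono_left (nhdsWithin_le_of_mem (mem_of_superset (Ioo_mem_nhdsGT ht)
      Ioo_subset_Icc_self))
  have l2 : Tendsto (fun a => (∫ x, v (x, t) * ζ x) - ∫ x, v (x, a) * ζ x) (𝓝[>] 0)
      (𝓝 ((∫ x, v (x, t) * ζ x) - ∫ x, v₀ x * ζ x)) :=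
    tendsto_const_nhds.sub (h.initial ζ hζ hζc)
  have l3 := tendsto_nhds_unique_of_eventuallyEq l2 l1 (by
    filter_upwards [Ioo_mem_nhdsGT ht] with a ha using key a ha.1 ha.2.le)
  have e : ∫ z in slab n 0 t, fderiv ℝ ζ z.1 (F z) =
      ∫ s in (0:ℝ)..t, ∫ x, fderiv ℝ ζ x (F (x, s)) := by
    have := h.integrableOn_fderiv_flux hζ hζc ht
    rw [IntegrableOn, restrict_slab] at this
    rw [restrict_slab, integral_prod_symm _ this, intervalIntegral.integral_of_le ht.le,
      integral_Ioc_eq_integral_Ioo]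
  rw [intervalIntegral.integral_neg] at l3
  rw [e]
  linarith

theorem slice_mul_nonneg (h : FluxSolution v F v₀) {ζ : Space n → ℝ}
    (hζ : ContDiff ℝ ∞ ζ) (hζc : HasCompactSupport ζ) (hζ0 : ∀ x, 0 ≤ ζ x) {t : ℝ} (ht : 0 < t) :
    0 ≤ ∫ x, v (x, t) * ζ x := by
  refine nonneg_of_ae_nonneg_of_continuousOn (f := fun t => ∫ x, v (x, t) * ζ x) isOpen_Ioi
    (h.time_cont ζ hζ hζc) ?_ (mem_Ioi.2 ht)
  rw [← ae_restrict_iff' measurableSet_Ioi]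
  filter_upwards [ae_slice h.nonneg] with s hs
  exact integral_nonneg_of_ae (hs.mono fun x hx => mul_nonneg hx (hζ0 x))

/-- Nonnegativity in space-time only concerns almost every time. Continuity in the sense of
distributions carries it to pairings at every time, and pairings with shrinking kernels recover the
values almost everywhere in space. -/
theorem slice_nonneg (h : FluxSolution v F v₀) {t : ℝ} (ht : 0 < t) :
    ∀ᵐ x, 0 ≤ v (x, t) := by
  filter_upwards [mollify_ae_tendsto (h.slice t ht)] with x hx
  refine ge_of_tendsto' hx fun k => ?_
  have hk := testOn_kernel (μ := (volume : Measure (Space n))) k (subset_univ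
    (Metric.closedBall x (bump (Space n) k).rOut))
  have := h.slice_mul_nonneg hk.smooth hk.compact (fun w => (bump (Space n) k).nonneg_normed _) ht
  simpa only [mollify, mul_comm] using this

end FluxSolution

end ParabolicSystem

/-! ### Spatial cutoffs and the bootstrap of mass growth. -/

namespace ParabolicSystem

variable {n : ℕ}

/-- Cutoff functions at scale `R`. -/
structure IsCutoff (D R : ℝ) (ζ : Space n → ℝ) : Prop where
  smooth : ContDiff ℝ ∞ ζ
  nonneg : ∀ x, 0 ≤ ζ x
  le_one : ∀ x, ζ x ≤ 1
  eq_one : ∀ x, ‖x‖ ≤ R → ζ x = 1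
  eq_zero : ∀ x, 2 * R ≤ ‖x‖ → ζ x = 0
  fderiv_le : ∀ x, ‖fderiv ℝ ζ x‖ ≤ D / R
  fderiv_eq_zero : ∀ x, ‖x‖ < R ∨ 2 * R < ‖x‖ → fderiv ℝ ζ x = 0

theorem IsCutoff.hasCompactSupport {D R : ℝ} {ζ : Space n → ℝ} (h : IsCutoff D R ζ) :
    HasCompactSupport ζ := by
  refine HasCompactSupport.intro (isCompact_closedBall 0 (2 * R)) fun x hx => h.eq_zero x ?_
  simpa using (not_le.1 (by simpa using hx)).le

theorem exists_cutoff (n : ℕ) : ∃ D : ℝ, 0 ≤ D ∧ ∀ R : ℝ, 0 < R →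
    ∃ ζ : Space n → ℝ, IsCutoff D R ζ := by
  set b : ContDiffBump (0 : Space n) := ⟨1, 2, one_pos, one_lt_two⟩
  have hb : ContDiff ℝ ∞ b := b.contDiff
  obtain ⟨D, hD⟩ := (b.hasCompactSupport.fderiv ℝ).exists_bound_of_continuous
    (hb.continuous_fderiv (by simp))
  refine ⟨D, (norm_nonneg _).trans (hD 0), fun R hR => ⟨fun x => b (R⁻¹ • x), ?_⟩⟩
  have hn : ∀ x : Space n, ‖R⁻¹ • x‖ = ‖x‖ / R := fun x => by
    rw [norm_smul, Real.norm_eq_abs, abs_of_pos (inv_pos.2 hR), div_eq_inv_mul]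
  have h1 : ∀ x : Space n, ‖x‖ ≤ R → b (R⁻¹ • x) = 1 := fun x hx =>
    b.one_of_mem_closedBall (by simpa [hn] using (div_le_one hR).2 hx)
  have h2 : ∀ x : Space n, 2 * R ≤ ‖x‖ → b (R⁻¹ • x) = 0 := fun x hx => by
    refine b.zero_of_le_dist ?_
    rw [dist_zero_right, hn]
    exact (le_div_iff₀ hR).2 hx
  have hev : ∀ {x : Space n} {c : ℝ}, (∀ᶠ y in 𝓝 x, b (R⁻¹ • y) = c) →
      fderiv ℝ (fun x => b (R⁻¹ • x)) x = 0 := fun {x c} h => by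
    rw [Filter.EventuallyEq.fderiv_eq (f := fun _ => c) h]
    simp
  refine ⟨hb.comp (contDiff_const_smul _), fun x => b.nonneg, fun x => b.le_one, h1, h2, ?_, ?_⟩
  · intro x
    have h3 : HasFDerivAt (fun x : Space n => b (R⁻¹ • x)) ((fderiv ℝ b (R⁻¹ • x)).comp
        (R⁻¹ • ContinuousLinearMap.id ℝ (Space n))) x :=
      HasFDerivAt.comp (g := b) x (hb.differentiable (by simp) _).hasFDerivAt
        ((hasFDerivAt_id x).const_smul R⁻¹)
    rw [h3.fderiv, ContinuousLinearMap.comp_smul, ContinuousLinearMap.comp_id, norm_smul,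
      Real.norm_eq_abs, abs_of_pos (inv_pos.2 hR), div_eq_inv_mul]
    exact mul_le_mul_of_nonneg_left (hD _) (inv_pos.2 hR).le
  · rintro x (hx | hx)
    · refine hev (c := 1) ?_
      filter_upwards [(continuous_norm.tendsto x).eventually (gt_mem_nhds hx)] with y hy
      exact h1 y hy.le
    · refine hev (c := 0) ?_
      filter_upwards [(continuous_norm.tendsto x).eventually (lt_mem_nhds hx)] with y hy
      exact h2 y hy.le

/-- The annulus `R ≤ |x| ≤ 2R`. -/
def annulus (n : ℕ) (R : ℝ) : Set (Space n) := {x | R ≤ ‖x‖ ∧ ‖x‖ ≤ 2 * R}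

theorem isCompact_annulus (R : ℝ) : IsCompact (annulus n R) := by
  refine (isCompact_closedBall (0 : Space n) (2 * R)).of_isClosed_subset ?_ fun x hx => by
    simpa using hx.2
  exact (isClosed_le continuous_const continuous_norm).inter
    (isClosed_le continuous_norm continuous_const)

theorem measurableSet_annulus_prod (R T : ℝ) :
    MeasurableSet (annulus n R ×ˢ Ioo 0 T) :=
  (isCompact_annulus R).isClosed.measurableSet.prod measurableSet_Ioo

/-- The mass of `v` in `B_R × (0, T)`. -/
noncomputable def massIn (v : Space n × ℝ → ℝ) (R T : ℝ) : ENNReal :=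
  ∫⁻ z in Metric.ball (0 : Space n) R ×ˢ Ioo 0 T, ENNReal.ofReal (v z)

/-- The amount of flux in the annulus `R ≤ |x| ≤ 2R` during the time interval `(0, T)`. -/
noncomputable def fluxIn (F : Space n × ℝ → Space n) (R T : ℝ) : ℝ :=
  ∫ z in annulus n R ×ˢ Ioo 0 T, ‖F z‖

namespace FluxSolution

variable {v : Space n × ℝ → ℝ} {F : Space n × ℝ → Space n} {v₀ : Space n → ℝ}

theorem fluxIn_mono (h : FluxSolution v F v₀) {R t T : ℝ} (hT : 0 < T) (htT : t ≤ T) :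
    fluxIn F R t ≤ fluxIn F R T := by
  refine setIntegral_mono_set
    (h.flux_integrableOn (isCompact_annulus R).measure_ne_top hT).norm
    (Eventually.of_forall fun z => norm_nonneg _) ?_
  exact (prod_mono le_rfl (Ioo_subset_Ioo_right htT)).eventuallyLE

theorem abs_flux_integral_le (h : FluxSolution v F v₀) {D R : ℝ} {ζ : Space n → ℝ}
    (hζ : IsCutoff D R ζ) {t : ℝ} (ht : 0 < t) :
    |∫ z in slab n 0 t, fderiv ℝ ζ z.1 (F z)| ≤ D / R * fluxIn F R t := by
  have h1 : ∫ z in slab n 0 t, fderiv ℝ ζ z.1 (F z) =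
      ∫ z in annulus n R ×ˢ Ioo 0 t, fderiv ℝ ζ z.1 (F z) := by
    refine (setIntegral_eq_of_subset_of_forall_sdiff_eq_zero measurableSet_slab
      (prod_mono (subset_univ _) le_rfl) fun z hz => ?_)
    have : ‖z.1‖ < R ∨ 2 * R < ‖z.1‖ := by
      by_contra! h'
      exact hz.2 ⟨h', hz.1.2⟩
    rw [hζ.fderiv_eq_zero _ this]
    rfl
  rw [h1, fluxIn, ← integral_const_mul, ← Real.norm_eq_abs]
  refine norm_integral_le_of_norm_le
    ((h.flux_integrableOn (isCompact_annulus R).measure_ne_top ht).norm.const_mul _)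
    (Eventually.of_forall fun z => ?_)
  exact ((fderiv ℝ ζ z.1).le_opNorm _).trans
    (mul_le_mul_of_nonneg_right (hζ.fderiv_le _) (norm_nonneg _))

theorem integral_mul_cutoff_le (h : FluxSolution v F v₀) {D R : ℝ} {ζ : Space n → ℝ}
    (hζ : IsCutoff D R ζ) {t : ℝ} (ht : 0 < t) :
    ∫ x, v (x, t) * ζ x ≤ (∫ x, v₀ x) + D / R * fluxIn F R t := by
  rw [h.mass_balance hζ.smooth hζ.hasCompactSupport ht]
  have h1 := (abs_le.1 (h.abs_flux_integral_le hζ ht)).1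
  have h2 : ∫ x, v₀ x * ζ x ≤ ∫ x, v₀ x := by
    refine integral_mono_of_nonneg ?_ h.init_int ?_
    · filter_upwards [h.init_nonneg] with x hx using mul_nonneg hx (hζ.nonneg x)
    · filter_upwards [h.init_nonneg] with x hx using mul_le_of_le_one_right hx (hζ.le_one x)
  linarith

theorem integrable_slice_mul (h : FluxSolution v F v₀) {ζ : Space n → ℝ}
    (hζ : Continuous ζ) (hζc : HasCompactSupport ζ) {t : ℝ} (ht : 0 < t) :
    Integrable fun x => v (x, t) * ζ x := by
  have := (locallyIntegrableOn_univ.2 (h.slice t ht)).integrable_mul_of_tsupport_subset hζ hζc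
    (subset_univ _)
  exact this

theorem lintegral_slice_mul (h : FluxSolution v F v₀) {ζ : Space n → ℝ}
    (hζ : Continuous ζ) (hζc : HasCompactSupport ζ) (hζ0 : ∀ x, 0 ≤ ζ x) {t : ℝ} (ht : 0 < t) :
    ∫⁻ x, ENNReal.ofReal (v (x, t) * ζ x) = ENNReal.ofReal (∫ x, v (x, t) * ζ x) := by
  rw [ofReal_integral_eq_lintegral_ofReal (h.integrable_slice_mul hζ hζc ht)]
  filter_upwards [h.slice_nonneg ht] with x hx using mul_nonneg hx (hζ0 x)

/-- The cutoff equals `1` on `B_R`, so the slice mass is bounded by the cutoff mass; this is then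
integrated over `(0, T)`. The factor `1/R` from the cutoff gradient is the gain that drives the
bootstrap. -/
theorem massIn_le (h : FluxSolution v F v₀) {D : ℝ} (hD : 0 ≤ D)
    (hcut : ∀ R : ℝ, 0 < R → ∃ ζ : Space n → ℝ, IsCutoff D R ζ) {R T : ℝ} (hR : 0 < R)
    (hT : 0 < T) :
    massIn v R T ≤ ENNReal.ofReal (T * ((∫ x, v₀ x) + D / R * fluxIn F R T)) := by
  obtain ⟨ζ, hζ⟩ := hcut R hR
  have e : massIn v R T = ∫⁻ t in Ioo 0 T, ∫⁻ x in Metric.ball 0 R, ENNReal.ofReal (v (x, t)) := by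
    rw [massIn, Measure.volume_eq_prod, ← Measure.prod_restrict, lintegral_prod_symm]
    rw [Measure.prod_restrict, ← Measure.volume_eq_prod]
    exact (h.locInt.aestronglyMeasurable.aemeasurable.mono_measure
      (Measure.restrict_mono (Set.prod_mono (subset_univ _) Ioo_subset_Ioi_self) le_rfl)).ennreal_ofReal
  rw [e]
  have hb : ∀ t ∈ Ioo 0 T, ∫⁻ x in Metric.ball 0 R, ENNReal.ofReal (v (x, t)) ≤
      ENNReal.ofReal ((∫ x, v₀ x) + D / R * fluxIn F R T) := by
    intro t ht
    calc _ ≤ ∫⁻ x in Metric.ball 0 R, ENNReal.ofReal (v (x, t) * ζ x) := by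
          refine setLIntegral_mono' Metric.isOpen_ball.measurableSet fun x hx => ?_
          rw [hζ.eq_one x (mem_ball_zero_iff.1 hx).le, mul_one]
      _ ≤ ∫⁻ x, ENNReal.ofReal (v (x, t) * ζ x) := setLIntegral_le_lintegral _ _
      _ = ENNReal.ofReal (∫ x, v (x, t) * ζ x) :=
          h.lintegral_slice_mul hζ.smooth.continuous hζ.hasCompactSupport hζ.nonneg ht.1
      _ ≤ _ := by
          refine ENNReal.ofReal_le_ofReal ((h.integral_mul_cutoff_le hζ ht.1).trans ?_)
          gcongr
          exact h.fluxIn_mono hT ht.2.le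
  calc _ ≤ ∫⁻ t in Ioo 0 T, ENNReal.ofReal ((∫ x, v₀ x) + D / R * fluxIn F R T) :=
        setLIntegral_mono' measurableSet_Ioo hb
    _ = _ := by
        rw [setLIntegral_const, Real.volume_Ioo, sub_zero, mul_comm,
          ← ENNReal.ofReal_mul hT.le]

/-- Growth of the mass at most like `R ^ a`. -/
def MassGrowth (v : Space n × ℝ → ℝ) (a : ℝ) : Prop :=
  ∀ T : ℝ, 0 < T → ∃ C R₀ : ℝ, 0 ≤ C ∧ ∀ R : ℝ, R₀ ≤ R →
    massIn v R T ≤ ENNReal.ofReal (C * R ^ a)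

/-- The flux through large annuli is controlled by the mass. -/
def FluxBound (v : Space n × ℝ → ℝ) (F : Space n × ℝ → Space n) (ϑ : ℝ) : Prop :=
  ∀ T : ℝ, 0 < T → ∃ C R₀ : ℝ, 0 ≤ C ∧ ∀ R : ℝ, R₀ ≤ R → massIn v (4 * R) (T + 1) ≠ ⊤ →
    fluxIn F R T ≤ C * R ^ (1 - ϑ) * ((massIn v (4 * R) (T + 1)).toReal + 1)

/-- The enlarged cylinder of `FluxBound` only changes constants, because the mass growth is assumed
for every time and every large radius. -/
theorem fluxIn_le_of_massGrowth {a ϑ : ℝ} (ha : 0 ≤ a) (hF : FluxBound v F ϑ)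
    (hv : MassGrowth v a) {T : ℝ} (hT : 0 < T) :
    ∃ C R₀ : ℝ, 0 ≤ C ∧ 1 ≤ R₀ ∧ ∀ R : ℝ, R₀ ≤ R → fluxIn F R T / R ≤ C * R ^ (a - ϑ) := by
  obtain ⟨C, R₀, hC, h1⟩ := hF T hT
  obtain ⟨C', R₁, hC', h2⟩ := hv (T + 1) (by positivity)
  refine ⟨C * (C' * 4 ^ a + 1), max 1 (max R₀ R₁), by positivity, le_max_left _ _, fun R hR => ?_⟩
  have hR1 : 1 ≤ R := (le_max_left _ _).trans hR
  have hR0 : R₀ ≤ R := ((le_max_left _ _).trans (le_max_right _ _)).trans hR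
  have hR2 : R₁ ≤ 4 * R := (((le_max_right _ _).trans (le_max_right _ _)).trans hR).trans
    (by linarith)
  have hRpos : 0 < R := by linarith
  have hm := h2 (4 * R) hR2
  have hm' : (massIn v (4 * R) (T + 1)).toReal ≤ C' * (4 * R) ^ a :=
    ENNReal.toReal_le_of_le_ofReal (by positivity) hm
  have h3 := h1 R hR0 (ne_top_of_le_ne_top ENNReal.ofReal_ne_top hm)
  have hRa : 1 ≤ R ^ a := Real.one_le_rpow hR1 ha
  rw [div_le_iff₀ hRpos]
  calc fluxIn F R T ≤ C * R ^ (1 - ϑ) * (C' * (4 * R) ^ a + 1) := h3.trans (by gcongr)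
    _ ≤ C * R ^ (1 - ϑ) * (C' * 4 ^ a * R ^ a + 1 * R ^ a) := by
        rw [Real.mul_rpow (by norm_num) hRpos.le, mul_assoc C']
        gcongr
        linarith
    _ = C * (C' * 4 ^ a + 1) * (R ^ (1 - ϑ) * R ^ a) := by ring
    _ = C * (C' * 4 ^ a + 1) * (R ^ (a - ϑ) * R) := by
        rw [← Real.rpow_add hRpos]
        congr 1
        conv_rhs => rw [← Real.rpow_one R, ← Real.rpow_mul hRpos.le, one_mul,
          ← Real.rpow_add hRpos]
        congr 1
        ring
    _ = _ := by ring

/-- One round of the bootstrap. The exponent cannot be pushed below `0` because the initial mass in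
the balance does not decay with `R`. -/
theorem massGrowth_step (h : FluxSolution v F v₀) {a ϑ : ℝ} (ha : 0 ≤ a)
    (hF : FluxBound v F ϑ) (hv : MassGrowth v a) : MassGrowth v (max (a - ϑ) 0) := by
  obtain ⟨D, hD, hcut⟩ := exists_cutoff n
  intro T hT
  obtain ⟨C, R₀, hC, hR₀, h1⟩ := fluxIn_le_of_massGrowth ha hF hv hT
  have hM : 0 ≤ ∫ x, v₀ x := integral_nonneg_of_ae h.init_nonneg
  refine ⟨T * ((∫ x, v₀ x) + D * C), R₀, by positivity, fun R hR => ?_⟩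
  have hR1 : 1 ≤ R := hR₀.trans hR
  refine (h.massIn_le hD hcut (by linarith) hT).trans (ENNReal.ofReal_le_ofReal ?_)
  have h2 : R ^ (a - ϑ) ≤ R ^ (max (a - ϑ) 0) :=
    Real.rpow_le_rpow_of_exponent_le hR1 (le_max_left _ _)
  have h3 : 1 ≤ R ^ (max (a - ϑ) 0) := Real.one_le_rpow hR1 (le_max_right _ _)
  rw [mul_assoc]
  refine mul_le_mul_of_nonneg_left ?_ hT.le
  calc (∫ x, v₀ x) + D / R * fluxIn F R T = (∫ x, v₀ x) * 1 + D * (fluxIn F R T / R) := by ring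
    _ ≤ (∫ x, v₀ x) * R ^ (max (a - ϑ) 0) + D * (C * R ^ (max (a - ϑ) 0)) := by
        gcongr
        exact (h1 R hR).trans (by gcongr)
    _ = _ := by ring

/-- On an annulus, of volume `O(R^n)`, one has `‖F‖ ≤ ‖F‖² + 1`, and `‖F‖²` is integrable over the
slab. This starts the bootstrap and also shows that the mass in large cylinders is finite. -/
theorem massGrowth_base (h : FluxSolution v F v₀) : MassGrowth v n := by
  obtain ⟨D, hD, hcut⟩ := exists_cutoff n
  intro T hT
  have hM : 0 ≤ ∫ x, v₀ x := integral_nonneg_of_ae h.init_nonneg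
  have hF2 : IntegrableOn (fun z => ‖F z‖ ^ 2) (slab n 0 T) :=
    (h.flux_memLp T hT).integrable_norm_pow (by norm_num)
  set Q := ∫ z in slab n 0 T, ‖F z‖ ^ 2 with hQ
  have hQ0 : 0 ≤ Q := integral_nonneg fun z => by positivity
  set V := volume.real (Metric.closedBall (0 : Space n) 2) with hV
  refine ⟨T * ((∫ x, v₀ x) + D * (Q + V * T)), 1, by positivity, fun R hR => ?_⟩
  have hRpos : 0 < R := by linarith
  refine (h.massIn_le hD hcut hRpos hT).trans (ENNReal.ofReal_le_ofReal ?_)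
  have hvol : (volume : Measure (Space n × ℝ)).real (annulus n R ×ˢ Ioo 0 T) ≤ R ^ (n:ℝ) * V * T := by
    rw [Measure.volume_eq_prod, measureReal_prod_prod]
    simp only [Real.volume_real_Ioo_of_le hT.le, sub_zero]
    refine mul_le_mul_of_nonneg_right ?_ hT.le
    calc volume.real (annulus n R) ≤ volume.real (Metric.closedBall (0 : Space n) (R * 2)) := by
          refine measureReal_mono (fun x hx => ?_) (isCompact_closedBall _ _).measure_ne_top
          simpa [mul_comm] using hx.2
      _ = _ := by
          rw [Measure.real, Measure.addHaar_closedBall_mul _ _ hRpos.le (by norm_num)]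
          simp [Measure.real, hV, finrank_euclideanSpace, hRpos.le]
  have hfl : fluxIn F R T ≤ Q + R ^ (n:ℝ) * V * T := by
    have hfin : volume (annulus n R ×ˢ Ioo 0 T) ≠ ⊤ := by
      rw [Measure.volume_eq_prod, Measure.prod_prod]
      exact (ENNReal.mul_lt_top (isCompact_annulus R).measure_lt_top (by simp)).ne
    have hi2 : IntegrableOn (fun z => ‖F z‖ ^ 2) (annulus n R ×ˢ Ioo 0 T) :=
      hF2.mono_set (prod_mono (subset_univ _) le_rfl)
    calc fluxIn F R T ≤ ∫ z in annulus n R ×ˢ Ioo 0 T, (‖F z‖ ^ 2 + 1) := by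
          refine integral_mono (h.flux_integrableOn (isCompact_annulus R).measure_ne_top hT).norm
            (hi2.add (integrableOn_const hfin)) fun z => ?_
          simp only
          nlinarith [sq_nonneg (‖F z‖ - 1), sq_nonneg ‖F z‖]
      _ = (∫ z in annulus n R ×ˢ Ioo 0 T, ‖F z‖ ^ 2) +
            volume.real (annulus n R ×ˢ Ioo 0 T) := by
          rw [integral_add hi2 (integrableOn_const hfin)]
          simp
      _ ≤ _ := by
          refine add_le_add ?_ hvol
          exact setIntegral_mono_set hF2 (Eventually.of_forall fun z => by positivity)
            (prod_mono (subset_univ _) le_rfl).eventuallyLE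
  have hRn : 1 ≤ R ^ (n:ℝ) := Real.one_le_rpow hR (by positivity)
  rw [mul_assoc]
  refine mul_le_mul_of_nonneg_left ?_ hT.le
  calc (∫ x, v₀ x) + D / R * fluxIn F R T ≤
        (∫ x, v₀ x) * R ^ (n:ℝ) + D / 1 * (Q * R ^ (n:ℝ) + R ^ (n:ℝ) * V * T) := by
        have : fluxIn F R T ≤ Q * R ^ (n:ℝ) + R ^ (n:ℝ) * V * T :=
          hfl.trans (by gcongr; exact le_mul_of_one_le_right hQ0 hRn)
        have h0 : 0 ≤ fluxIn F R T := integral_nonneg fun z => norm_nonneg _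
        gcongr
        exact le_mul_of_one_le_right hM hRn
    _ = _ := by ring

/-- Each round lowers the exponent by `ϑ`, down to the floor `0`; about `n / ϑ` rounds suffice. -/
theorem massGrowth_zero (h : FluxSolution v F v₀) {ϑ : ℝ} (hϑ : 0 < ϑ)
    (hF : FluxBound v F ϑ) : MassGrowth v 0 := by
  have h1 : ∀ k : ℕ, MassGrowth v (max (n - k * ϑ) 0) := by
    intro k
    induction k with
    | zero => simpa using h.massGrowth_base
    | succ k ih =>
      have := h.massGrowth_step (le_max_right _ _) hF ih
      convert this using 1
      rcases le_total (n - k * ϑ : ℝ) 0 with h1 | h1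
      · rw [max_eq_right h1, max_eq_right, max_eq_right] <;> push_cast <;> linarith
      · rw [max_eq_left h1]; push_cast; ring_nf
  obtain ⟨k, hk⟩ := exists_nat_ge (n / ϑ : ℝ)
  have := h1 k
  rwa [max_eq_right] at this
  rw [div_le_iff₀ hϑ] at hk
  linarith

/-- If the flux through large annuli is controlled by the mass, then the mass is conserved. -/
theorem massConserved (h : FluxSolution v F v₀) {ϑ : ℝ} (hϑ : 0 < ϑ)
    (hF : FluxBound v F ϑ) : MassConserved v v₀ := by
  obtain ⟨D, hD, hcut⟩ := exists_cutoff n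
  intro t ht
  obtain ⟨C, R₀, hC, hR₀, h1⟩ := fluxIn_le_of_massGrowth le_rfl hF (h.massGrowth_zero hϑ hF) ht
  choose ζ hζ using fun k : ℕ => hcut ((k : ℝ) + 1) (by positivity)
  have hlimR : Tendsto (fun k : ℕ => (k : ℝ) + 1) atTop atTop :=
    tendsto_atTop_add_const_right _ _ tendsto_natCast_atTop_atTop
  have hζ1 : ∀ x, Tendsto (fun k => ζ k x) atTop (𝓝 1) := fun x => by
    refine tendsto_const_nhds.congr' ?_
    filter_upwards [hlimR.eventually_ge_atTop ‖x‖] with k hk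
    exact ((hζ k).eq_one x hk).symm
  have hl0 : Tendsto (fun k => ∫ x, v₀ x * ζ k x) atTop (𝓝 (∫ x, v₀ x)) := by
    refine tendsto_integral_of_dominated_convergence (fun x => |v₀ x|)
      (fun k => h.init_int.aestronglyMeasurable.mul (hζ k).smooth.continuous.aestronglyMeasurable)
      h.init_int.abs ?_ ?_
    · refine fun k => Eventually.of_forall fun x => ?_
      rw [norm_mul, Real.norm_eq_abs, Real.norm_eq_abs, abs_of_nonneg ((hζ k).nonneg x)]
      exact mul_le_of_le_one_right (abs_nonneg _) ((hζ k).le_one x)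
    · exact Eventually.of_forall fun x => by simpa using (hζ1 x).const_mul (v₀ x)
  -- With growth exponent `0` the boundary term at scale `R` is `O(R^(-ϑ))`.
  have hl1 : Tendsto (fun k : ℕ => ∫ z in slab n 0 t, fderiv ℝ (ζ k) z.1 (F z)) atTop (𝓝 0) := by
    refine squeeze_zero_norm' (a := fun k : ℕ => D * (C * ((k : ℝ) + 1) ^ (0 - ϑ))) ?_ ?_
    · filter_upwards [hlimR.eventually_ge_atTop R₀] with k hk
      refine (h.abs_flux_integral_le (hζ k) ht).trans ?_
      calc _ = D * (fluxIn F (k + 1) t / (k + 1)) := by ring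
        _ ≤ _ := mul_le_mul_of_nonneg_left (h1 _ hk) hD
    · rw [zero_sub]
      have := ((tendsto_rpow_neg_atTop hϑ).comp hlimR).const_mul C |>.const_mul D
      simpa using this
  have hl2 : Tendsto (fun k => ∫ x, v (x, t) * ζ k x) atTop (𝓝 (∫ x, v₀ x)) := by
    have := hl0.sub hl1
    rw [sub_zero] at this
    refine this.congr fun k => ?_
    rw [h.mass_balance (hζ k).smooth (hζ k).hasCompactSupport ht]
  have hvm := (h.slice t ht).aestronglyMeasurable
  have hlim : ∀ x, Tendsto (fun k => v (x, t) * ζ k x) atTop (𝓝 (v (x, t))) := fun x => by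
    simpa using (hζ1 x).const_mul (v (x, t))
  -- Fatou's lemma gives integrability; `|v(·, t)|` then serves as the majorant that identifies the
  -- integral.
  have hint : Integrable fun x => v (x, t) := by
    refine ⟨hvm, ?_⟩
    rw [hasFiniteIntegral_iff_ofReal (h.slice_nonneg ht)]
    calc ∫⁻ x, ENNReal.ofReal (v (x, t)) =
          ∫⁻ x, liminf (fun k => ENNReal.ofReal (v (x, t) * ζ k x)) atTop := by
          refine lintegral_congr fun x => ?_
          exact ((ENNReal.tendsto_ofReal (hlim x)).liminf_eq).symm
      _ ≤ liminf (fun k => ∫⁻ x, ENNReal.ofReal (v (x, t) * ζ k x)) atTop := by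
          refine lintegral_liminf_le' fun k => ?_
          exact (hvm.mul (hζ k).smooth.continuous.aestronglyMeasurable).aemeasurable.ennreal_ofReal
      _ = ENNReal.ofReal (∫ x, v₀ x) := by
          simp_rw [h.lintegral_slice_mul (hζ _).smooth.continuous (hζ _).hasCompactSupport
            (hζ _).nonneg ht]
          exact (ENNReal.tendsto_ofReal hl2).liminf_eq
      _ < ⊤ := ENNReal.ofReal_lt_top
  refine ⟨hint, ?_⟩
  refine tendsto_nhds_unique ?_ hl2
  refine tendsto_integral_of_dominated_convergence (fun x => |v (x, t)|)
    (fun k => hvm.mul (hζ k).smooth.continuous.aestronglyMeasurable) hint.abs ?_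
    (Eventually.of_forall hlim)
  refine fun k => Eventually.of_forall fun x => ?_
  rw [norm_mul, Real.norm_eq_abs, Real.norm_eq_abs, abs_of_nonneg ((hζ k).nonneg x)]
  exact mul_le_of_le_one_right (abs_nonneg _) ((hζ k).le_one x)

end FluxSolution

end ParabolicSystem

/-! ### The flux law in an exterior domain and the energy identity there. -/

namespace ParabolicSystem

variable {n : ℕ}

theorem _root_.MeasureTheory.LocallyIntegrableOn.integrable_smul_of_tsupport_subset {X H : Type*}
    [TopologicalSpace X] [TopologicalSpace.PseudoMetrizableSpace X] [MeasurableSpace X]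
    [BorelSpace X] [NormedAddCommGroup H] [NormedSpace ℝ H] {μ : Measure X} {O : Set X}
    {f : X → H} {q : X → ℝ} (hf : LocallyIntegrableOn f O μ) (hq : Continuous q)
    (hqc : HasCompactSupport q) (hqO : tsupport q ⊆ O) : Integrable (fun z => q z • f z) μ := by
  obtain ⟨D, hD⟩ := hqc.exists_bound_of_continuous hq
  have h1 : IntegrableOn f (tsupport q) μ := hf.integrableOn_compact_subset hqO hqc.isCompact
  have h2 : IntegrableOn (fun z => q z • f z) (tsupport q) μ :=
    Integrable.bdd_smul h1 D hq.aestronglyMeasurable (Eventually.of_forall hD)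
  rw [← integrableOn_univ]
  exact h2.of_forall_sdiff_eq_zero MeasurableSet.univ fun z hz => by
    simp [image_eq_zero_of_notMem_tsupport hz.2]

instance isAddHaarMeasure_space_prod : (volume : Measure (Space n × ℝ)).IsAddHaarMeasure := by
  rw [Measure.volume_eq_prod]
  infer_instance

/-- The exterior domain `{|x| > R} × (0, ∞)`. -/
def exterior (n : ℕ) (R : ℝ) : Set (Space n × ℝ) := {x | R < ‖x‖} ×ˢ Ioi 0

theorem isOpen_exterior (R : ℝ) : IsOpen (exterior n R) :=
  (isOpen_lt continuous_const continuous_norm).prod isOpen_Ioi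

theorem exterior_subset_domain (R : ℝ) : exterior n R ⊆ domain n :=
  prod_mono (subset_univ _) le_rfl

/-- The direction of the `j`-th spatial coordinate in space-time. -/
noncomputable def dirX (j : Fin n) : Space n × ℝ := (EuclideanSpace.single j 1, 0)

theorem sum_mul_dirX (p : Space n) (L : Space n × ℝ →L[ℝ] ℝ) :
    ∑ j, p j * L (dirX j) = L (p, 0) := by
  have h : (p, (0 : ℝ)) = ∑ j, p j • dirX j := by
    rw [Prod.ext_iff]
    constructor
    · rw [Prod.fst_sum]
      ext i
      simp [dirX, Finset.sum_apply, Pi.single_apply]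
    · rw [Prod.snd_sum]
      simp [dirX]
  rw [h, map_sum]
  simp

/-- Passage from vector-valued integration by parts to coordinates, where the scalar calculus of
weak derivatives applies in the directions `dirX j`. -/
theorem HasWeakGrad.hasWeakDeriv {f : Space n × ℝ → ℝ} {g : Space n × ℝ → Space n}
    (h : HasWeakGrad f g) (j : Fin n) :
    HasWeakDeriv volume (domain n) (dirX j) f (fun z => g z j) := by
  intro φ hφ
  have hd := hφ.smooth.differentiable (by simp)
  have h1 := congrArg (EuclideanSpace.proj j : Space n →L[ℝ] ℝ) (h.byParts φ (hφ.isTest le_rfl))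
  have hgc : ∀ z, gradX φ z = (InnerProductSpace.toDual ℝ (Space n)).symm
      ((fderiv ℝ φ z).comp (ContinuousLinearMap.inl ℝ (Space n) ℝ)) := fun z => by
    refine ext_inner_left ℝ fun p => ?_
    rw [inner_gradX (hd z), real_inner_comm, InnerProductSpace.toDual_symm_apply]
    rfl
  have hcont : Continuous (gradX φ) := by
    rw [funext hgc]
    exact (LinearIsometryEquiv.continuous _).comp
      ((hφ.smooth.continuous_fderiv (by simp)).clm_comp continuous_const)
  have hz : ∀ z ∉ tsupport φ, gradX φ z = 0 := fun z hz => by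
    refine ext_inner_left ℝ fun p => ?_
    rw [inner_gradX (hd z), fderiv_eq_zero_of_notMem_tsupport _ hz, inner_zero_right]
  have i1 : IntegrableOn (fun z => f z • gradX φ z) (domain n) := by
    have hsupp : HasCompactSupport (gradX φ) := HasCompactSupport.intro hφ.compact.isCompact hz
    obtain ⟨D, hD⟩ := hsupp.exists_bound_of_continuous hcont
    have h2 : IntegrableOn (fun z => f z • gradX φ z) (tsupport φ) :=
      Integrable.smul_bdd (h.locInt.integrableOn_compact_subset hφ.support hφ.compact.isCompact)
        D hcont.aestronglyMeasurable (Eventually.of_forall hD)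
    exact h2.of_forall_sdiff_eq_zero isOpen_domain.measurableSet fun z hz' => by simp [hz z hz'.2]
  have i2 : IntegrableOn (fun z => φ z • g z) (domain n) :=
    (h.locInt_grad.integrable_smul_of_tsupport_subset hφ.smooth.continuous hφ.compact
      hφ.support).integrableOn
  rw [map_neg, ← ContinuousLinearMap.integral_comp_comm _ i1,
    ← ContinuousLinearMap.integral_comp_comm _ i2] at h1
  have e : ∀ z, (gradX φ z) j = fderiv ℝ φ z (dirX j) := fun z => by
    rw [dirX, ← inner_gradX (hd z), EuclideanSpace.inner_single_left]
    simp
  have e' : ∀ p : Space n, (EuclideanSpace.proj j : Space n →L[ℝ] ℝ) p = p j := fun p => rfl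
  simp only [e', PiLp.smul_apply, smul_eq_mul, e] at h1
  rw [← setIntegral_eq_integral_of_forall_compl_eq_zero (s := domain n),
    ← setIntegral_eq_integral_of_forall_compl_eq_zero (s := domain n) (f := fun z => φ z * g z j)]
  · exact h1
  · exact fun z hz' => by simp [hφ.eq_zero hz']
  · exact fun z hz' => by
      simp [fderiv_eq_zero_of_notMem_tsupport _ fun h' => hz' (hφ.support h')]

theorem integrable_mul_fderiv {f : Space n × ℝ → ℝ} {O : Set (Space n × ℝ)}
    (hf : LocallyIntegrableOn f O) {φ : Space n × ℝ → ℝ} (hφ : TestOn O φ) (p : Space n × ℝ) :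
    Integrable fun z => f z * fderiv ℝ φ z p := by
  refine hf.integrable_mul_of_tsupport_subset (hφ.continuous_fderiv p)
    (hφ.hasCompactSupport_fderiv _) ((closure_mono fun z hz => ?_).trans
      ((isClosed_tsupport φ).closure_eq.subset.trans hφ.support))
  by_contra h'
  exact hz (fderiv_eq_zero_of_notMem_tsupport _ h')

theorem integrable_inner_gradX {F : Space n × ℝ → Space n} (hF : LocallyIntegrableOn F (domain n))
    {φ : Space n × ℝ → ℝ} (hφ : TestOn (domain n) φ) :
    Integrable fun z => inner ℝ (F z) (gradX φ z) := by
  simp_rw [inner_gradX (hφ.smooth.differentiable (by simp) _), ← sum_mul_dirX]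
  exact integrable_finsetSum _ fun j _ => integrable_mul_fderiv
    ((EuclideanSpace.proj j : Space n →L[ℝ] ℝ).locallyIntegrableOn_comp hF) hφ _

theorem FluxSolution.flux_locallyIntegrableOn {v : Space n × ℝ → ℝ} {F : Space n × ℝ → Space n}
    {v₀ : Space n → ℝ} (h : FluxSolution v F v₀) : LocallyIntegrableOn F (domain n) ∧
      LocallyIntegrableOn (fun z => ‖F z‖ ^ 2) (domain n) :=
  locallyIntegrableOn_of_memLp_slab h.flux_memLp

/-- The pointwise structure of the flux at one point: `F = w A` with a weight `w` that is bounded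
below and at most `W v^(μ-1)`, and a field `A` of linear growth that is coercive. -/
structure FluxLaw (μ c C₂ C₃ C₄ w₀ W v : ℝ) (g F : Space n) (w : ℝ) (A : Space n) : Prop where
  eq : F = w • A
  lower : 0 < v → w₀ ≤ w
  upper : 0 < v → w ≤ W * v ^ (μ - 1)
  growth : ‖A‖ ≤ C₃ * ‖g‖ + C₄ * v
  coercive : c * ‖g‖ ^ 2 - C₂ * v ^ 2 ≤ inner ℝ A g

/-- A solution that is bounded for `|x| ≥ R`, with a flux of the structure `FluxLaw` there. -/
structure ExteriorLaw (μ R L c C₂ C₃ C₄ w₀ W : ℝ) (v : Space n × ℝ → ℝ)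
    (g F : Space n × ℝ → Space n) : Prop where
  weakGrad : HasWeakGrad v g
  bound : ∀ᵐ z ∂volume.restrict (exterior n R), v z ≤ L
  law : ∀ᵐ z ∂volume.restrict (exterior n R),
    ∃ w A, FluxLaw μ c C₂ C₃ C₄ w₀ W (v z) (g z) (F z) w A

section

variable {μ R L c C₂ C₃ C₄ w₀ W : ℝ} {v : Space n × ℝ → ℝ} {g F : Space n × ℝ → Space n}
  {v₀ : Space n → ℝ}

/-- The weight `w` is uncontrolled where `v = 0`. There the gradient vanishes almost everywhere, so
the growth condition forces `A = 0` and the flux vanishes too. -/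
theorem ExteriorLaw.grad_eq_zero (he : ExteriorLaw μ R L c C₂ C₃ C₄ w₀ W v g F)
    (h : FluxSolution v F v₀) (hL : 0 ≤ L) :
    ∀ᵐ z ∂volume.restrict (exterior n R), v z = 0 → g z = 0 := by
  have h0 : ∀ᵐ z, z ∈ exterior n R → 0 ≤ v z ∧ v z ≤ L := by
    rw [← ae_restrict_iff' (isOpen_exterior R).measurableSet]
    filter_upwards [he.bound, ae_restrict_of_ae_restrict_of_subset (exterior_subset_domain R)
      h.nonneg] with z h1 h2 using ⟨h2, h1⟩
  have hj : ∀ j, ∀ᵐ z, z ∈ exterior n R → v z = 0 → g z j = 0 := fun j =>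
    HasWeakDeriv.ae_eq_zero_of_eq_zero (isOpen_exterior R) hL
      (h.locInt.mono_set (exterior_subset_domain R))
      (((EuclideanSpace.proj j : Space n →L[ℝ] ℝ).locallyIntegrableOn_comp
        he.weakGrad.locInt_grad).mono_set (exterior_subset_domain R)) h0
      (fun φ hφ => he.weakGrad.hasWeakDeriv j φ (hφ.mono (exterior_subset_domain R)))
  rw [ae_restrict_iff' (isOpen_exterior R).measurableSet]
  filter_upwards [ae_all_iff.2 hj] with z hz h1 h2
  ext j
  exact hz j h1 h2

theorem FluxLaw.flux_eq_zero {w x : ℝ} {p P A : Space n} (h : FluxLaw μ c C₂ C₃ C₄ w₀ W x p P w A)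
    (hx : x = 0) (hp : p = 0) : P = 0 := by
  have := h.growth
  simp only [hx, hp, norm_zero, mul_zero, add_zero] at this
  rw [h.eq, norm_le_zero_iff.1 this, smul_zero]

/-- The lower bound on the weight gives `‖A‖ ≤ ‖P‖ / w₀`; Young's inequality in the coercivity
estimate absorbs half of `c ‖p‖²`. -/
theorem FluxLaw.norm_grad_sq_le {w x : ℝ} {p P A : Space n}
    (h : FluxLaw μ c C₂ C₃ C₄ w₀ W x p P w A) (hx : 0 < x) (hc : 0 < c) (hw₀ : 0 < w₀) :
    ‖p‖ ^ 2 ≤ (1 / (c * w₀)) ^ 2 * ‖P‖ ^ 2 + 2 * C₂ / c * x ^ 2 := by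
  have hw : 0 < w := hw₀.trans_le (h.lower hx)
  have h1 : ‖A‖ ≤ ‖P‖ / w₀ := by
    rw [h.eq, norm_smul, Real.norm_eq_abs, abs_of_pos hw, le_div_iff₀ hw₀, mul_comm]
    exact mul_le_mul_of_nonneg_right (h.lower hx) (norm_nonneg _)
  have h2 := h.coercive.trans (real_inner_le_norm A p)
  have h3 : c * ‖p‖ ^ 2 - C₂ * x ^ 2 ≤ ‖P‖ / w₀ * ‖p‖ :=
    h2.trans (mul_le_mul_of_nonneg_right h1 (norm_nonneg _))
  have h4 : ‖P‖ / w₀ * ‖p‖ ≤ c / 2 * ‖p‖ ^ 2 + 1 / (2 * c) * (‖P‖ / w₀) ^ 2 := by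
    have : 0 ≤ 1 / (2 * c) * (‖P‖ / w₀ - c * ‖p‖) ^ 2 := by positivity
    have e : 1 / (2 * c) * (‖P‖ / w₀ - c * ‖p‖) ^ 2 =
      1 / (2 * c) * (‖P‖ / w₀) ^ 2 - ‖P‖ / w₀ * ‖p‖ + c / 2 * ‖p‖ ^ 2 := by
      field_simp
      ring
    linarith
  have h5 : c / 2 * ‖p‖ ^ 2 ≤ 1 / (2 * c) * (‖P‖ / w₀) ^ 2 + C₂ * x ^ 2 := by linarith
  have h6 : ‖p‖ ^ 2 = 2 / c * (c / 2 * ‖p‖ ^ 2) := by field_simp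
  rw [h6]
  calc _ ≤ 2 / c * (1 / (2 * c) * (‖P‖ / w₀) ^ 2 + C₂ * x ^ 2) := by gcongr
    _ = _ := by field_simp

/-- Only the flux is known to be square integrable a priori. In the exterior domain the weight bound
transfers this to the gradient, as the energy identity requires. -/
theorem ExteriorLaw.grad_sq_locallyIntegrableOn (he : ExteriorLaw μ R L c C₂ C₃ C₄ w₀ W v g F)
    (h : FluxSolution v F v₀) (hL : 0 ≤ L) (hc : 0 < c) (hC₂ : 0 ≤ C₂) (hw₀ : 0 < w₀) :
    LocallyIntegrableOn (fun z => ‖g z‖ ^ 2) (exterior n R) := by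
  have hsub := exterior_subset_domain (n := n) R
  have h1 : LocallyIntegrableOn (fun z => (1 / (c * w₀)) ^ 2 * ‖F z‖ ^ 2 + 2 * C₂ / c * L ^ 2)
      (exterior n R) := by
    refine LocallyIntegrableOn.add ?_ (locallyIntegrableOn_const _)
    exact (h.flux_locallyIntegrableOn.2.mono_set hsub).smul ((1 / (c * w₀)) ^ 2)
  refine h1.mono_of_isOpen (isOpen_exterior R) ?_ ?_
  · exact ((he.weakGrad.locInt_grad.mono_set hsub).aestronglyMeasurable.norm.pow 2)
  · filter_upwards [he.bound, he.law, ae_restrict_of_ae_restrict_of_subset hsub h.nonneg,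
      he.grad_eq_zero h hL] with z h1 ⟨w, A, h2⟩ h3 h4
    refine (Real.norm_of_nonneg (sq_nonneg ‖g z‖)).le.trans (le_trans ?_ (le_abs_self _))
    rcases h3.eq_or_lt with h5 | h5
    · rw [h4 h5.symm, norm_zero, zero_pow two_ne_zero]
      positivity
    · refine (h2.norm_grad_sq_le h5 hc hw₀).trans ?_
      gcongr

/-- The energy identity for solutions with an exterior law. -/
theorem ExteriorLaw.energy (he : ExteriorLaw μ R L c C₂ C₃ C₄ w₀ W v g F)
    (h : FluxSolution v F v₀) (hL : 0 ≤ L) (hc : 0 < c) (hC₂ : 0 ≤ C₂) (hw₀ : 0 < w₀)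
    {Φ G G' : ℝ → ℝ} (hΦ : ∀ x, 0 ≤ x → HasDerivAt Φ (G x) x)
    (hG : ∀ x, 0 ≤ x → HasDerivAt G (G' x) x) (hG' : ContinuousOn G' (Ici 0))
    {ψ : Space n × ℝ → ℝ} (hψ : TestOn (exterior n R) ψ) :
    IntegrableOn (fun z => G' (v z) * inner ℝ (F z) (g z) * ψ z +
      G (v z) * fderiv ℝ ψ z (F z, 0)) (exterior n R) ∧
    ∫ z in exterior n R, (G' (v z) * inner ℝ (F z) (g z) * ψ z +
      G (v z) * fderiv ℝ ψ z (F z, 0)) =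
    ∫ z in exterior n R, Φ (v z) * fderiv ℝ ψ z (0, 1) := by
  have hsub := exterior_subset_domain (n := n) R
  have hO := isOpen_exterior (n := n) R
  have hgl := he.weakGrad.locInt_grad.mono_set hsub
  have hFl := h.flux_locallyIntegrableOn.1.mono_set hsub
  have hg2 := he.grad_sq_locallyIntegrableOn h hL hc hC₂ hw₀
  have hF2 := h.flux_locallyIntegrableOn.2.mono_set hsub
  have hcoord : ∀ {p : Space n × ℝ → Space n}, LocallyIntegrableOn p (exterior n R) → ∀ j,
      LocallyIntegrableOn (fun z => p z j) (exterior n R) := fun hp j =>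
    (EuclideanSpace.proj j : Space n →L[ℝ] ℝ).locallyIntegrableOn_comp hp
  have habs : ∀ (p : Space n) j, |p j| ≤ ‖p‖ := fun p j => PiLp.norm_apply_le p j
  have hcoord2 : ∀ {p : Space n × ℝ → Space n}, LocallyIntegrableOn p (exterior n R) →
      LocallyIntegrableOn (fun z => ‖p z‖ ^ 2) (exterior n R) → ∀ j,
      LocallyIntegrableOn (fun z => p z j ^ 2) (exterior n R) := fun {p} hp hp2 j => by
    refine hp2.mono_of_isOpen hO ((hcoord hp j).aestronglyMeasurable.pow 2)
      (Eventually.of_forall fun z => ?_)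
    rw [norm_pow, norm_pow, norm_norm]
    exact pow_le_pow_left₀ (norm_nonneg _) (habs _ j) 2
  have h0' : ∀ᵐ z ∂volume.restrict (exterior n R), 0 ≤ v z ∧ v z ≤ L := by
    filter_upwards [he.bound, ae_restrict_of_ae_restrict_of_subset hsub h.nonneg] with z h1 h2
      using ⟨h2, h1⟩
  have h0 := (ae_restrict_iff' hO.measurableSet).1 h0'
  have hmv := (h.locInt.mono_set hsub).aestronglyMeasurable
  have hcomp : ∀ {q : ℝ → ℝ}, ContinuousOn q (Ici 0) →
      AEStronglyMeasurable (fun z => q (v z)) (volume.restrict (exterior n R)) ∧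
      ∃ C, ∀ᵐ z ∂volume.restrict (exterior n R), ‖q (v z)‖ ≤ C := by
    intro q hq
    constructor
    · have hq' : Continuous fun x => q (max x 0) := hq.comp_continuous (by fun_prop)
        fun x => le_max_right x 0
      refine (hq'.comp_aestronglyMeasurable hmv).congr ?_
      filter_upwards [h0'] with z hz
      simp [hz.1]
    · obtain ⟨C, hC⟩ := isCompact_Icc.exists_bound_of_continuousOn
        (hq.mono (Icc_subset_Ici_self : Icc 0 L ⊆ Ici 0))
      exact ⟨C, h0'.mono fun z hz => hC _ hz⟩
  have hGc : ContinuousOn G (Ici 0) := fun x hx => (hG x hx).continuousAt.continuousWithinAt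
  obtain ⟨hmG', C', hC'⟩ := hcomp hG'
  obtain ⟨hmG, C, hC⟩ := hcomp hGc
  have key := energy_identity (μ := volume) (v := dirX) (τ := ((0 : Space n), (1 : ℝ))) hO hL
    hΦ hG hG' (h.locInt.mono_set hsub) (F := fun j z => F z j) (g := fun j z => g z j)
    (hcoord hFl) (hcoord hgl) (hcoord2 hFl hF2) (hcoord2 hgl hg2) h0
    (fun j φ hφ => he.weakGrad.hasWeakDeriv j φ (hφ.mono hsub)) ?_ hψ
  · have i1 : ∀ j, IntegrableOn (fun z => G' (v z) * (F z j * g z j) * ψ z) (exterior n R) := by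
      intro j
      have hl : LocallyIntegrableOn (fun z => F z j * g z j) (exterior n R) := by
        refine (hF2.add hg2).mono_of_isOpen hO ((hcoord hFl j).aestronglyMeasurable.mul
          (hcoord hgl j).aestronglyMeasurable) (Eventually.of_forall fun z => ?_)
        have e1 := habs (F z) j
        have e2 := habs (g z) j
        rw [norm_mul, Real.norm_eq_abs, Real.norm_eq_abs, Real.norm_eq_abs]
        simp only [Pi.add_apply]
        rw [abs_of_nonneg (a := _ + _) (by positivity)]
        have : |F z j| * |g z j| ≤ ‖F z‖ * ‖g z‖ := by gcongr
        nlinarith [sq_nonneg (‖F z‖ - ‖g z‖), sq_nonneg ‖F z‖, sq_nonneg ‖g z‖]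
      have := (hl.integrable_mul_of_tsupport_subset hψ.smooth.continuous hψ.compact
        hψ.support).integrableOn (s := exterior n R)
      refine (Integrable.bdd_mul (c := C') this hmG' hC').congr (Eventually.of_forall fun z => ?_)
      simp only
      ring
    have i2 : ∀ j, IntegrableOn (fun z => G (v z) * F z j * fderiv ℝ ψ z (dirX j))
        (exterior n R) := by
      intro j
      have := (integrable_mul_fderiv (hcoord hFl j) hψ (dirX j)).integrableOn (s := exterior n R)
      refine (Integrable.bdd_mul (c := C) this hmG hC).congr (Eventually.of_forall fun z => ?_)
      simp only
      ring
    have e : ∀ z, G' (v z) * inner ℝ (F z) (g z) * ψ z + G (v z) * fderiv ℝ ψ z (F z, 0) =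
        ∑ j, (G' (v z) * (F z j * g z j) * ψ z + G (v z) * F z j * fderiv ℝ ψ z (dirX j)) := by
      intro z
      rw [Finset.sum_add_distrib, ← Finset.sum_mul, ← Finset.mul_sum, ← sum_mul_dirX,
        Finset.mul_sum]
      congr 1
      · congr 2
        simp [PiLp.inner_apply, mul_comm]
      · exact Finset.sum_congr rfl fun j _ => by ring
    have hset : ∀ {p : Space n × ℝ → ℝ}, (∀ z ∉ tsupport ψ, p z = 0) →
        ∫ z, p z = ∫ z in exterior n R, p z := fun hp =>
      (setIntegral_eq_integral_of_forall_compl_eq_zero fun z hz =>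
        hp z fun h' => hz (hψ.support h')).symm
    have i3 : ∀ j, IntegrableOn (fun z => G' (v z) * (F z j * g z j) * ψ z +
        G (v z) * F z j * fderiv ℝ ψ z (dirX j)) (exterior n R) := fun j => (i1 j).add (i2 j)
    refine ⟨?_, ?_⟩
    · simp_rw [e]
      exact integrable_finsetSum _ fun j _ => i3 j
    · simp_rw [e]
      rw [integral_finsetSum _ fun j _ => i3 j]
      rw [hset fun z hz => by simp [fderiv_eq_zero_of_notMem_tsupport _ hz]] at key
      rw [← key]
      refine Finset.sum_congr rfl fun j _ => ?_
      rw [integral_add (i1 j) (i2 j),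
        hset fun z hz => by simp [image_eq_zero_of_notMem_tsupport hz],
        hset fun z hz => by simp [fderiv_eq_zero_of_notMem_tsupport _ hz]]
  · intro φ hφ
    have hφd := hφ.mono hsub
    have hd := hφ.smooth.differentiable (by simp)
    have heq := h.equation φ (hφ.isTest hsub)
    have hset : ∀ {p : Space n × ℝ → ℝ}, (∀ z ∉ tsupport φ, p z = 0) →
        ∫ z, p z = ∫ z in domain n, p z := fun hp =>
      (setIntegral_eq_integral_of_forall_compl_eq_zero fun z hz =>
        hp z fun h' => hz (hφd.support h')).symm
    simp_rw [inner_gradX (hd _), derivT_eq (hd _), ← sum_mul_dirX] at heq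
    rw [hset fun z hz => by simp [fderiv_eq_zero_of_notMem_tsupport _ hz], ← heq,
      integral_finsetSum]
    · refine Finset.sum_congr rfl fun j _ => ?_
      rw [hset fun z hz => by simp [fderiv_eq_zero_of_notMem_tsupport _ hz]]
    · intro j _
      exact (integrable_mul_fderiv
        ((EuclideanSpace.proj j : Space n →L[ℝ] ℝ).locallyIntegrableOn_comp
          h.flux_locallyIntegrableOn.1) hφd _).integrableOn

end

end ParabolicSystem

/-! ### The energy density and the pointwise estimates for the flux. -/

namespace ParabolicSystem

variable {n : ℕ}

/-- The convex energy density with derivative `(x + δ)^s - δ^s`. -/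
noncomputable def energyDensity (s δ x : ℝ) : ℝ := (x + δ) ^ (s + 1) / (s + 1) - δ ^ s * x

/-- The derivative of the energy density. -/
noncomputable def energyDeriv (s δ x : ℝ) : ℝ := (x + δ) ^ s - δ ^ s

/-- The second derivative of the energy density. -/
noncomputable def energyDeriv2 (s δ x : ℝ) : ℝ := s * (x + δ) ^ (s - 1)

section

variable {s δ x : ℝ}

theorem hasDerivAt_energyDensity (hs : 0 < s) (hδ : 0 < δ) (hx : 0 ≤ x) :
    HasDerivAt (fun x => energyDensity s δ x - energyDensity s δ 0) (energyDeriv s δ x) x := by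
  have h1 : HasDerivAt (fun x => (x + δ) ^ (s + 1) / (s + 1)) ((x + δ) ^ s) x := by
    have := (((hasDerivAt_id x).add_const δ).rpow_const (p := s + 1)
      (Or.inl (by simp only [id]; positivity))).div_const (s + 1)
    refine this.congr_deriv ?_
    simp only [id, one_mul, add_sub_cancel_right]
    field_simp
  have h2 : HasDerivAt (fun x => δ ^ s * x) (δ ^ s) x := by
    simpa using (hasDerivAt_id x).const_mul (δ ^ s)
  exact (h1.sub h2).sub_const _

theorem hasDerivAt_energyDeriv (hδ : 0 < δ) (hx : 0 ≤ x) :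
    HasDerivAt (energyDeriv s δ) (energyDeriv2 s δ x) x := by
  have := (((hasDerivAt_id x).add_const δ).rpow_const (p := s)
      (Or.inl (by simp only [id]; positivity))).sub_const (δ ^ s)
  refine this.congr_deriv ?_
  simp [energyDeriv2]

theorem continuousOn_energyDeriv2 (hδ : 0 < δ) : ContinuousOn (energyDeriv2 s δ) (Ici 0) := by
  refine continuousOn_const.mul (ContinuousOn.rpow_const (by fun_prop) fun x hx => Or.inl ?_)
  exact (add_pos_of_nonneg_of_pos hx hδ).ne'

theorem energyDeriv_nonneg (hs : 0 < s) (hδ : 0 < δ) (hx : 0 ≤ x) : 0 ≤ energyDeriv s δ x :=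
  sub_nonneg.2 (Real.rpow_le_rpow hδ.le (by linarith) hs.le)

/-- Since `s ≤ 1`, the subtracted `δ^s` is at least `δ (x+δ)^(s-1)`, which turns `(x+δ)^s` into `x
(x+δ)^(s-1)`. Hence the cutoff term is controlled by the weight of the production term, uniformly in
`δ`. -/
theorem energyDeriv_le (hs : 0 < s) (hs1 : s ≤ 1) (hδ : 0 < δ) (hx : 0 ≤ x) :
    s * energyDeriv s δ x ≤ x * energyDeriv2 s δ x := by
  have hp : 0 < x + δ := by linarith
  have h1 : (x + δ) ^ s = (x + δ) * (x + δ) ^ (s - 1) := by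
    rw [Real.rpow_sub_one hp.ne']; field_simp
  have h2 : δ * (x + δ) ^ (s - 1) ≤ δ ^ s := by
    have h3 : δ ^ s = δ * δ ^ (s - 1) := by rw [Real.rpow_sub_one hδ.ne']; field_simp
    rw [h3]
    exact mul_le_mul_of_nonneg_left
      (Real.rpow_le_rpow_of_nonpos hδ (by linarith) (by linarith)) hδ.le
  rw [energyDeriv, energyDeriv2, h1]
  nlinarith

theorem energyDensity_nonneg (hs : 0 < s) (hδ : 0 < δ) (hx : 0 ≤ x) :
    0 ≤ energyDensity s δ x - energyDensity s δ 0 := by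
  have hm : MonotoneOn (fun x => energyDensity s δ x - energyDensity s δ 0) (Ici 0) := by
    refine monotoneOn_of_deriv_nonneg (convex_Ici 0) ?_ ?_ ?_
    · exact fun y hy => (hasDerivAt_energyDensity hs hδ hy).continuousAt.continuousWithinAt
    · exact fun y hy => (hasDerivAt_energyDensity hs hδ
        (interior_subset hy)).differentiableAt.differentiableWithinAt
    · intro y hy
      rw [(hasDerivAt_energyDensity hs hδ (interior_subset hy)).deriv]
      exact energyDeriv_nonneg hs hδ (interior_subset hy)
  simpa using hm (mem_Ici.2 le_rfl) (mem_Ici.2 hx) hx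

/-- Mean value inequality with an increasing derivative. For bounded solutions the energy near the
initial time is thereby controlled by mass. -/
theorem energyDensity_le {L : ℝ} (hs : 0 < s) (hδ : 0 < δ) (hx : 0 ≤ x) (hxL : x ≤ L) :
    energyDensity s δ x - energyDensity s δ 0 ≤ energyDeriv s δ L * x := by
  have := (convex_Icc (0 : ℝ) L).norm_image_sub_le_of_norm_hasDerivWithin_le
    (f := fun x => energyDensity s δ x - energyDensity s δ 0) (f' := energyDeriv s δ)
    (C := energyDeriv s δ L) (x := 0) (y := x)
    (fun y hy => (hasDerivAt_energyDensity hs hδ hy.1).hasDerivWithinAt) (fun y hy => ?_)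
    ⟨le_rfl, hx.trans hxL⟩ ⟨hx, hxL⟩
  · simp only [sub_self, sub_zero, Real.norm_eq_abs, abs_of_nonneg hx] at this
    exact (le_abs_self _).trans this
  · rw [Real.norm_eq_abs, abs_of_nonneg (energyDeriv_nonneg hs hδ hy.1)]
    exact sub_le_sub_right (Real.rpow_le_rpow (by linarith [hy.1]) (by linarith [hy.2]) hs.le) _

/-- In `(x+σ)^p = (x+σ)^(p-1) (x+σ)` the nonpositive power is largest at `x = 0`. A sublinear power
is traded for mass plus the small constant `σ`. -/
theorem rpow_le_mul_add {p σ : ℝ} (hp : 0 ≤ p) (hp1 : p ≤ 1) (hσ : 0 < σ) (hx : 0 ≤ x) :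
    x ^ p ≤ σ ^ (p - 1) * (x + σ) := by
  have hpos : 0 < x + σ := by linarith
  calc x ^ p ≤ (x + σ) ^ p := Real.rpow_le_rpow hx (by linarith) hp
    _ = (x + σ) ^ (p - 1) * (x + σ) := by rw [Real.rpow_sub_one hpos.ne']; field_simp
    _ ≤ _ := mul_le_mul_of_nonneg_right
      (Real.rpow_le_rpow_of_nonpos hσ (by linarith) (by linarith)) hpos.le

end

section

variable {μ c C₂ C₃ C₄ w₀ W : ℝ}

/-- The constant in the pointwise lower bound for the energy production. -/
noncomputable def energyConst (μ c C₂ C₃ C₄ W : ℝ) : ℝ :=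
  (C₂ + 2 * C₃ ^ 2 / ((1 - μ) ^ 2 * c) + 2 * C₄ / (1 - μ)) * (W * (1 - μ))

/-- Pointwise lower bound for the energy production. -/
theorem FluxLaw.energy_production {w x δ : ℝ} {p P A : Space n}
    (h : FluxLaw μ c C₂ C₃ C₄ w₀ W x p P w A) (hx : 0 < x) (hμ : μ < 1) (hμ0 : 0 < μ) (hδ : 0 < δ)
    (hc : 0 < c) (hC₂ : 0 ≤ C₂) (hC₃ : 0 ≤ C₃) (hC₄ : 0 ≤ C₄) (hw₀ : 0 < w₀) (hW : 0 ≤ W)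
    {η θ : ℝ} (hη : 0 ≤ η) (hη1 : η ≤ 1) (hθ : 0 ≤ θ)
    {l : ℝ} (hl : |l| ≤ ‖P‖) :
    c / 2 * (w * energyDeriv2 (1 - μ) δ x * ‖p‖ ^ 2) * (η ^ 2 * θ) -
        energyConst μ c C₂ C₃ C₄ W * x * θ ≤
      energyDeriv2 (1 - μ) δ x * inner ℝ P p * (η ^ 2 * θ) +
        energyDeriv (1 - μ) δ x * (2 * η * θ * l) := by
  set s := 1 - μ with hs
  have hs0 : 0 < s := by linarith
  have hs1 : s ≤ 1 := by linarith
  have hw : 0 < w := hw₀.trans_le (h.lower hx)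
  set G := energyDeriv s δ x
  set G' := energyDeriv2 s δ x with hG'
  have hG0 : 0 ≤ G := energyDeriv_nonneg hs0 hδ hx.le
  have hGG' : G ≤ x * G' / s := by
    rw [le_div_iff₀ hs0, mul_comm]; exact energyDeriv_le hs0 hs1 hδ hx.le
  have hG'0 : 0 ≤ G' := by
    have : 0 < x + δ := by linarith
    simp only [hG', energyDeriv2]; positivity
  -- the lower order term
  have hX : w * G' * x ^ 2 ≤ W * s * x := by
    have hxδ : (x + δ) ^ (s - 1) ≤ x ^ (s - 1) :=
      Real.rpow_le_rpow_of_nonpos hx (by linarith) (by linarith)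
    calc w * G' * x ^ 2 ≤ (W * x ^ (μ - 1)) * (s * x ^ (s - 1)) * x ^ 2 := by
          rw [hG', energyDeriv2]
          gcongr
          exact h.upper hx
      _ = W * s * (x ^ (μ - 1) * x ^ (s - 1) * x ^ 2) := by ring
      _ = W * s * x := by
          congr 1
          -- The exponents satisfy `(μ-1) + (s-1) + 2 = 1` precisely because `s = 1 - μ`: the lower
          -- order terms are linear in `x`.
          rw [← Real.rpow_natCast x 2, ← Real.rpow_add hx, ← Real.rpow_add hx]
          conv_rhs => rw [← Real.rpow_one x]
          congr 1
          push_cast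
          rw [hs]
          ring
  have hP : ‖P‖ ≤ w * (C₃ * ‖p‖ + C₄ * x) := by
    rw [h.eq, norm_smul, Real.norm_eq_abs, abs_of_pos hw]
    exact mul_le_mul_of_nonneg_left h.growth hw.le
  have h1 : w * (c * ‖p‖ ^ 2 - C₂ * x ^ 2) ≤ inner ℝ P p := by
    rw [h.eq, real_inner_smul_left]
    exact mul_le_mul_of_nonneg_left h.coercive hw.le
  have h2 : -(w * (C₃ * ‖p‖ + C₄ * x)) ≤ l := (neg_le_neg hP).trans (neg_le_of_abs_le hl)
  have h3 : G * (2 * η * θ * l) ≥ -(θ * (w * G' * (2 * C₃ / s * (‖p‖ * η) * x +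
      2 * C₄ / s * x ^ 2 * η))) := by
    have hA0 : 0 ≤ w * (C₃ * ‖p‖ + C₄ * x) := by positivity
    calc G * (2 * η * θ * l) = G * (2 * η * θ) * l := by ring
      _ ≥ G * (2 * η * θ) * -(w * (C₃ * ‖p‖ + C₄ * x)) :=
          mul_le_mul_of_nonneg_left h2 (by positivity)
      _ = -(G * ((2 * η * θ) * (w * (C₃ * ‖p‖ + C₄ * x)))) := by ring
      _ ≥ -(x * G' / s * ((2 * η * θ) * (w * (C₃ * ‖p‖ + C₄ * x)))) := by
          gcongr
      _ = _ := by field_simp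
  -- Young's inequality, with constants chosen so that the cutoff term uses up exactly half of the
  -- coercive term.
  have h4 : 2 * C₃ / s * (‖p‖ * η) * x ≤ c / 2 * (‖p‖ ^ 2 * η ^ 2) +
      2 * C₃ ^ 2 / (s ^ 2 * c) * x ^ 2 := by
    have h5 : 0 ≤ c / 2 * (‖p‖ * η - 2 * C₃ / (s * c) * x) ^ 2 := by positivity
    have e5 : c / 2 * (‖p‖ * η - 2 * C₃ / (s * c) * x) ^ 2 = c / 2 * (‖p‖ ^ 2 * η ^ 2) -
      2 * C₃ / s * (‖p‖ * η) * x + 2 * C₃ ^ 2 / (s ^ 2 * c) * x ^ 2 := by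
      field_simp
      ring
    linarith
  have h6 : 2 * C₄ / s * x ^ 2 * η ≤ 2 * C₄ / s * x ^ 2 :=
    mul_le_of_le_one_right (by positivity) hη1
  have hη2 : η ^ 2 ≤ 1 := pow_le_one₀ hη hη1
  set K := C₂ + 2 * C₃ ^ 2 / (s ^ 2 * c) + 2 * C₄ / s with hK
  have hK0 : 0 ≤ K := by positivity
  have h7 : G' * inner ℝ P p * (η ^ 2 * θ) ≥
      G' * (w * (c * ‖p‖ ^ 2)) * (η ^ 2 * θ) - θ * (w * G' * (C₂ * x ^ 2)) := by
    have h8 : G' * inner ℝ P p * (η ^ 2 * θ) ≥ G' * (w * (c * ‖p‖ ^ 2 - C₂ * x ^ 2)) *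
      (η ^ 2 * θ) := by gcongr
    have h9 : θ * (w * G' * (C₂ * x ^ 2)) * η ^ 2 ≤ θ * (w * G' * (C₂ * x ^ 2)) :=
      mul_le_of_le_one_right (by positivity) hη2
    calc _ ≥ _ := h8
      _ = G' * (w * (c * ‖p‖ ^ 2)) * (η ^ 2 * θ) - θ * (w * G' * (C₂ * x ^ 2)) * η ^ 2 := by ring
      _ ≥ _ := by linarith
  have h10 : θ * (w * G' * (2 * C₃ / s * (‖p‖ * η) * x + 2 * C₄ / s * x ^ 2 * η)) ≤
      θ * (w * G' * (c / 2 * (‖p‖ ^ 2 * η ^ 2) + 2 * C₃ ^ 2 / (s ^ 2 * c) * x ^ 2 +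
        2 * C₄ / s * x ^ 2)) := by gcongr
  have h11 : θ * K * (w * G' * x ^ 2) ≤ θ * K * (W * s * x) := by gcongr
  have e12 : energyConst μ c C₂ C₃ C₄ W * x * θ = θ * K * (W * s * x) := by
    rw [energyConst, hK]; ring
  rw [e12]
  calc _ ≤ c / 2 * (w * G' * ‖p‖ ^ 2) * (η ^ 2 * θ) - θ * K * (w * G' * x ^ 2) := by linarith
    _ = (G' * (w * (c * ‖p‖ ^ 2)) * (η ^ 2 * θ) - θ * (w * G' * (C₂ * x ^ 2))) -
      θ * (w * G' * (c / 2 * (‖p‖ ^ 2 * η ^ 2) + 2 * C₃ ^ 2 / (s ^ 2 * c) * x ^ 2 +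
        2 * C₄ / s * x ^ 2)) := by rw [hK]; ring
    _ ≤ _ := by linarith

/-- Pointwise upper bound for the flux where `x ≥ δ`. -/
theorem FluxLaw.norm_flux_le {w x δ : ℝ} {p P A : Space n}
    (h : FluxLaw μ c C₂ C₃ C₄ w₀ W x p P w A) (hμ : μ < 1) (hμ0 : 1 / 2 ≤ μ) (hδ : 0 < δ)
    (hδx : δ ≤ x) (hC₃ : 0 ≤ C₃) (hC₄ : 0 ≤ C₄) (hw₀ : 0 < w₀) (hW : 0 ≤ W)
    {σ : ℝ} (hσ : 0 < σ) :
    ‖P‖ ≤ σ ^ (μ - 1) * (C₃ * (w * energyDeriv2 (1 - μ) δ x * ‖p‖ ^ 2) +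
      (2 * C₃ * W / (1 - μ) + C₄ * W) * (x + σ)) := by
  set s := 1 - μ with hs
  have hs0 : 0 < s := by linarith
  have hx : 0 < x := hδ.trans_le hδx
  have hw : 0 < w := hw₀.trans_le (h.lower hx)
  have hxδ : 0 < x + δ := by linarith
  set κ := σ ^ (μ - 1) with hκ
  have hκ0 : 0 < κ := by positivity
  set G' := energyDeriv2 s δ x with hG'
  have hG'0 : 0 < G' := by simp only [hG', energyDeriv2]; positivity
  -- Young's inequality with weight `κ G'`. The value `κ = σ^(μ-1)` makes both resulting terms carry
  -- the same factor `κ` in the end, because `σ^(2μ-2) = κ²`.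
  have h1 : w * ‖p‖ ≤ κ * (w * G' * ‖p‖ ^ 2) + κ⁻¹ * (w / G') := by
    have h2 : w * ‖p‖ ≤ w * (κ * G' * ‖p‖ ^ 2 + (κ * G')⁻¹) := by
      refine mul_le_mul_of_nonneg_left ?_ hw.le
      have hy : 0 < κ * G' := by positivity
      have : 0 ≤ (κ * G')⁻¹ * (κ * G' * ‖p‖ - 1) ^ 2 := by positivity
      have e : (κ * G')⁻¹ * (κ * G' * ‖p‖ - 1) ^ 2 =
        κ * G' * ‖p‖ ^ 2 + (κ * G')⁻¹ - 2 * ‖p‖ := by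
        field_simp; ring
      linarith [norm_nonneg p]
    refine h2.trans (le_of_eq ?_)
    field_simp
  -- Here `x ≥ δ` is needed: it gives `x + δ ≤ 2x`, so that `G'` is bounded below by a multiple of
  -- `x^(s-1)`.
  have h3 : w / G' ≤ 2 * W / s * x ^ (2 * μ - 1) := by
    rw [div_le_iff₀ hG'0, hG', energyDeriv2]
    have h4 : (2 * x) ^ (s - 1) ≤ (x + δ) ^ (s - 1) :=
      Real.rpow_le_rpow_of_nonpos hxδ (by linarith) (by linarith)
    have h5 : (2:ℝ)⁻¹ ≤ 2 ^ (s - 1) := by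
      rw [← Real.rpow_neg_one]
      exact Real.rpow_le_rpow_of_exponent_le (by norm_num) (by linarith)
    calc w ≤ W * x ^ (μ - 1) := h.upper hx
      _ = 2 * W / s * x ^ (2 * μ - 1) * (s * (2⁻¹ * x ^ (s - 1))) := by
          have : x ^ (μ - 1) = x ^ (2 * μ - 1) * x ^ (s - 1) := by
            rw [← Real.rpow_add hx]; congr 1; rw [hs]; ring
          rw [this]
          field_simp
      _ ≤ 2 * W / s * x ^ (2 * μ - 1) * (s * (2 ^ (s - 1) * x ^ (s - 1))) := by gcongr
      _ = 2 * W / s * x ^ (2 * μ - 1) * (s * (2 * x) ^ (s - 1)) := by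
          rw [Real.mul_rpow (by norm_num) hx.le]
      _ ≤ _ := by gcongr
  have h6 : κ⁻¹ * x ^ (2 * μ - 1) ≤ κ * (x + σ) := by
    -- The exponent `2μ - 1` is nonnegative because `μ ≥ 1/2`.
    have h7 := rpow_le_mul_add (p := 2 * μ - 1) (by linarith) (by linarith) hσ hx.le
    have h8 : σ ^ (2 * μ - 1 - 1) = κ * κ := by
      rw [hκ, ← Real.rpow_add hσ]; congr 1; ring
    rw [h8] at h7
    rw [inv_mul_le_iff₀ hκ0]
    linarith
  have h9 : w * x ≤ W * (κ * (x + σ)) := by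
    calc w * x ≤ W * x ^ (μ - 1) * x := mul_le_mul_of_nonneg_right (h.upper hx) hx.le
      _ = W * x ^ μ := by rw [Real.rpow_sub_one hx.ne']; field_simp
      _ ≤ _ := mul_le_mul_of_nonneg_left (rpow_le_mul_add (by linarith) hμ.le hσ hx.le) hW
  have hP : ‖P‖ ≤ C₃ * (w * ‖p‖) + C₄ * (w * x) := by
    rw [h.eq, norm_smul, Real.norm_eq_abs, abs_of_pos hw]
    refine (mul_le_mul_of_nonneg_left h.growth hw.le).trans (le_of_eq (by ring))
  calc ‖P‖ ≤ C₃ * (κ * (w * G' * ‖p‖ ^ 2) + κ⁻¹ * (2 * W / s * x ^ (2 * μ - 1))) +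
        C₄ * (W * (κ * (x + σ))) := by
        refine hP.trans ?_
        gcongr
        exact h1.trans (by gcongr)
    _ = C₃ * (κ * (w * G' * ‖p‖ ^ 2)) + C₃ * (2 * W / s) * (κ⁻¹ * x ^ (2 * μ - 1)) +
        C₄ * (W * (κ * (x + σ))) := by ring
    _ ≤ C₃ * (κ * (w * G' * ‖p‖ ^ 2)) + C₃ * (2 * W / s) * (κ * (x + σ)) +
        C₄ * (W * (κ * (x + σ))) := by gcongr
    _ = _ := by ring

end

end ParabolicSystem

/-! ### Annular and temporal cutoffs; the flux where the solution is not small. -/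

namespace ParabolicSystem

variable {n : ℕ}

/-- The cutoff at scale `2r` times the complement of the cutoff at scale `r/2`. -/
theorem exists_annular_cutoff (n : ℕ) : ∃ D : ℝ, 0 ≤ D ∧ ∀ r : ℝ, 0 < r → ∃ η : Space n → ℝ,
    ContDiff ℝ ∞ η ∧ HasCompactSupport η ∧ (∀ x, 0 ≤ η x) ∧ (∀ x, η x ≤ 1) ∧
    (∀ x ∈ annulus n r, η x = 1) ∧ (∀ x, ‖x‖ ≤ r / 2 → η x = 0) ∧
    (∀ x, 4 * r ≤ ‖x‖ → η x = 0) ∧ ∀ x, ‖fderiv ℝ η x‖ ≤ D / r := by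
  obtain ⟨D, hD, hcut⟩ := exists_cutoff n
  refine ⟨D / 2 + 2 * D, by positivity, fun r hr => ?_⟩
  obtain ⟨a, ha⟩ := hcut (2 * r) (by positivity)
  obtain ⟨b, hb⟩ := hcut (r / 2) (by positivity)
  refine ⟨fun x => a x * (1 - b x), ha.smooth.mul (contDiff_const.sub hb.smooth),
    ha.hasCompactSupport.mul_right, fun x => mul_nonneg (ha.nonneg x) (sub_nonneg.2 (hb.le_one x)),
    fun x => mul_le_one₀ (ha.le_one x) (sub_nonneg.2 (hb.le_one x)) (by linarith [hb.nonneg x]),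
    fun x hx => ?_, fun x hx => ?_, fun x hx => ?_, fun x => ?_⟩
  · simp only
    rw [ha.eq_one x hx.2, hb.eq_zero x (by linarith [hx.1])]; norm_num
  · simp only
    rw [hb.eq_one x hx]; norm_num
  · simp only
    rw [ha.eq_zero x (by linarith)]; norm_num
  · have h1 := (ha.smooth.differentiable (by simp) x).hasFDerivAt
    have h2 := (hb.smooth.differentiable (by simp) x).hasFDerivAt.const_sub 1
    have h3 : HasFDerivAt (fun x => a x * (1 - b x)) _ x := h1.mul h2
    rw [h3.fderiv]
    refine (norm_add_le _ _).trans ?_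
    rw [norm_smul, norm_smul, norm_neg, Real.norm_of_nonneg (ha.nonneg x),
      Real.norm_of_nonneg (sub_nonneg.2 (hb.le_one x))]
    have h3 := hb.fderiv_le x
    have h4 := ha.fderiv_le x
    calc _ ≤ 1 * (D / (r / 2)) + 1 * (D / (2 * r)) := by
          gcongr
          · exact ha.le_one x
          · linarith [hb.nonneg x]
      _ = _ := by field_simp; ring

/-- The cutoff rises on `[h, 2h]` and falls on `[T, T+1]`; `2h < T` keeps the two transitions apart.
One-sided bounds on the derivative suffice because it will multiply a nonnegative energy, so the
fall has a favourable sign. -/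
theorem exists_time_cutoff : ∃ M : ℝ, 0 ≤ M ∧ ∀ h T : ℝ, 0 < h → 2 * h < T → ∃ θ : ℝ → ℝ,
    ContDiff ℝ ∞ θ ∧ (∀ t, 0 ≤ θ t) ∧ (∀ t, θ t ≤ 1) ∧ (∀ t, 2 * h ≤ t → t ≤ T → θ t = 1) ∧
    (∀ t, t ≤ h → θ t = 0) ∧ (∀ t, T + 1 ≤ t → θ t = 0) ∧
    (∀ t ∈ Icc h (2 * h), deriv θ t ≤ M / h) ∧ ∀ t ∉ Icc h (2 * h), deriv θ t ≤ 0 := by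
  have hst : ContDiff ℝ ∞ Real.smoothTransition := Real.smoothTransition.contDiff
  obtain ⟨M, hM⟩ := isCompact_Icc.exists_bound_of_continuousOn
    ((hst.continuous_deriv (by simp)).continuousOn (s := Icc 0 1))
  refine ⟨M, (norm_nonneg _).trans (hM 0 (by simp)), fun h T hh hT => ?_⟩
  have hd : ∀ t, HasDerivAt Real.smoothTransition (deriv Real.smoothTransition t) t := fun t =>
    (hst.differentiable (by simp) t).hasDerivAt
  refine ⟨fun t => Real.smoothTransition ((t - h) / h) * Real.smoothTransition (T + 1 - t),
    (hst.comp ((contDiff_id.sub contDiff_const).div_const h)).mul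
      (hst.comp (contDiff_const.sub contDiff_id)), fun t => mul_nonneg
    (Real.smoothTransition.nonneg _) (Real.smoothTransition.nonneg _), fun t => mul_le_one₀
    (Real.smoothTransition.le_one _) (Real.smoothTransition.nonneg _)
    (Real.smoothTransition.le_one _), fun t h1 h2 => ?_, fun t h1 => ?_, fun t h1 => ?_,
    fun t ht => ?_, fun t ht => ?_⟩
  · simp only
    rw [Real.smoothTransition.one_of_one_le (by rw [le_div_iff₀ hh]; linarith),
      Real.smoothTransition.one_of_one_le (by linarith), one_mul]
  · simp only
    rw [Real.smoothTransition.zero_of_nonpos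
      (div_nonpos_of_nonpos_of_nonneg (by linarith) hh.le), zero_mul]
  · simp only
    rw [Real.smoothTransition.zero_of_nonpos (x := T + 1 - t) (by linarith), mul_zero]
  · have h1 : (fun t => Real.smoothTransition ((t - h) / h) * Real.smoothTransition (T + 1 - t))
        =ᶠ[𝓝 t] fun t => Real.smoothTransition ((t - h) / h) := by
      filter_upwards [Iio_mem_nhds (ht.2.trans_lt hT)] with y hy
      rw [Real.smoothTransition.one_of_one_le (x := T + 1 - y) (by linarith [mem_Iio.1 hy]), mul_one]
    rw [h1.deriv_eq]
    have h2 : HasDerivAt (fun t => (t - h) / h) (1 / h) t :=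
      ((hasDerivAt_id t).sub_const h).div_const h
    have h3 : HasDerivAt (fun t => Real.smoothTransition ((t - h) / h))
        (deriv Real.smoothTransition ((t - h) / h) * (1 / h)) t := (hd _).comp t h2
    rw [h3.deriv, mul_one_div]
    refine div_le_div_of_nonneg_right ((le_abs_self _).trans (hM _ ⟨?_, ?_⟩)) hh.le
    · exact div_nonneg (by linarith [ht.1]) hh.le
    · rw [div_le_one hh]; linarith [ht.2]
  · rcases lt_or_ge t h with h1 | h1
    · have : (fun t => Real.smoothTransition ((t - h) / h) * Real.smoothTransition (T + 1 - t))
          =ᶠ[𝓝 t] fun _ => 0 := by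
        filter_upwards [Iio_mem_nhds h1] with y hy
        rw [Real.smoothTransition.zero_of_nonpos
          (div_nonpos_of_nonpos_of_nonneg (by linarith [mem_Iio.1 hy]) hh.le), zero_mul]
      rw [this.deriv_eq]; simp
    · have h2 : 2 * h < t := by
        by_contra! h3
        exact ht ⟨h1, h3⟩
      have : (fun t => Real.smoothTransition ((t - h) / h) * Real.smoothTransition (T + 1 - t))
          =ᶠ[𝓝 t] fun t => Real.smoothTransition (T + 1 - t) := by
        filter_upwards [Ioi_mem_nhds h2] with y hy
        rw [Real.smoothTransition.one_of_one_le
          (by rw [le_div_iff₀ hh]; linarith [mem_Ioi.1 hy]), one_mul]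
      rw [this.deriv_eq]
      have ha : Antitone fun t => Real.smoothTransition (T + 1 - t) := fun x y hxy =>
        Real.smoothTransition.monotone (by linarith)
      exact ha.deriv_nonpos

section

variable {μ R L c C₂ C₃ C₄ w₀ W : ℝ} {v : Space n × ℝ → ℝ} {g F : Space n × ℝ → Space n}
  {v₀ : Space n → ℝ}

/-- The initial layer contributes little energy where the initial datum vanishes. -/
theorem FluxSolution.initial_layer (h : FluxSolution v F v₀) {Φ : ℝ → ℝ} {Q L M : ℝ} (hQ : 0 ≤ Q)
    (hM : 0 ≤ M) (hΦ0 : ∀ x, 0 ≤ x → 0 ≤ Φ x) (hΦ : ∀ x, 0 ≤ x → x ≤ L → Φ x ≤ Q * x)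
    {O : Set (Space n × ℝ)} (hOd : O ⊆ domain n)
    (hb : ∀ᵐ z ∂volume.restrict O, v z ≤ L)
    {ζ : Space n → ℝ} (hζ : ContDiff ℝ ∞ ζ) (hζc : HasCompactSupport ζ) (hζ0 : ∀ x, 0 ≤ ζ x)
    {a ε : ℝ} (ha : 0 < a) (hε : ∀ t ∈ Icc a (2 * a), ∫ x, v (x, t) * ζ x ≤ ε)
    {θ : ℝ → ℝ} (h1 : ∀ t ∈ Icc a (2 * a), deriv θ t ≤ M / a)
    (h2 : ∀ t ∉ Icc a (2 * a), deriv θ t ≤ 0) :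
    ∫ z in O, Φ (v z) * (ζ z.1 * deriv θ z.2) ≤ Q * M * ε := by
  set B : Set (Space n × ℝ) := univ ×ˢ Icc a (2 * a) with hB
  have hBm : MeasurableSet B := MeasurableSet.univ.prod measurableSet_Icc
  have hBd : B ⊆ domain n := prod_mono le_rfl fun t ht => ha.trans_le ht.1
  have hqi : IntegrableOn (fun z => v z * ζ z.1) B := by
    obtain ⟨D, hD⟩ := hζc.exists_bound_of_continuous hζ.continuous
    have h3 : IntegrableOn v (tsupport ζ ×ˢ Icc a (2 * a)) :=
      h.locInt.integrableOn_compact_subset ((prod_mono (subset_univ _) le_rfl).trans hBd)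
        (hζc.isCompact.prod isCompact_Icc)
    have h4 : IntegrableOn (fun z => v z * ζ z.1) (tsupport ζ ×ˢ Icc a (2 * a)) :=
      Integrable.mul_bdd h3 (hζ.continuous.comp continuous_fst).aestronglyMeasurable
        (Eventually.of_forall fun z => hD z.1)
    refine h4.of_forall_sdiff_eq_zero hBm fun z hz => ?_
    have : z.1 ∉ tsupport ζ := fun h' => hz.2 ⟨h', hz.1.2⟩
    simp [image_eq_zero_of_notMem_tsupport this]
  have hB0 : ∀ᵐ z ∂volume.restrict B, 0 ≤ v z * ζ z.1 := by
    filter_upwards [ae_restrict_of_ae_restrict_of_subset hBd h.nonneg] with z hz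
      using mul_nonneg hz (hζ0 _)
  have hBi : ∫ z in B, v z * ζ z.1 ≤ a * ε := by
    have hr : (volume : Measure (Space n × ℝ)).restrict B =
        (volume : Measure (Space n)).prod (volume.restrict (Icc a (2 * a))) := by
      rw [hB, Measure.volume_eq_prod, ← Measure.prod_restrict, Measure.restrict_univ]
    rw [IntegrableOn, hr] at hqi
    rw [hr, integral_prod_symm _ hqi]
    calc _ ≤ ∫ t in Icc a (2 * a), ε :=
          setIntegral_mono_on hqi.integral_prod_right (integrable_const _) measurableSet_Icc hε
      _ = a * ε := by
          rw [setIntegral_const, Real.volume_real_Icc_of_le (by linarith), smul_eq_mul]; ring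
  have hBi0 : 0 ≤ ∫ z in B, v z * ζ z.1 := integral_nonneg_of_ae hB0
  have hε0 : 0 ≤ ε := by
    by_contra! hneg
    linarith [mul_neg_of_pos_of_neg ha hneg]
  -- A non-integrable integrand has Bochner integral `0`, for which the bound is trivial.
  by_cases hint : IntegrableOn (fun z => Φ (v z) * (ζ z.1 * deriv θ z.2)) O
  swap
  · rw [integral_undef hint]
    positivity
  -- The slope `M / a` is multiplied by a layer of length `a`, so the final bound does not depend on
  -- `a`.
  have hi2 : Integrable (B.indicator fun z => Q * (M / a) * (v z * ζ z.1)) :=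
    IntegrableOn.integrable_indicator (hqi.const_mul (Q * (M / a))) hBm
  have hi0 : ∀ᵐ z, 0 ≤ B.indicator (fun z => Q * (M / a) * (v z * ζ z.1)) z := by
    filter_upwards [(ae_restrict_iff' hBm).1 hB0] with z hz
    by_cases hzB : z ∈ B
    · rw [indicator_of_mem hzB]
      exact mul_nonneg (by positivity) (hz hzB)
    · rw [indicator_of_notMem hzB]
  calc ∫ z in O, Φ (v z) * (ζ z.1 * deriv θ z.2)
      ≤ ∫ z in O, B.indicator (fun z => Q * (M / a) * (v z * ζ z.1)) z := by
        refine integral_mono_ae hint hi2.integrableOn ?_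
        filter_upwards [hb, ae_restrict_of_ae_restrict_of_subset hOd h.nonneg] with z hz1 hz2
        by_cases hzB : z ∈ B
        · rw [indicator_of_mem hzB]
          calc Φ (v z) * (ζ z.1 * deriv θ z.2) ≤ Φ (v z) * (ζ z.1 * (M / a)) :=
                mul_le_mul_of_nonneg_left (mul_le_mul_of_nonneg_left (h1 _ hzB.2) (hζ0 _))
                  (hΦ0 _ hz2)
            _ ≤ Q * v z * (ζ z.1 * (M / a)) :=
                mul_le_mul_of_nonneg_right (hΦ _ hz2 hz1)
                  (mul_nonneg (hζ0 _) (by positivity))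
            _ = _ := by ring
        · rw [indicator_of_notMem hzB]
          have : z.2 ∉ Icc a (2 * a) := fun h' => hzB ⟨mem_univ _, h'⟩
          exact mul_nonpos_of_nonneg_of_nonpos (hΦ0 _ hz2)
            (mul_nonpos_of_nonneg_of_nonpos (hζ0 _) (h2 _ this))
    _ ≤ ∫ z, B.indicator (fun z => Q * (M / a) * (v z * ζ z.1)) z :=
        setIntegral_le_integral hi2 hi0
    _ = Q * (M / a) * ∫ z in B, v z * ζ z.1 := by
        rw [integral_indicator hBm, integral_const_mul]
    _ ≤ Q * (M / a) * (a * ε) := by gcongr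
    _ = _ := by field_simp

/-- The constant in the pointwise flux bound. -/
noncomputable def fluxConst (μ c C₂ C₃ C₄ W : ℝ) : ℝ :=
  2 * C₃ / c * energyConst μ c C₂ C₃ C₄ W + (2 * C₃ * W / (1 - μ) + C₄ * W)

theorem energyConst_nonneg (hμ1 : μ < 1) (hc : 0 < c) (hC₂ : 0 ≤ C₂)
    (hC₄ : 0 ≤ C₄) (hW : 0 ≤ W) : 0 ≤ energyConst μ c C₂ C₃ C₄ W := by
  have : 0 < 1 - μ := by linarith
  unfold energyConst
  positivity

theorem fluxConst_nonneg (hμ1 : μ < 1) (hc : 0 < c) (hC₂ : 0 ≤ C₂) (hC₃ : 0 ≤ C₃)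
    (hC₄ : 0 ≤ C₄) (hW : 0 ≤ W) : 0 ≤ fluxConst μ c C₂ C₃ C₄ W := by
  have : 0 < 1 - μ := by linarith
  have := energyConst_nonneg (C₃ := C₃) hμ1 hc hC₂ hC₄ hW
  unfold fluxConst
  positivity

/-- The flux on the part of an annulus where the solution is not small, away from the initial
time. -/
theorem ExteriorLaw.flux_le (he : ExteriorLaw μ R L c C₂ C₃ C₄ w₀ W v g F)
    (h : FluxSolution v F v₀) (hμ : 1 / 2 ≤ μ) (hμ1 : μ < 1) (hL : 0 ≤ L) (hc : 0 < c)
    (hC₂ : 0 ≤ C₂) (hC₃ : 0 ≤ C₃) (hC₄ : 0 ≤ C₄) (hw₀ : 0 < w₀) (hW : 0 ≤ W)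
    {η : Space n → ℝ} {θ : ℝ → ℝ} {r T a δ σ : ℝ} (hr : 0 < r) (hδ : 0 < δ)
    (hσ : 0 < σ)
    (hm : massIn v (4 * r) (T + 1) ≠ ⊤)
    (hη : TestOn {x | R < ‖x‖} η) (hη0 : ∀ x, 0 ≤ η x) (hη1 : ∀ x, η x ≤ 1)
    (hηa : ∀ x ∈ annulus n r, η x = 1) (hηr : ∀ x, 4 * r ≤ ‖x‖ → η x = 0)
    (hηd : ∀ x, ‖fderiv ℝ η x‖ ≤ 1)
    (hθ : TestOn (Ioi 0) θ) (hθ0 : ∀ t, 0 ≤ θ t) (hθ1 : ∀ t, θ t ≤ 1)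
    (hθa : ∀ t, 2 * a ≤ t → t ≤ T → θ t = 1) (hθT : ∀ t, T + 1 ≤ t → θ t = 0)
    (henergy : ∫ z in exterior n R, (energyDensity (1 - μ) δ (v z) - energyDensity (1 - μ) δ 0) *
      (η z.1 ^ 2 * deriv θ z.2) ≤ 1) :
    ∫ z in annulus n r ×ˢ Ioo 0 T, (if δ ≤ v z ∧ 2 * a ≤ z.2 then ‖F z‖ else 0) ≤
      σ ^ (μ - 1) * (2 * C₃ / c + fluxConst μ c C₂ C₃ C₄ W *
        ((massIn v (4 * r) (T + 1)).toReal +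
          σ * volume.real (Metric.ball (0 : Space n) (4 * r) ×ˢ Ioo 0 (T + 1)))) := by
  have hsub := exterior_subset_domain (n := n) R
  have hOm := (isOpen_exterior (n := n) R).measurableSet
  set κ := σ ^ (μ - 1) with hκ
  have hκ0 : 0 < κ := by positivity
  set CP := fluxConst μ c C₂ C₃ C₄ W with hCP
  set K := energyConst μ c C₂ C₃ C₄ W with hK
  have hK0 : 0 ≤ K := energyConst_nonneg hμ1 hc hC₂ hC₄ hW
  have hCP0 : 0 ≤ CP := fluxConst_nonneg hμ1 hc hC₂ hC₃ hC₄ hW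
  have hCQ0 : 0 ≤ 2 * C₃ * W / (1 - μ) + C₄ * W := by
    have : 0 < 1 - μ := by linarith
    positivity
  have hs0 : 0 < 1 - μ := by linarith
  set B : Set (Space n × ℝ) := Metric.ball 0 (4 * r) ×ˢ Ioo 0 (T + 1) with hB
  have hBm : MeasurableSet B := Metric.isOpen_ball.measurableSet.prod measurableSet_Ioo
  have hBd : B ⊆ domain n := prod_mono (subset_univ _) fun t ht => ht.1
  have hBfin : volume B ≠ ⊤ := by
    rw [hB, Measure.volume_eq_prod, Measure.prod_prod]
    exact (ENNReal.mul_lt_top Metric.isBounded_ball.measure_lt_top (by simp)).ne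
  have hsupp : Function.support (fun x => η x ^ 2) ⊆ Function.support η :=
    fun x hx hx' => hx (by simp [hx'])
  have hη2 : TestOn {x | R < ‖x‖} fun x => η x ^ 2 :=
    ⟨hη.smooth.pow 2, hη.compact.mono hsupp, (closure_mono hsupp).trans hη.support⟩
  have hψ : TestOn (exterior n R) fun z : Space n × ℝ => η z.1 ^ 2 * θ z.2 :=
    testOn_prod_mul hη2 hθ
  have hψX : ∀ z p, fderiv ℝ (fun z : Space n × ℝ => η z.1 ^ 2 * θ z.2) z (p, 0) =
      2 * η z.1 * θ z.2 * fderiv ℝ η z.1 p := by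
    intro z p
    rw [hasFDerivAt_prod_mul hη2.smooth hθ.smooth]
    have := (hη.smooth.differentiable (by simp) z.1).hasFDerivAt.pow 2
    rw [this.fderiv]
    simp
    ring
  have hψT : ∀ z, fderiv ℝ (fun z : Space n × ℝ => η z.1 ^ 2 * θ z.2) z (0, 1) =
      η z.1 ^ 2 * deriv θ z.2 := by
    intro z
    rw [hasFDerivAt_prod_mul hη2.smooth hθ.smooth]
    simp
  obtain ⟨hint, heq⟩ := he.energy h hL hc hC₂ hw₀
    (fun x hx => hasDerivAt_energyDensity hs0 hδ hx)
    (fun x hx => hasDerivAt_energyDeriv hδ hx) (continuousOn_energyDeriv2 hδ) hψ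
  simp_rw [hψX, hψT] at hint heq
  set EL : Space n × ℝ → ℝ := fun z => energyDeriv2 (1 - μ) δ (v z) * inner ℝ (F z) (g z) *
    (η z.1 ^ 2 * θ z.2) + energyDeriv (1 - μ) δ (v z) *
      (2 * η z.1 * θ z.2 * fderiv ℝ η z.1 (F z)) with hEL
  have hvB : IntegrableOn v B := by
    refine ⟨h.locInt.aestronglyMeasurable.mono_measure (Measure.restrict_mono hBd le_rfl), ?_⟩
    rw [hasFiniteIntegral_iff_ofReal (ae_restrict_of_ae_restrict_of_subset hBd h.nonneg)]
    exact hm.lt_top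
  have hvBi : ∫ z in B, v z = (massIn v (4 * r) (T + 1)).toReal :=
    integral_eq_lintegral_of_nonneg_ae (ae_restrict_of_ae_restrict_of_subset hBd h.nonneg)
      hvB.aestronglyMeasurable
  have hvσ : Integrable (B.indicator fun z => v z + σ) :=
    (hvB.add (integrableOn_const hBfin)).integrable_indicator hBm
  have hannB : annulus n r ×ˢ Ioo 0 T ⊆ B := by
    refine prod_mono (fun x hx => ?_) (Ioo_subset_Ioo_right (by linarith))
    rw [mem_ball_zero_iff]
    linarith [hx.2]
  set S : Set (Space n × ℝ) := annulus n r ×ˢ Ioo 0 T with hS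
  have hSm : MeasurableSet S := measurableSet_annulus_prod r T
  have hSR : S ⊆ exterior n R := by
    refine prod_mono (fun x hx => ?_) fun t ht => ht.1
    refine hη.support (subset_tsupport _ ?_)
    simp [hηa x hx]
  -- The right side is nonnegative on the whole exterior domain: the negative part of `EL` is at
  -- most `K v`, and the first summand of `fluxConst` compensates it. Thus the inequality can be
  -- integrated over the exterior domain, where the energy identity evaluates the integral of `EL`.
  have hpt : ∀ᵐ z ∂volume.restrict (exterior n R),
      S.indicator (fun z => if δ ≤ v z ∧ 2 * a ≤ z.2 then ‖F z‖ else 0) z ≤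
      κ * (2 * C₃ / c * EL z + CP * B.indicator (fun z => v z + σ) z) := by
    filter_upwards [he.law, ae_restrict_of_ae_restrict_of_subset hsub h.nonneg,
      he.grad_eq_zero h hL] with z ⟨w, A, hlaw⟩ hv0 hg0
    have hind0 : 0 ≤ B.indicator (fun z => v z + σ) z := by
      by_cases hz : z ∈ B
      · rw [indicator_of_mem hz]; positivity
      · rw [indicator_of_notMem hz]
    rcases hv0.eq_or_lt with hv | hv
    · have hF0 := hlaw.flux_eq_zero hv.symm (hg0 hv.symm)
      have hEL0 : EL z = 0 := by simp [hEL, hF0]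
      rw [hEL0]
      refine le_trans (le_of_eq ?_) (show 0 ≤ κ * (2 * C₃ / c * 0 +
        CP * B.indicator (fun z => v z + σ) z) by rw [mul_zero, zero_add]; positivity)
      by_cases hz : z ∈ S <;> simp [hz, hF0]
    · have hprod := hlaw.energy_production hv hμ1 (by linarith) hδ hc hC₂ hC₃ hC₄ hw₀ hW
        (hη0 z.1) (hη1 z.1) (hθ0 z.2) (l := fderiv ℝ η z.1 (F z))
        (((fderiv ℝ η z.1).le_opNorm _).trans
          (mul_le_of_le_one_left (norm_nonneg _) (hηd z.1)))
      change _ ≤ EL z at hprod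
      set X := w * energyDeriv2 (1 - μ) δ (v z) * ‖g z‖ ^ 2 with hX
      have hX0 : 0 ≤ X := by
        have : 0 < w := hw₀.trans_le (hlaw.lower hv)
        have : 0 < v z + δ := by linarith
        simp only [hX, energyDeriv2]
        positivity
      by_cases hcase : z ∈ S ∧ δ ≤ v z ∧ 2 * a ≤ z.2
      · obtain ⟨hzS, hδv, ha⟩ := hcase
        rw [indicator_of_mem hzS, if_pos ⟨hδv, ha⟩, indicator_of_mem (hannB hzS)]
        rw [hηa _ hzS.1, hθa _ ha hzS.2.2.le] at hprod
        have hfl := hlaw.norm_flux_le hμ1 hμ hδ hδv hC₃ hC₄ hw₀ hW hσ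
        refine hfl.trans (mul_le_mul_of_nonneg_left ?_ hκ0.le)
        have h1 : X ≤ 2 / c * (EL z + K * (v z + σ)) := by
          have h2 : c / 2 * X ≤ EL z + K * (v z + σ) := by
            have : 0 ≤ K * σ := by positivity
            linarith
          calc X = 2 / c * (c / 2 * X) := by field_simp
            _ ≤ _ := by gcongr
        calc C₃ * X + (2 * C₃ * W / (1 - μ) + C₄ * W) * (v z + σ) ≤
            C₃ * (2 / c * (EL z + K * (v z + σ))) +
              (2 * C₃ * W / (1 - μ) + C₄ * W) * (v z + σ) := by gcongr
          _ = _ := by rw [hCP, fluxConst, ← hK]; ring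
      · have hl0 : S.indicator (fun z => if δ ≤ v z ∧ 2 * a ≤ z.2 then ‖F z‖ else 0) z = 0 := by
          by_cases hzS : z ∈ S
          · rw [indicator_of_mem hzS, if_neg fun h' => hcase ⟨hzS, h'⟩]
          · rw [indicator_of_notMem hzS]
        rw [hl0]
        refine mul_nonneg hκ0.le ?_
        by_cases hzB : z ∈ B
        · rw [indicator_of_mem hzB]
          have h1 : -(K * (v z + σ)) ≤ EL z := by
            have h2 : K * v z * θ z.2 ≤ K * v z := mul_le_of_le_one_right (by positivity) (hθ1 _)
            have h3 : 0 ≤ c / 2 * X * (η z.1 ^ 2 * θ z.2) :=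
              mul_nonneg (by positivity) (mul_nonneg (sq_nonneg _) (hθ0 _))
            have : 0 ≤ K * σ := by positivity
            linarith
          calc 0 ≤ (2 * C₃ * W / (1 - μ) + C₄ * W) * (v z + σ) := by positivity
            _ = 2 * C₃ / c * (-(K * (v z + σ))) + CP * (v z + σ) := by
                rw [hCP, fluxConst, ← hK]; ring
            _ ≤ _ := by gcongr
        · have hzero : EL z = 0 ∨ z.2 ≤ 0 := by
            by_cases hx : 4 * r ≤ ‖z.1‖
            · exact Or.inl (by simp [hEL, hηr _ hx])
            · by_cases ht : T + 1 ≤ z.2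
              · exact Or.inl (by simp [hEL, hθT _ ht])
              · right
                by_contra! h0
                exact hzB ⟨mem_ball_zero_iff.2 (not_le.1 hx), h0, not_le.1 ht⟩
          have hEL0 : EL z = 0 := by
            rcases hzero with h1 | h1
            · exact h1
            · have : θ z.2 = 0 := hθ.eq_zero (not_lt.2 h1)
              simp [hEL, this]
          rw [hEL0, mul_zero, zero_add]
          positivity
  have hrhs : IntegrableOn (fun z => κ * (2 * C₃ / c * EL z +
      CP * B.indicator (fun z => v z + σ) z)) (exterior n R) :=
    ((hint.const_mul _).add (hvσ.integrableOn.const_mul _)).const_mul _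
  calc ∫ z in S, (if δ ≤ v z ∧ 2 * a ≤ z.2 then ‖F z‖ else 0)
      = ∫ z in exterior n R,
          S.indicator (fun z => if δ ≤ v z ∧ 2 * a ≤ z.2 then ‖F z‖ else 0) z := by
        rw [setIntegral_indicator hSm, inter_eq_self_of_subset_right hSR]
    _ ≤ ∫ z in exterior n R, κ * (2 * C₃ / c * EL z +
          CP * B.indicator (fun z => v z + σ) z) := by
        refine integral_mono_of_nonneg (Eventually.of_forall fun z => ?_) hrhs hpt
        refine indicator_nonneg (fun z _ => ?_) z
        split_ifs
        · exact norm_nonneg _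
        · exact le_rfl
    _ = κ * (2 * C₃ / c * (∫ z in exterior n R, EL z) +
          CP * ∫ z in exterior n R, B.indicator (fun z => v z + σ) z) := by
        rw [integral_const_mul, integral_add (hint.const_mul _) (hvσ.integrableOn.const_mul _),
          integral_const_mul, integral_const_mul]
    _ ≤ κ * (2 * C₃ / c * 1 + CP * ∫ z, B.indicator (fun z => v z + σ) z) := by
        refine mul_le_mul_of_nonneg_left (add_le_add
          (mul_le_mul_of_nonneg_left (heq.trans_le henergy) (by positivity))
          (mul_le_mul_of_nonneg_left ?_ hCP0)) hκ0.le
        · refine setIntegral_le_integral hvσ ?_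
          filter_upwards [(ae_restrict_iff' isOpen_domain.measurableSet).1 h.nonneg] with z hz
          by_cases hzB : z ∈ B
          · rw [indicator_of_mem hzB]; exact add_nonneg (hz (hBd hzB)) hσ.le
          · rw [indicator_of_notMem hzB]; rfl
    _ = _ := by
        rw [integral_indicator hBm, integral_add hvB (integrableOn_const hBfin), hvBi,
          setIntegral_const, smul_eq_mul, mul_one, mul_comm σ]

end

end ParabolicSystem

/-! ### The flux bound on large annuli. -/

namespace ParabolicSystem

variable {n : ℕ} {μ R L c C₂ C₃ C₄ w₀ W : ℝ} {v : Space n × ℝ → ℝ} {g F : Space n × ℝ → Space n}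
  {v₀ : Space n → ℝ}

theorem FluxSolution.exists_small_time (h : FluxSolution v F v₀) {ζ : Space n → ℝ}
    (hζ : ContDiff ℝ ∞ ζ) (hζc : HasCompactSupport ζ) (hz : ∀ x, v₀ x * ζ x = 0) {ε b : ℝ}
    (hε : 0 < ε) (hb : 0 < b) :
    ∃ a, 0 < a ∧ 2 * a < b ∧ ∀ t ∈ Icc a (2 * a), ∫ x, v (x, t) * ζ x ≤ ε := by
  have hl := h.initial ζ hζ hζc
  simp only [hz, integral_zero] at hl
  have h1 := hl.eventually (ge_mem_nhds hε)
  obtain ⟨d, hd, hd'⟩ := mem_nhdsGT_iff_exists_Ioo_subset.1 h1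
  have hd0 : 0 < d := hd
  refine ⟨min d b / 4, by positivity, ?_, fun t ht => ?_⟩
  · have := min_le_right d b
    linarith
  · refine hd' ⟨lt_of_lt_of_le (by positivity) ht.1, lt_of_le_of_lt ht.2 ?_⟩
    have := min_le_left d b
    linarith

theorem volume_real_cylinder {r T : ℝ} (hr : 0 < r) (hT : 0 < T) :
    (volume : Measure (Space n × ℝ)).real (Metric.ball 0 (4 * r) ×ˢ Ioo 0 T) =
      r ^ (n : ℝ) * (volume.real (Metric.ball (0 : Space n) 4) * T) := by
  rw [Measure.volume_eq_prod, measureReal_prod_prod, Real.volume_real_Ioo_of_le hT.le, sub_zero,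
    ← mul_assoc, mul_comm 4 r]
  congr 1
  rw [Measure.real, Measure.addHaar_ball_mul_of_pos _ _ hr]
  simp [Measure.real, finrank_euclideanSpace, hr.le]

/-- The estimate on `{v ≥ δ, t ≥ 2a}` is uniform in `δ` and `a`. Letting both tend to `0` exhausts
the set where `v > 0`, and elsewhere the flux vanishes. -/
theorem ExteriorLaw.fluxBound (he : ExteriorLaw μ R L c C₂ C₃ C₄ w₀ W v g F)
    (h : FluxSolution v F v₀) (hμ : 1 / 2 ≤ μ) (hμ1 : μ < 1) (hL : 0 ≤ L) (hc : 0 < c)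
    (hC₂ : 0 ≤ C₂) (hC₃ : 0 ≤ C₃) (hC₄ : 0 ≤ C₄) (hw₀ : 0 < w₀) (hW : 0 ≤ W) :
    FluxSolution.FluxBound v F (1 - n * (1 - μ)) := by
  intro T hT
  obtain ⟨D, hD, hcut⟩ := exists_annular_cutoff n
  obtain ⟨M, hM, htime⟩ := exists_time_cutoff
  obtain ⟨ρ, hρ⟩ := h.init_supp.isCompact.isBounded.subset_closedBall 0
  have hs0 : 0 < 1 - μ := by linarith
  set V := volume.real (Metric.ball (0 : Space n) 4) * (T + 1) with hV
  set CP := fluxConst μ c C₂ C₃ C₄ W with hCP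
  have hCP0 : 0 ≤ CP := fluxConst_nonneg hμ1 hc hC₂ hC₃ hC₄ hW
  have hV0 : 0 ≤ V := by positivity
  -- The radius must satisfy `r/2 > R` and `r/2 > ρ`, so that the annular cutoff lives in the
  -- exterior domain and misses the initial datum, and `r ≥ D`, so that its gradient is at most `1`.
  refine ⟨2 * C₃ / c + CP * (1 + V), max 1 (max (2 * R + 1) (max (2 * ρ + 1) D)), by positivity,
    fun r hr hm => ?_⟩
  simp only [max_le_iff] at hr
  obtain ⟨hr1, hrR, hrρ, hrD⟩ := hr
  have hr0 : 0 < r := by linarith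
  obtain ⟨η, hηs, hηc, hη0, hη1, hηa, hηi, hηo, hηd⟩ := hcut r hr0
  have hηO : TestOn {x | R < ‖x‖} η := by
    refine ⟨hηs, hηc, ?_⟩
    have h1 : tsupport η ⊆ {x | r / 2 ≤ ‖x‖} := by
      refine closure_minimal (fun x hx => ?_) (isClosed_le continuous_const continuous_norm)
      by_contra h'
      exact hx (hηi x (not_le.1 h').le)
    exact h1.trans fun x hx => by
      have : r / 2 ≤ ‖x‖ := hx
      show R < ‖x‖
      linarith
  have hηd1 : ∀ x, ‖fderiv ℝ η x‖ ≤ 1 := fun x => (hηd x).trans ((div_le_one hr0).2 hrD)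
  have hv₀η : ∀ x, v₀ x * η x ^ 2 = 0 := by
    intro x
    by_cases hx : ‖x‖ ≤ r / 2
    · rw [hηi x hx]; ring
    · have : x ∉ tsupport v₀ := fun hx' => by
        have := mem_closedBall_zero_iff.1 (hρ hx')
        linarith
      rw [image_eq_zero_of_notMem_tsupport this, zero_mul]
  have hη2c : HasCompactSupport fun x => η x ^ 2 := hηc.mono fun x hx hx' => hx (by simp [hx'])
  -- With this choice `σ` times the volume of the cylinder is independent of `r`, while `σ^(μ-1) =
  -- r^(n(1-μ))`.
  set σ := r ^ (-(n : ℝ)) with hσ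
  have hσ0 : 0 < σ := by positivity
  set m := (massIn v (4 * r) (T + 1)).toReal with hmdef
  have hm0 : 0 ≤ m := ENNReal.toReal_nonneg
  set δ : ℕ → ℝ := fun k => 1 / ((k : ℝ) + 1) with hδ
  have hδ0 : ∀ k, 0 < δ k := fun k => by positivity
  have hδl : Tendsto δ atTop (𝓝 0) := tendsto_one_div_add_atTop_nhds_zero_nat
  have hQ0 : ∀ k, 0 ≤ energyDeriv (1 - μ) (δ k) L := fun k => energyDeriv_nonneg hs0 (hδ0 k) hL
  -- The tolerance makes the energy of the initial layer at most `1`, whatever the size of the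
  -- energy derivative at `L`; `2a < δ k` makes the layers shrink to time `0`.
  have hexa : ∀ k, ∃ a, 0 < a ∧ 2 * a < min T (δ k) ∧ ∀ t ∈ Icc a (2 * a),
      ∫ x, v (x, t) * η x ^ 2 ≤ 1 / (energyDeriv (1 - μ) (δ k) L * M + 1) := fun k => by
    have h1 : 0 < energyDeriv (1 - μ) (δ k) L * M + 1 := by
      have := mul_nonneg (hQ0 k) hM
      linarith
    exact h.exists_small_time (hηs.pow 2) hη2c hv₀η (one_div_pos.2 h1) (lt_min hT (hδ0 k))
  choose a ha0 ha2 hav using hexa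
  set S : Set (Space n × ℝ) := annulus n r ×ˢ Ioo 0 T with hS
  have hbound : ∀ k, ∫ z in S, (if δ k ≤ v z ∧ 2 * a k ≤ z.2 then ‖F z‖ else 0) ≤
      σ ^ (μ - 1) * (2 * C₃ / c + CP * (m + σ *
        volume.real (Metric.ball (0 : Space n) (4 * r) ×ˢ Ioo 0 (T + 1)))) := by
    intro k
    obtain ⟨θ, hθs, hθ0, hθ1, hθa, hθi, hθo, hθd, hθd'⟩ := htime (a k) T (ha0 k)
      ((ha2 k).trans_le (min_le_left _ _))
    have hθsub : tsupport θ ⊆ Icc (a k) (T + 1) := by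
      refine closure_minimal (fun t ht => ?_) isClosed_Icc
      by_contra h'
      rw [mem_Icc, not_and_or] at h'
      rcases h' with h' | h'
      · exact ht (hθi t (not_le.1 h').le)
      · exact ht (hθo t (not_le.1 h').le)
    have hθO : TestOn (Ioi 0) θ := ⟨hθs, isCompact_Icc.of_isClosed_subset
      (isClosed_tsupport _) hθsub, hθsub.trans fun t ht => (ha0 k).trans_le ht.1⟩
    refine he.flux_le h hμ hμ1 hL hc hC₂ hC₃ hC₄ hw₀ hW hr0 (hδ0 k) hσ0 hm hηO hη0 hη1 hηa hηo
      hηd1 hθO hθ0 hθ1 hθa hθo ?_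
    refine (h.initial_layer (hQ0 k) hM (fun x hx => energyDensity_nonneg hs0 (hδ0 k) hx)
      (fun x hx hxL => energyDensity_le hs0 (hδ0 k) hx hxL) (exterior_subset_domain R) he.bound
      (hηs.pow 2) hη2c (fun x => sq_nonneg _) (ha0 k) (hav k) hθd hθd').trans ?_
    have h1 : 0 ≤ energyDeriv (1 - μ) (δ k) L * M := mul_nonneg (hQ0 k) hM
    rw [mul_one_div, div_le_one (by linarith)]
    linarith
  have hFi : IntegrableOn (fun z => ‖F z‖) S :=
    (h.flux_integrableOn (isCompact_annulus r).measure_ne_top hT).norm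
  have hSd : S ⊆ domain n := prod_mono (subset_univ _) fun t ht => ht.1
  have hSm : MeasurableSet S := measurableSet_annulus_prod r T
  have hSR : S ⊆ exterior n R := by
    refine prod_mono (fun x hx => ?_) fun t ht => ht.1
    show R < ‖x‖
    linarith [hx.1]
  have hvm : AEMeasurable v (volume.restrict S) :=
    (h.locInt.aestronglyMeasurable.mono_measure (Measure.restrict_mono hSd le_rfl)).aemeasurable
  -- At points with `v > 0` the condition holds for all large `k`; at the others the flux is zero.
  have hlim : Tendsto (fun k => ∫ z in S, (if δ k ≤ v z ∧ 2 * a k ≤ z.2 then ‖F z‖ else 0)) atTop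
      (𝓝 (∫ z in S, ‖F z‖)) := by
    refine tendsto_integral_of_dominated_convergence (fun z => ‖F z‖) ?_ hFi ?_ ?_
    · intro k
      have hms : NullMeasurableSet {z | δ k ≤ v z ∧ 2 * a k ≤ z.2} (volume.restrict S) :=
        (nullMeasurableSet_le aemeasurable_const hvm).inter
          (measurableSet_le measurable_const measurable_snd).nullMeasurableSet
      refine (hFi.aestronglyMeasurable.indicator₀ hms).congr (Eventually.of_forall fun z => ?_)
      simp only [indicator_apply, mem_ofPred_eq]
    · refine fun k => Eventually.of_forall fun z => ?_
      split_ifs <;> simp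
    · filter_upwards [ae_restrict_of_ae_restrict_of_subset hSd h.nonneg,
        ae_restrict_of_ae_restrict_of_subset hSR (he.grad_eq_zero h hL),
        ae_restrict_of_ae_restrict_of_subset hSR he.law, ae_restrict_mem hSm]
        with z hz0 hzg ⟨w, A, hlaw⟩ hzS
      rcases hz0.eq_or_lt with hv | hv
      · have hF0 := hlaw.flux_eq_zero hv.symm (hzg hv.symm)
        simp [hF0]
      · refine tendsto_const_nhds.congr' ?_
        filter_upwards [hδl.eventually (ge_mem_nhds hv),
          hδl.eventually (ge_mem_nhds hzS.2.1)] with k h1 h2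
        rw [if_pos ⟨h1, ((ha2 k).le.trans (min_le_right _ _)).trans h2⟩]
  have hfin := le_of_tendsto' hlim hbound
  refine hfin.trans ?_
  have e1 : σ ^ (μ - 1) = r ^ (1 - (1 - n * (1 - μ))) := by
    rw [hσ, ← Real.rpow_mul hr0.le]
    congr 1
    ring
  have e2 : σ * volume.real (Metric.ball (0 : Space n) (4 * r) ×ˢ Ioo 0 (T + 1)) = V := by
    rw [volume_real_cylinder hr0 (by positivity), ← mul_assoc, hσ, ← Real.rpow_add hr0]
    simp [hV]
  rw [e1, e2, mul_comm (_ + _) (r ^ _), mul_assoc]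
  refine mul_le_mul_of_nonneg_left ?_ (by positivity)
  have h1 : 0 ≤ 2 * C₃ / c * m := by positivity
  have h2 : 0 ≤ CP * V * m := by positivity
  nlinarith

end ParabolicSystem

/-! ### Application to the system: measurability, flux law and thresholds. -/

namespace ParabolicSystem

/-- The composition of a Carathéodory function with a measurable function is measurable. -/
theorem aestronglyMeasurable_caratheodory {X Y H : Type*} [MeasurableSpace X] {μ : Measure X}
    [PseudoEMetricSpace Y] [MeasurableSpace Y] [OpensMeasurableSpace Y]
    [SecondCountableTopology Y] [NormedAddCommGroup H]
    {f : Y → X → H} {C : Set Y} (hf : ∀ y ∈ C, AEStronglyMeasurable (f y) μ)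
    (hc : ∀ᵐ x ∂μ, ContinuousOn (fun y => f y x) C) {φ : X → Y} (hφ : AEMeasurable φ μ)
    (hφC : ∀ᵐ x ∂μ, φ x ∈ C) {y₀ : Y} (hy₀ : y₀ ∈ C) :
    AEStronglyMeasurable (fun x => f (φ x) x) μ := by
  set φ' := hφ.mk φ
  -- The approximating simple functions keep their values in `C`, where the slices `f y` are
  -- measurable and where continuity permits passing to the limit.
  set a : ℕ → SimpleFunc X Y := fun k => SimpleFunc.approxOn φ' hφ.measurable_mk C y₀ hy₀ k
  have hmem : ∀ k x, a k x ∈ C := fun k x => SimpleFunc.approxOn_mem hφ.measurable_mk hy₀ k x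
  refine aestronglyMeasurable_of_tendsto_ae atTop (f := fun k x => f (a k x) x) (fun k => ?_) ?_
  · have e : (fun x => f (a k x) x) =
        fun x => ∑ y ∈ (a k).range, ((a k) ⁻¹' {y}).indicator (f y) x := by
      ext x
      rw [Finset.sum_eq_single (a k x)]
      · simp
      · intro y _ hy
        exact indicator_of_notMem (fun h' => hy h'.symm) _
      · exact fun h' => absurd (SimpleFunc.mem_range_self _ x) h'
    rw [e]
    refine Finset.aestronglyMeasurable_fun_sum _ fun y hy => ?_
    obtain ⟨x, rfl⟩ := SimpleFunc.mem_range.1 hy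
    exact (hf _ (hmem k x)).indicator ((a k).measurableSet_fiber _)
  · filter_upwards [hc, hφC, hφ.ae_eq_mk] with x h1 h2 h3
    have h4 : Tendsto (fun k => a k x) atTop (𝓝 (φ x)) := by
      rw [h3]
      exact SimpleFunc.tendsto_approxOn hφ.measurable_mk hy₀ (subset_closure (h3 ▸ h2))
    exact (h1 (φ x) h2).tendsto.comp (tendsto_nhdsWithin_iff.2
      ⟨h4, Eventually.of_forall fun k => hmem k x⟩)

namespace Data

variable {n k : ℕ} {S : Data n k} {u₀ : Fin k → Space n → ℝ}
  {u : Fin k → Space n × ℝ → ℝ} {Du : Fin k → Space n × ℝ → Space n} {i : Fin k}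

theorem aestronglyMeasurable_Aval (hS : S.Structural) (hu : S.IsWeakSolution u Du u₀)
    (hcomp : S.Compatible u Du) :
    AEStronglyMeasurable (S.Aval u Du i) (volume.restrict (domain n)) := by
  refine aestronglyMeasurable_caratheodory
    (f := fun (w : Space n × ℝ) (y : Space n × ℝ) => S.A w.1 w.2 y.1 y.2)
    (C := univ ×ˢ Ici 0) (φ := fun z => (Du i z, u i z)) (y₀ := (0, 0))
    (fun w hw => hS.A_meas w.1 w.2 hw.2) hS.A_cont ?_ ?_ ⟨mem_univ _, mem_Ici.2 le_rfl⟩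
  · exact (hu.weakGrad i).locInt_grad.aestronglyMeasurable.aemeasurable.prodMk
      (hu.weakGrad i).locInt.aestronglyMeasurable.aemeasurable
  · filter_upwards [hcomp.nonneg i] with z hz using ⟨mem_univ _, hz⟩

theorem aemeasurable_Uval (hcomp : S.Compatible u Du) :
    AEMeasurable (S.Uval u) (volume.restrict (domain n)) := by
  obtain ⟨G, hG, -⟩ := hcomp.coercive
  exact hG.locInt.aestronglyMeasurable.aemeasurable

theorem flux_ae_eq (hS : S.Structural) (hC₅ : S.C₅ = 0) (hcomp : S.Compatible u Du) :
    ∀ᵐ z ∂volume.restrict (domain n),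
      S.flux u Du i z = (S.m * S.Uval u z ^ (S.m - 1)) • S.Aval u Du i z := by
  filter_upwards [hS.B_growth, hcomp.nonneg i] with z h1 h2
  have := h1 (u i z) h2
  rw [hC₅, zero_mul, norm_le_zero_iff] at this
  rw [flux, this, add_zero]

theorem flux_memLp (hS : S.Structural) (hC₅ : S.C₅ = 0) (hu : S.IsWeakSolution u Du u₀)
    (hcomp : S.Compatible u Du) {T : ℝ} (hT : 0 < T) :
    MemLp (S.flux u Du i) 2 (volume.restrict (slab n 0 T)) := by
  have hsub : slab n 0 T ⊆ domain n := slab_subset_domain le_rfl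
  have hm : AEStronglyMeasurable (S.flux u Du i) (volume.restrict (domain n)) := by
    refine AEStronglyMeasurable.congr ?_ (EventuallyEq.symm (flux_ae_eq hS hC₅ hcomp))
    exact (((aemeasurable_Uval hcomp).pow_const _).const_mul _).aestronglyMeasurable.smul
      (aestronglyMeasurable_Aval hS hu hcomp)
  refine (hu.energy i T hT).of_le_mul (c := |S.m|)
    (hm.mono_measure (Measure.restrict_mono hsub le_rfl)) ?_
  filter_upwards [ae_restrict_of_ae_restrict_of_subset hsub (flux_ae_eq hS hC₅ hcomp)] with z hz
  rw [hz, norm_smul, norm_mul, norm_mul, norm_norm, Real.norm_eq_abs, mul_assoc]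

theorem fluxSolution (hS : S.Structural) (hC₅ : S.C₅ = 0) (hu : S.IsWeakSolution u Du u₀)
    (hcomp : S.Compatible u Du) (h0 : ∀ᵐ x, 0 ≤ u₀ i x) (h1 : Integrable (u₀ i))
    (h2 : HasCompactSupport (u₀ i)) : FluxSolution (u i) (S.flux u Du i) (u₀ i) where
  nonneg := hcomp.nonneg i
  locInt := (hu.weakGrad i).locInt
  flux_memLp _ hT := flux_memLp hS hC₅ hu hcomp hT
  equation φ hφ := by
    have hF := (locallyIntegrableOn_of_memLp_slab
      fun _ hT => flux_memLp (i := i) hS hC₅ hu hcomp hT).1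
    have i1 := (integrable_inner_gradX hF hφ.testOn).integrableOn (s := domain n)
    have i2 := (integrable_mul_fderiv (hu.weakGrad i).locInt hφ.testOn (0, 1)).integrableOn
      (s := domain n)
    have h := hu.equation i φ hφ
    simp_rw [derivT_eq (hφ.smooth.differentiable (by simp) _)] at h ⊢
    rw [integral_sub i1 i2] at h
    linarith
  slice := hu.slice i
  time_cont := hu.time_cont i
  initial := hu.initial i
  init_nonneg := h0
  init_int := h1
  init_supp := h2

/-- As `m < 1`, the weight `m U^(m-1)` decreases in `U`. The bound `U ≤ Λ` therefore gives the lower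
bound on it, and `U ≥ λ v^β` the upper bound with `v^(β(m-1)) = v^(μ-1)`. Together the two bounds on
`U` also bound `v`, where `β > 0` is used. -/
theorem exteriorLaw (hm0 : 0 < S.m) (hm1 : S.m < 1) (hS : S.Structural) (hC₅ : S.C₅ = 0)
    (hu : S.IsWeakSolution u Du u₀) (hcomp : S.Compatible u Du) {Rstar Λ : ℝ}
    (hU : ∀ᵐ z ∂volume.restrict (domain n), Rstar ≤ ‖z.1‖ → S.Uval u z ≤ Λ)
    (hβ : 0 < S.beta i) :
    ExteriorLaw (S.mexp i) Rstar ((Λ / S.lam i) ^ (1 / S.beta i)) S.c S.C₂ S.C₃ S.C₄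
      (S.m * Λ ^ (S.m - 1)) (S.m * S.lam i ^ (S.m - 1)) (u i) (Du i) (S.flux u Du i) := by
  have hsub := exterior_subset_domain (n := n) Rstar
  have hOm := (isOpen_exterior (n := n) Rstar).measurableSet
  have hlam := hS.lam_pos i
  refine ⟨hu.weakGrad i, ?_, ?_⟩
  · filter_upwards [ae_restrict_of_ae_restrict_of_subset hsub hU,
      ae_restrict_of_ae_restrict_of_subset hsub (hcomp.nonneg i),
      ae_restrict_of_ae_restrict_of_subset hsub (hcomp.lower i), ae_restrict_mem hOm]
      with z h1 h2 h3 h4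
    have h5 : u i z ^ S.beta i ≤ Λ / S.lam i := by
      rw [le_div_iff₀ hlam, mul_comm]
      exact h3.trans (h1 (le_of_lt h4.1))
    calc u i z = (u i z ^ S.beta i) ^ (1 / S.beta i) := by
          rw [← Real.rpow_mul h2, mul_one_div_cancel hβ.ne', Real.rpow_one]
      _ ≤ _ := Real.rpow_le_rpow (Real.rpow_nonneg h2 _) h5 (by positivity)
  · filter_upwards [ae_restrict_of_ae_restrict_of_subset hsub hU,
      ae_restrict_of_ae_restrict_of_subset hsub (hcomp.nonneg i),
      ae_restrict_of_ae_restrict_of_subset hsub (hcomp.lower i), ae_restrict_mem hOm,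
      ae_restrict_of_ae_restrict_of_subset hsub (flux_ae_eq (i := i) hS hC₅ hcomp),
      ae_restrict_of_ae_restrict_of_subset hsub hS.A_coercive,
      ae_restrict_of_ae_restrict_of_subset hsub hS.A_growth]
      with z h1 h2 h3 h4 h5 h6 h7
    refine ⟨_, _, h5, fun hv => ?_, fun hv => ?_, h7 _ _ h2, h6 _ _ h2⟩
    · have hUpos : 0 < S.Uval u z := lt_of_lt_of_le (by positivity) h3
      exact mul_le_mul_of_nonneg_left (Real.rpow_le_rpow_of_nonpos hUpos
        (h1 (le_of_lt h4.1)) (by linarith)) hm0.le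
    · rw [mul_assoc]
      refine mul_le_mul_of_nonneg_left ?_ hm0.le
      have h8 : 0 < S.lam i * u i z ^ S.beta i := by positivity
      calc S.Uval u z ^ (S.m - 1) ≤ (S.lam i * u i z ^ S.beta i) ^ (S.m - 1) :=
            Real.rpow_le_rpow_of_nonpos h8 h3 (by linarith)
        _ = _ := by
            rw [Real.mul_rpow hlam.le (by positivity), ← Real.rpow_mul h2, mexp,
              add_sub_cancel_right]

/-- Mass conservation for exponents above `1 - 1/n`. -/
theorem massConserved (hn : 2 ≤ n) (hm0 : 0 < S.m) (hm1 : S.m < 1) (hS : S.Structural)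
    (hC₅ : S.C₅ = 0) (hu : S.IsWeakSolution u Du u₀) (hcomp : S.Compatible u Du)
    (h0 : ∀ᵐ x, 0 ≤ u₀ i x) (h1 : Integrable (u₀ i)) (h2 : HasCompactSupport (u₀ i))
    {Rstar Λ : ℝ}
    (hU : ∀ᵐ z ∂volume.restrict (domain n), Rstar ≤ ‖z.1‖ → S.Uval u z ≤ Λ)
    (hμ : 1 - 1 / (n : ℝ) < S.mexp i) (hμ1 : S.mexp i < 1) : MassConserved (u i) (u₀ i) := by
  -- The value `β = 0` would give the exponent `1`.
  have hβ : 0 < S.beta i := by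
    refine (hS.beta_nonneg i).lt_of_ne fun h' => ?_
    rw [mexp, ← h'] at hμ1
    simp at hμ1
  have hn' : (2 : ℝ) ≤ n := by exact_mod_cast hn
  have hhalf : 1 / (n : ℝ) ≤ 1 / 2 := one_div_le_one_div_of_le (by norm_num) hn'
  -- Enlarging `Λ` to at least `1` makes the constants of the flux law positive without a sign
  -- assumption on `Λ`.
  have hΛ : 0 < max Λ 1 := lt_max_of_lt_right one_pos
  have hlam := hS.lam_pos i
  have hsol := fluxSolution hS hC₅ hu hcomp h0 h1 h2
  have hlaw := exteriorLaw hm0 hm1 hS hC₅ hu hcomp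
    (hU.mono fun z hz hR => (hz hR).trans (le_max_left _ 1)) hβ
  refine hsol.massConserved (ϑ := 1 - n * (1 - S.mexp i)) ?_
    (hlaw.fluxBound hsol (by linarith) hμ1 (by positivity) hS.c_pos hS.C₂_nonneg hS.C₃_nonneg
      hS.C₄_nonneg (by positivity) (by positivity))
  have h3 : (n : ℝ) * (1 - S.mexp i) < n * (1 / n) :=
    mul_lt_mul_of_pos_left (by linarith) (by linarith)
  rw [mul_one_div_cancel (by linarith)] at h3
  linarith

end Data

/-- Replacing the square root by its lower bound `3x` reduces the claim to `3 - 8/x ≤ 4`. -/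
theorem one_sub_one_div_le_threshold {x : ℝ} (hx : 2 ≤ x) :
    1 - 1 / x ≤ (x ^ 2 + x + 4 + √(2 * x * (7 * x + 11))) / (x ^ 2 + 5 * x + 8) := by
  have hx0 : 0 < x := by linarith
  have h1 : 3 * x ≤ √(2 * x * (7 * x + 11)) := Real.le_sqrt_of_sq_le (by nlinarith)
  rw [le_div_iff₀ (by positivity)]
  have e : (1 - 1 / x) * (x ^ 2 + 5 * x + 8) = x ^ 2 + 4 * x + 3 - 8 / x := by field_simp; ring
  have : 0 < 8 / x := by positivity
  rw [e]
  linarith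

/-- Replacing the square root by its lower bound `2x` reduces the claim to `2 - 4/x ≤ 3`. -/
theorem one_sub_one_div_le_threshold' {x : ℝ} (hx : 2 ≤ x) :
    1 - 1 / x ≤ (x ^ 2 - x + 3 + √(7 * x ^ 2 + 2 * x - 7)) / (x ^ 2 + 2 * x + 4) := by
  have hx0 : 0 < x := by linarith
  have h1 : 2 * x ≤ √(7 * x ^ 2 + 2 * x - 7) := Real.le_sqrt_of_sq_le (by nlinarith)
  rw [le_div_iff₀ (by positivity)]
  have e : (1 - 1 / x) * (x ^ 2 + 2 * x + 4) = x ^ 2 + x + 2 - 4 / x := by field_simp; ring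
  have : 0 < 4 / x := by positivity
  rw [e]
  linarith

end ParabolicSystem

theorem theorem1p4 {n k : ℕ} (hn : 2 ≤ n)
    (S : ParabolicSystem.Data n k) (hm0 : 0 < S.m) (hm1 : S.m < 1)
    (hS : S.Structural) (hC₅ : S.C₅ = 0)
    (u₀ : Fin k → ParabolicSystem.Space n → ℝ)
    (hu₀_nonneg : ∀ i, ∀ᵐ x, 0 ≤ u₀ i x)
    (hu₀_int : ∀ i, Integrable (u₀ i))
    (hu₀_supp : ∀ i, HasCompactSupport (u₀ i))
    (u : Fin k → ParabolicSystem.Space n × ℝ → ℝ)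
    (Du : Fin k → ParabolicSystem.Space n × ℝ → ParabolicSystem.Space n)
    (hu : S.IsWeakSolution u Du u₀)
    (hcomp : S.Compatible u Du)
    (Rstar Λ : ℝ)
    (hU : ∀ᵐ z ∂volume.restrict (ParabolicSystem.domain n), Rstar ≤ ‖z.1‖ → S.Uval u z ≤ Λ)
    (i : Fin k) :
    (((n : ℝ) ^ 2 + n + 4 + √(2 * n * (7 * n + 11))) / ((n : ℝ) ^ 2 + 5 * n + 8) < S.mexp i →
      S.mexp i < 1 → ParabolicSystem.MassConserved (u i) (u₀ i)) ∧
    (S.C₂ = 0 → S.C₄ = 0 →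
      ((n : ℝ) ^ 2 - n + 3 + √(7 * (n : ℝ) ^ 2 + 2 * n - 7)) / ((n : ℝ) ^ 2 + 2 * n + 4) < S.mexp i →
      S.mexp i < 1 → ParabolicSystem.MassConserved (u i) (u₀ i)) := by
  have hn' : (2 : ℝ) ≤ n := by exact_mod_cast hn
  have key : 1 - 1 / (n : ℝ) < S.mexp i → S.mexp i < 1 →
      ParabolicSystem.MassConserved (u i) (u₀ i) :=
    ParabolicSystem.Data.massConserved hn hm0 hm1 hS hC₅ hu hcomp (hu₀_nonneg i) (hu₀_int i)
      (hu₀_supp i) hU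
  exact ⟨fun h => key ((ParabolicSystem.one_sub_one_div_le_threshold hn').trans_lt h),
    fun _ _ h => key ((ParabolicSystem.one_sub_one_div_le_threshold' hn').trans_lt h)⟩
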